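/- Let $G=(V,E,w)$ be a finite simple connected graph with $|E|\ge 1$ and edge weights $w:E\to\mathbb{R}_{>0}$, let $w_{\max}=\max_{e\in E}w(e)$, $w_{\min}=\min_{e\in E}w(e)$, and let $k>0$ be real. For $S\subseteq V$, let $E(S)$ be the edge set of the induced subgraph $G[S]$, and let $d(S)=\sum_{e\in E(S)}w(e)/|S|$ be its density. A cut of $G[S]$ is a set $F\subseteq E(S)$ whose removal disconnects $G[S]$; $G[S]$ is $k$-edge-connected if $|S|\ge 2$ and every cut of $G[S]$ has total weight at least $k$. It is a maximal $k$-edge-connected subgraph if, moreover, $G[T]$ is not $k$-edge-connected for any $T\supsetneq S$. The densest $k$-edge-connected subgraph problem asks, given $(G,k)$, for a set $S\subseteq V$ of maximum density such that $G[S]$ is $k$-edge-connected. Consider, for a parameter $\gamma\in[1,2]$, the following algorithm with input $(G,k)$. 1. Find the family $G[S_1],\dots,G[S_p]$ of all maximal $k$-edge-connected subgraphs of $G$. If $p=0$, return INFEASIBLE. 2. For each $i=1,\dots,p$: set $S_i^*:=S_i$; find a set $S_i^{\mathrm{DS}}$ of maximum density among all non-empty subsets of $S_i$; put $\tau_i=w_{\min}\left(\left\lfloor\tfrac12\lceil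 d(S_i^{\mathrm{DS}})/w_{\max}\rceil\right\rfloor+1\right)$; if $k\le\gamma\tau_i$, replace $S_i^*$ by the vertex set of a $\tau_i$-edge-connected subgraph of $G[S_i^{\mathrm{DS}}]$ in which every vertex has weighted degree greater than $d(S_i^{\mathrm{DS}})$. 3. Return a set of maximum density among $S_1^*,\dots,S_p^*$. **Theorem.** For any $\gamma\in[1,2]$, this algorithm is a polynomial-time $\left(\frac{\gamma}{4}\cdot\frac{w_{\min}}{w_{\max}},\frac1\gamma\right)$-bicriteria approximation algorithm for the densest $k$-edge-connected subgraph problem. That is: (a) There are a program for the real random access machine (unit-cost arithmetic and comparisons on real numbers, no rounding of real numbers) and a polynomial $q$ such that for all $G$, $k$ and $\gamma\in[1,2]$ as above, the program with input $(G,k,\gamma)$ carries out the algorithm, i.e. computes valid values of $p$, all $S_i$, $S_i^{\mathrm{DS}}$, $S_i^*$ and of the answer, in at most $q(|V|)$ steps. (b) For all $G$, $k$ and $\gamma\in[1,2]$ as above, and for all choices that the algorithm leaves open, it returns INFEASIBLE if and only if no $G[T]$ with $T\subseteq V$ is $k$-edge-connected; otherwise it returns a set $S$ such that $G[S]$ is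 $(k/\gamma)$-edge-connected and $d(S)\ge\frac{\gamma}{4}\cdot\frac{w_{\min}}{w_{\max}}\cdot d(T)$ for every $T\subseteq V$ such that $G[T]$ is $k$-edge-connected. -/

import Mathlib

/-! ## Edge-weighted graphs, density, edge connectivity -/

/-- A simple undirected graph with positive edge weights. Only the values of `w` on edges matter. -/
structure WeightedGraph (V : Type*) where
  graph : SimpleGraph V
  w : Sym2 V → ℝ
  w_pos : ∀ e ∈ graph.edgeSet, 0 < w e

namespace WeightedGraph

variable {V : Type*} [Fintype V]

open Classical in
/-- `E(S)`: the edges of the induced subgraph `G[S]`. -/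
noncomputable def edgesIn (G : WeightedGraph V) (S : Finset V) : Finset (Sym2 V) :=
  Finset.univ.filter fun e => e ∈ G.graph.edgeSet ∧ ∀ v ∈ e, v ∈ S

/-- `w(F)`: the sum of the weights of the members of `F`. -/
noncomputable def weight (G : WeightedGraph V) (F : Finset (Sym2 V)) : ℝ :=
  ∑ e ∈ F, G.w e

/-- The density `d(S) = w(S) / |S|`. -/
noncomputable def density (G : WeightedGraph V) (S : Finset V) : ℝ :=
  G.weight (G.edgesIn S) / (S.card : ℝ)

open Classical in
/-- The weighted degree of `v` in `G[S]`. -/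
noncomputable def degIn (G : WeightedGraph V) (S : Finset V) (v : V) : ℝ :=
  G.weight ((G.edgesIn S).filter fun e => v ∈ e)

/-- The maximum edge weight of `G`. -/
noncomputable def wMax (G : WeightedGraph V) : ℝ := sSup (G.w '' G.graph.edgeSet)

/-- The minimum edge weight of `G`. -/
noncomputable def wMin (G : WeightedGraph V) : ℝ := sInf (G.w '' G.graph.edgeSet)

/-- `F` is a cut of `G[S]`: a set of edges of `G[S]` whose removal partitions `G[S]` into two
non-empty parts `X` and `S \ X` between which there are no edges. -/
def IsCut (G : WeightedGraph V) (S : Finset V) (F : Finset (Sym2 V)) : Prop :=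
  F ⊆ G.edgesIn S ∧
    ∃ X ⊆ S, X.Nonempty ∧ X ≠ S ∧
      ∀ u ∈ X, ∀ v ∈ S, v ∉ X → G.graph.Adj u v → s(u, v) ∈ F

/-- The edge connectivity of `G[S]`: the smallest weight of a cut. If `S` has at most one vertex
there is no cut and the value is `sInf ∅ = 0`, the usual convention for the trivial graph. -/
noncomputable def edgeConnectivity (G : WeightedGraph V) (S : Finset V) : ℝ :=
  sInf {x | ∃ F, G.IsCut S F ∧ G.weight F = x}

/-- `G[S]` is `k`-edge-connected. -/
def IsEdgeConnected (G : WeightedGraph V) (k : ℝ) (S : Finset V) : Prop :=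
  k ≤ G.edgeConnectivity S

/-- `G[S]` is a maximal `k`-edge-connected subgraph. -/
def IsMaximalEdgeConnected (G : WeightedGraph V) (k : ℝ) (S : Finset V) : Prop :=
  G.IsEdgeConnected k S ∧ ∀ T, S ⊂ T → ¬ G.IsEdgeConnected k T

/-- `D` is the vertex set of a densest subgraph of `G[S]` (without any constraint). -/
def IsDensestIn (G : WeightedGraph V) (S D : Finset V) : Prop :=
  D ⊆ S ∧ D.Nonempty ∧ ∀ T ⊆ S, T.Nonempty → G.density T ≤ G.density D

/-- `w_min (⌊⌈d(D) / w_max⌉ / 2⌋ + 1)`; the division by two is that of natural numbers. -/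
noncomputable def threshold (G : WeightedGraph V) (D : Finset V) : ℝ :=
  G.wMin * ((⌈G.density D / G.wMax⌉₊ / 2 + 1 : ℕ) : ℝ)

/-- `T` is the vertex set of a `threshold D`-edge-connected subgraph in `G[D]` in which every
weighted degree is greater than `d(D)`. -/
def IsMaderVariant (G : WeightedGraph V) (D T : Finset V) : Prop :=
  T ⊆ D ∧ G.IsEdgeConnected (G.threshold D) T ∧ ∀ v ∈ T, G.density D < G.degIn T v

/-- `out` (where `none` is the answer INFEASIBLE) is a correct answer of an
`(α, β)`-bicriteria approximation algorithm for the densest `k`-edge-connected subgraph problem: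
INFEASIBLE is answered exactly if there is no feasible solution, and otherwise the answer is
a `β k`-edge-connected set of density at least `α` times the optimal value. -/
def IsBicriteriaAnswer (G : WeightedGraph V) (α β k : ℝ) : Option (Finset V) → Prop
  | none => ∀ T, ¬ G.IsEdgeConnected k T
  | some S => (∃ T, G.IsEdgeConnected k T) ∧ G.IsEdgeConnected (β * k) S ∧
      ∀ T, G.IsEdgeConnected k T → α * G.density T ≤ G.density S

end WeightedGraph

/-! ## The bicriteria approximation algorithm -/

/-- The values taken by the variables of the algorithm in one execution: the family
`S_1, …, S_p`, the densest subgraphs `S_i^DS`, the sets `S_i^*`, and the answer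
(`none` is INFEASIBLE). -/
structure BicriteriaRun (V : Type*) where
  p : ℕ
  comp : Fin p → Finset V
  dense : Fin p → Finset V
  star : Fin p → Finset V
  out : Option (Finset V)

/-- `r` is an execution of the algorithm with parameter `γ` on the input `(G, k)`. The pseudocode
leaves open the order of the family, which densest subgraph and which highly connected
subgraph are found, and how ties are broken; every way to make these choices is an execution. -/
structure BicriteriaRun.IsExecution {V : Type*} [Fintype V] (r : BicriteriaRun V)
    (G : WeightedGraph V) (k γ : ℝ) : Prop where
  /-- `S_1, …, S_p` are the maximal `k`-edge-connected subgraphs, without repetition. -/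
  comp_injective : Function.Injective r.comp
  comp_range : ∀ S, (∃ i, r.comp i = S) ↔ G.IsMaximalEdgeConnected k S
  /-- If there is none, return INFEASIBLE. -/
  infeasible : r.p = 0 → r.out = none
  /-- For each `i`, find a densest subgraph of `G[S_i]`. -/
  densest : ∀ i, G.IsDensestIn (r.comp i) (r.dense i)
  /-- The set `S_i^*` when the if-condition holds, and when it does not. -/
  star_then : ∀ i, k ≤ γ * G.threshold (r.dense i) → G.IsMaderVariant (r.dense i) (r.star i)
  star_else : ∀ i, ¬ k ≤ γ * G.threshold (r.dense i) → r.star i = r.comp i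
  /-- Return a densest set among `S_1^*, …, S_p^*`. -/
  output : r.p ≠ 0 → ∃ i, r.out = some (r.star i) ∧
    ∀ j, G.density (r.star j) ≤ G.density (r.star i)

/-! ## A real random access machine

Programs are those of a small imperative language whose memory consists of arrays of natural
numbers and arrays of real numbers. Elementary commands and tests cost one step; the expressions
in them are fixed parts of the program, so this is the unit-cost measure up to a constant factor
that depends only on the program. Natural numbers (addresses, counters) can only be added and
subtracted; real numbers can be added, subtracted, multiplied, divided and compared. There are no
real constants except natural numbers, and no rounding of real numbers. -/

namespace RealRAM

/-- A memory state: `nat A i j` and `real A i j` are the cells `(i, j)` of the `A`-th arrays. -/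
structure State where
  nat : ℕ → ℕ → ℕ → ℕ
  real : ℕ → ℕ → ℕ → ℝ

/-- Expressions for natural numbers; subtraction is truncated. -/
inductive NExpr where
  | const (c : ℕ)
  | cell (A : ℕ) (i j : NExpr)
  | add (a b : NExpr)
  | sub (a b : NExpr)

/-- Expressions for real numbers; division by zero gives zero. -/
inductive RExpr where
  | ofNat (a : NExpr)
  | cell (A : ℕ) (i j : NExpr)
  | add (x y : RExpr)
  | sub (x y : RExpr)
  | mul (x y : RExpr)
  | div (x y : RExpr)

/-- Tests. -/
inductive BExpr where
  | natLT (a b : NExpr)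
  | realLT (x y : RExpr)
  | not (b : BExpr)
  | and (b c : BExpr)

/-- Programs. -/
inductive Program where
  | skip
  | setNat (A : ℕ) (i j : NExpr) (a : NExpr)
  | setReal (A : ℕ) (i j : NExpr) (x : RExpr)
  | seq (P Q : Program)
  | ite (b : BExpr) (P Q : Program)
  | loop (b : BExpr) (P : Program)

def NExpr.eval (s : State) : NExpr → ℕ
  | .const c => c
  | .cell A i j => s.nat A (i.eval s) (j.eval s)
  | .add a b => a.eval s + b.eval s
  | .sub a b => a.eval s - b.eval s

noncomputable def RExpr.eval (s : State) : RExpr → ℝ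
  | .ofNat a => (a.eval s : ℝ)
  | .cell A i j => s.real A (i.eval s) (j.eval s)
  | .add x y => x.eval s + y.eval s
  | .sub x y => x.eval s - y.eval s
  | .mul x y => x.eval s * y.eval s
  | .div x y => x.eval s / y.eval s

def BExpr.Holds (s : State) : BExpr → Prop
  | .natLT a b => a.eval s < b.eval s
  | .realLT x y => x.eval s < y.eval s
  | .not b => ¬ b.Holds s
  | .and b c => b.Holds s ∧ c.Holds s

def State.setNat (s : State) (A i j a : ℕ) : State where
  nat := fun A' i' j' => if A' = A ∧ i' = i ∧ j' = j then a else s.nat A' i' j'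
  real := s.real

def State.setReal (s : State) (A i j : ℕ) (x : ℝ) : State where
  nat := s.nat
  real := fun A' i' j' => if A' = A ∧ i' = i ∧ j' = j then x else s.real A' i' j'

/-- `Exec P s t s'`: the program `P` started in the state `s` halts after exactly `t` steps in the
state `s'`. -/
inductive Exec : Program → State → ℕ → State → Prop where
  | skip (s : State) : Exec .skip s 1 s
  | setNat (s : State) (A : ℕ) (i j a : NExpr) :
      Exec (.setNat A i j a) s 1 (s.setNat A (i.eval s) (j.eval s) (a.eval s))
  | setReal (s : State) (A : ℕ) (i j : NExpr) (x : RExpr) :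
      Exec (.setReal A i j x) s 1 (s.setReal A (i.eval s) (j.eval s) (x.eval s))
  | seq {P Q : Program} {s₁ s₂ s₃ : State} {t u : ℕ} :
      Exec P s₁ t s₂ → Exec Q s₂ u s₃ → Exec (.seq P Q) s₁ (t + u) s₃
  | ite_true {b : BExpr} {P Q : Program} {s s' : State} {t : ℕ} :
      b.Holds s → Exec P s t s' → Exec (.ite b P Q) s (t + 1) s'
  | ite_false {b : BExpr} {P Q : Program} {s s' : State} {t : ℕ} :
      ¬ b.Holds s → Exec Q s t s' → Exec (.ite b P Q) s (t + 1) s'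
  | loop_true {b : BExpr} {P : Program} {s₁ s₂ s₃ : State} {t u : ℕ} :
      b.Holds s₁ → Exec P s₁ t s₂ → Exec (.loop b P) s₂ u s₃ →
      Exec (.loop b P) s₁ (t + u + 1) s₃
  | loop_false {b : BExpr} {P : Program} {s : State} :
      ¬ b.Holds s → Exec (.loop b P) s 1 s

open Classical in
/-- The initial state on the input `G`, `k`, `γ`, where `G` has the vertices `0, …, n - 1`.
The number `n` is in the natural number array `0`, the weighted adjacency matrix (with zero for
non-edges) in the real array `0`, and `k`, `γ` are in the real array `1`. All else is zero. -/
noncomputable def input {n : ℕ} (G : WeightedGraph (Fin n)) (k γ : ℝ) : State where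
  nat := fun A i j => if A = 0 ∧ i = 0 ∧ j = 0 then n else 0
  real := fun A i j =>
    if A = 0 then
      if h : i < n ∧ j < n then
        if G.graph.Adj ⟨i, h.1⟩ ⟨j, h.2⟩ then G.w s(⟨i, h.1⟩, ⟨j, h.2⟩) else 0
      else 0
    else if A = 1 ∧ i = 0 ∧ j = 0 then k
    else if A = 1 ∧ i = 0 ∧ j = 1 then γ
    else 0

/-- The set of vertices whose indicator vector is row `i` of the natural number array `A`. -/
def State.row (s : State) (n A i : ℕ) : Finset (Fin n) :=
  Finset.univ.filter fun v => s.nat A i v.val = 1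

/-- The execution of the algorithm that a final state describes: `p` is the cell `(0, 0)` of the
natural number array `1`, the families `S_i`, `S_i^DS`, `S_i^*` are the rows of the arrays
`2`, `3`, `4`, and the answer is row `0` of the array `5`, or INFEASIBLE if the cell `(0, 1)` of
the array `1` is not equal to one. -/
def State.decode (s : State) (n : ℕ) : BicriteriaRun (Fin n) where
  p := s.nat 1 0 0
  comp := fun i => s.row n 2 i.val
  dense := fun i => s.row n 3 i.val
  star := fun i => s.row n 4 i.val
  out := if s.nat 1 0 1 = 1 then some (s.row n 5 0) else none

end RealRAM

/-! The guarantee compares everything with the density `d` of a densest subgraph `D` of a maximal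
component `C`. A feasible set `T` lies in some maximal component, so its density is at most the `d`
of that component. If `k ≤ γτ`, the set replacing `C` has all weighted degrees above `d`, hence
density at least `d / 2`. Otherwise `C` is kept: its degrees are at least `k`, so its density is at
least `k / 2 > γτ / 2`, and `2τ ≥ (w_min / w_max) d` because `c ≤ 2(⌊c/2⌋ + 1)`. As `1 ≤ γ ≤ 2`,
both cases give the factor `γ/4 · w_min/w_max`, and the connectivity is at least `τ ≥ k/γ` or `k ≥
k/γ`.

The highly connected subgraph of `D` comes from a minimality argument (`exists_noCut_le_density`).
Take a smallest non-empty `T ⊆ D` with `w(T) > d(|T| - 1)`. The two sides of a cut of `T` violate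
this inequality, so the cut itself weighs more than `d`. Singletons are cuts, which gives the
degrees; a cut heavier than `d` has more than `d / w_max` edges, which gives the connectivity `τ`
(`threshold_le_cutWeight`).

For the algorithm, call a cut light if its weight is below `k` (for components) or at most `d` (for
the replacement). A cut of `S` restricted to `T ⊆ S` does not get heavier, so a set without light
cuts is never separated by a light cut of a superset (`NoCut.subset_or_disjoint`). Splitting along
light cuts and keeping the side of a seed vertex therefore ends in the largest set around the seed
that has no light cut (`run_narrow`). Densest subgraphs are found by Dinkelbach's method, in which
the sizes of the successive sets strictly decrease (`run_densest`).

Both tasks reduce to minimizing `T ↦ c(T, Tᶜ) - b(T)`. Large weights `±M` at two vertices yield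
minimum separating cuts; the weights `deg v - 2x` maximize `w(T) - x|T|`. The minimizer is found by
push-relabel with labels at most `n`: once all positive excess has label `n`, the vertices above a
level without labels form a minimizer (`cutObjective_le`). A potential with natural number values,
initially at most `n ^ 5`, decreases in every operation, so the number of steps does not depend on
the sizes of the real weights.

Finally, the program uses only loops over `0, …, n - 1`. Every such command takes polynomially many
steps (`exec_compile`), and only the final state has to be analysed. -/

namespace RealRAM

/-! ## Programs with bounded loops -/

/-- Commands whose only loops run a counter (the cell `(0, 0)` of the natural number array `A`)
from `0` to `n - 1`, where `n` is the cell `(0, 0)` of the natural number array `0`. -/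
inductive Cmd where
  | skip
  | setNat (A : ℕ) (i j : NExpr) (a : NExpr)
  | setReal (A : ℕ) (i j : NExpr) (x : RExpr)
  | seq (P Q : Cmd)
  | ite (b : BExpr) (P Q : Cmd)
  | forN (A : ℕ) (P : Cmd)

namespace Cmd

/-- The counter cell of the natural number array `A`. -/
abbrev nvar (A : ℕ) : NExpr := .cell A (.const 0) (.const 0)

/-- The cell `(0, 0)` of the real array `A`. -/
abbrev rvar (A : ℕ) : RExpr := .cell A (.const 0) (.const 0)

def compile : Cmd → Program
  | skip => .skip
  | setNat A i j a => .setNat A i j a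
  | setReal A i j x => .setReal A i j x
  | seq P Q => .seq P.compile Q.compile
  | ite b P Q => .ite b P.compile Q.compile
  | forN A P => .seq (.setNat A (.const 0) (.const 0) (.const 0))
      (.loop (.natLT (nvar A) (nvar 0))
        (.seq P.compile (.setNat A (.const 0) (.const 0) (.add (nvar A) (.const 1)))))

open Classical in
/-- The state in which a command ends. -/
noncomputable def run : Cmd → State → State
  | skip, s => s
  | setNat A i j a, s => s.setNat A (i.eval s) (j.eval s) (a.eval s)
  | setReal A i j x, s => s.setReal A (i.eval s) (j.eval s) (x.eval s)
  | seq P Q, s => Q.run (P.run s)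
  | ite b P Q, s => if b.Holds s then P.run s else Q.run s
  | forN A P, s =>
      (fun t => (P.run t).setNat A 0 0 ((P.run t).nat A 0 0 + 1))^[s.nat 0 0 0] (s.setNat A 0 0 0)

/-- Does the command write to the natural number array `B`? -/
def writesNat : Cmd → ℕ → Bool
  | skip, _ => false
  | setNat A _ _ _, B => B == A
  | setReal _ _ _ _, _ => false
  | seq P Q, B => P.writesNat B || Q.writesNat B
  | ite _ P Q, B => P.writesNat B || Q.writesNat B
  | forN A P, B => B == A || P.writesNat B

/-- Does the command write to the real array `B`? -/
def writesReal : Cmd → ℕ → Bool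
  | skip, _ => false
  | setNat _ _ _ _, _ => false
  | setReal A _ _ _, B => B == A
  | seq P Q, B => P.writesReal B || Q.writesReal B
  | ite _ P Q, B => P.writesReal B || Q.writesReal B
  | forN _ P, B => P.writesReal B

/-- The array `0` is read-only, and loop counters are not written in the bodies of their loops. -/
def wf : Cmd → Bool
  | skip => true
  | setNat A _ _ _ => A != 0
  | setReal _ _ _ _ => true
  | seq P Q => P.wf && Q.wf
  | ite _ P Q => P.wf && Q.wf
  | forN A P => A != 0 && !P.writesNat A && P.wf

@[simp] theorem run_skip (s : State) : skip.run s = s := rfl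
@[simp] theorem run_setNat (A : ℕ) (i j a : NExpr) (s : State) :
    (setNat A i j a).run s = s.setNat A (i.eval s) (j.eval s) (a.eval s) := rfl
@[simp] theorem run_setReal (A : ℕ) (i j : NExpr) (x : RExpr) (s : State) :
    (setReal A i j x).run s = s.setReal A (i.eval s) (j.eval s) (x.eval s) := rfl
@[simp] theorem run_seq (P Q : Cmd) (s : State) : (seq P Q).run s = Q.run (P.run s) := rfl
theorem run_ite_true {b : BExpr} {s : State} (P Q : Cmd) (h : b.Holds s) :
    (ite b P Q).run s = P.run s := if_pos h
theorem run_ite_false {b : BExpr} {s : State} (P Q : Cmd) (h : ¬ b.Holds s) :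
    (ite b P Q).run s = Q.run s := if_neg h

end Cmd

/-! ### Frame rules, running time and loop invariants -/

theorem State.setNat_nat_of_ne {A B : ℕ} (h : B ≠ A) (s : State) (i j a : ℕ) :
    (s.setNat A i j a).nat B = s.nat B := by
  funext i' j'; simp [State.setNat, h]

theorem State.setReal_real_of_ne {A B : ℕ} (h : B ≠ A) (s : State) (i j : ℕ) (x : ℝ) :
    (s.setReal A i j x).real B = s.real B := by
  funext i' j'; simp [State.setReal, h]

theorem State.setNat_nat_self (s : State) (A i j a i' j' : ℕ) :
    (s.setNat A i j a).nat A i' j' = if i' = i ∧ j' = j then a else s.nat A i' j' := by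
  simp [State.setNat]

theorem State.setReal_real_self (s : State) (A i j : ℕ) (x : ℝ) (i' j' : ℕ) :
    (s.setReal A i j x).real A i' j' = if i' = i ∧ j' = j then x else s.real A i' j' := by
  simp [State.setReal]

@[simp] theorem State.setNat_real (s : State) (A i j a : ℕ) : (s.setNat A i j a).real = s.real := rfl

@[simp] theorem State.setReal_nat (s : State) (A i j : ℕ) (x : ℝ) :
    (s.setReal A i j x).nat = s.nat := rfl

namespace Cmd

/-- The frame rule. The syntactic check `writesNat` computes, so for a concrete command and a
concrete array its hypothesis is closed by `rfl`. -/
theorem run_nat_of_not_writes {B : ℕ} :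
    ∀ (c : Cmd), c.writesNat B = false → ∀ s : State, (c.run s).nat B = s.nat B
  | skip, _, _ => rfl
  | setNat A i j a, h, s => State.setNat_nat_of_ne (by simpa [writesNat] using h) _ _ _ _
  | setReal A i j x, _, s => rfl
  | seq P Q, h, s => by
      simp only [writesNat, Bool.or_eq_false_iff] at h
      rw [run_seq, run_nat_of_not_writes Q h.2, run_nat_of_not_writes P h.1]
  | ite b P Q, h, s => by
      simp only [writesNat, Bool.or_eq_false_iff] at h
      by_cases hb : b.Holds s
      · rw [run_ite_true _ _ hb, run_nat_of_not_writes P h.1]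
      · rw [run_ite_false _ _ hb, run_nat_of_not_writes Q h.2]
  | forN A P, h, s => by
      simp only [writesNat, Bool.or_eq_false_iff, beq_eq_false_iff_ne] at h
      have key : ∀ m : ℕ,
          ((fun t => (P.run t).setNat A 0 0 ((P.run t).nat A 0 0 + 1))^[m]
            (s.setNat A 0 0 0)).nat B = s.nat B := by
        intro m
        induction m with
        | zero => exact State.setNat_nat_of_ne h.1 _ _ _ _
        | succ m ih =>
          rw [Function.iterate_succ_apply', State.setNat_nat_of_ne h.1,
            run_nat_of_not_writes P h.2, ih]
      exact key _

theorem run_real_of_not_writes {B : ℕ} :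
    ∀ (c : Cmd), c.writesReal B = false → ∀ s : State, (c.run s).real B = s.real B
  | skip, _, _ => rfl
  | setNat A i j a, h, s => rfl
  | setReal A i j x, h, s => State.setReal_real_of_ne (by simpa [writesReal] using h) _ _ _ _
  | seq P Q, h, s => by
      simp only [writesReal, Bool.or_eq_false_iff] at h
      rw [run_seq, run_real_of_not_writes Q h.2, run_real_of_not_writes P h.1]
  | ite b P Q, h, s => by
      simp only [writesReal, Bool.or_eq_false_iff] at h
      by_cases hb : b.Holds s
      · rw [run_ite_true _ _ hb, run_real_of_not_writes P h.1]
      · rw [run_ite_false _ _ hb, run_real_of_not_writes Q h.2]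
  | forN A P, h, s => by
      simp only [writesReal] at h
      have key : ∀ m : ℕ,
          ((fun t => (P.run t).setNat A 0 0 ((P.run t).nat A 0 0 + 1))^[m]
            (s.setNat A 0 0 0)).real B = s.real B := by
        intro m
        induction m with
        | zero => rfl
        | succ m ih =>
          rw [Function.iterate_succ_apply', State.setNat_real,
            run_real_of_not_writes P h, ih]
      exact key _

theorem wf.writesNat_zero : ∀ {c : Cmd}, c.wf = true → c.writesNat 0 = false
  | skip, _ => rfl
  | setNat A i j a, h => by
      have h : A ≠ 0 := by simpa [wf] using h
      simpa [writesNat] using h.symm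
  | setReal A i j x, _ => rfl
  | seq P Q, h => by
      simp only [wf, Bool.and_eq_true] at h
      simp [writesNat, wf.writesNat_zero h.1, wf.writesNat_zero h.2]
  | ite b P Q, h => by
      simp only [wf, Bool.and_eq_true] at h
      simp [writesNat, wf.writesNat_zero h.1, wf.writesNat_zero h.2]
  | forN A P, h => by
      simp only [wf, Bool.and_eq_true, bne_iff_ne] at h
      simpa [writesNat, wf.writesNat_zero h.2] using h.1.1.symm

theorem run_nat_zero {c : Cmd} (h : c.wf = true) (s : State) : (c.run s).nat 0 = s.nat 0 :=
  run_nat_of_not_writes c (wf.writesNat_zero h) s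

/-- A well-formed command runs in polynomial time. -/
theorem exec_compile : ∀ (c : Cmd), c.wf = true → ∃ q : Polynomial ℕ, ∀ s : State,
    ∃ t : ℕ, Exec c.compile s t (c.run s) ∧ t ≤ q.eval (s.nat 0 0 0)
  | skip, _ => ⟨1, fun s => ⟨1, .skip s, by simp⟩⟩
  | setNat A i j a, _ => ⟨1, fun s => ⟨1, .setNat s A i j a, by simp⟩⟩
  | setReal A i j x, _ => ⟨1, fun s => ⟨1, .setReal s A i j x, by simp⟩⟩
  | seq P Q, h => by
      simp only [wf, Bool.and_eq_true] at h
      obtain ⟨p, hp⟩ := exec_compile P h.1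
      obtain ⟨q, hq⟩ := exec_compile Q h.2
      refine ⟨p + q, fun s => ?_⟩
      obtain ⟨t, ht, htp⟩ := hp s
      obtain ⟨u, hu, huq⟩ := hq (P.run s)
      rw [run_nat_zero h.1] at huq
      exact ⟨t + u, .seq ht hu, by rw [Polynomial.eval_add]; omega⟩
  | ite b P Q, h => by
      simp only [wf, Bool.and_eq_true] at h
      obtain ⟨p, hp⟩ := exec_compile P h.1
      obtain ⟨q, hq⟩ := exec_compile Q h.2
      refine ⟨p + q + 1, fun s => ?_⟩
      obtain ⟨t, ht, htp⟩ := hp s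
      obtain ⟨u, hu, huq⟩ := hq s
      by_cases hb : b.Holds s
      · rw [run_ite_true _ _ hb]
        exact ⟨t + 1, .ite_true hb ht, by simp; omega⟩
      · rw [run_ite_false _ _ hb]
        exact ⟨u + 1, .ite_false hb hu, by simp; omega⟩
  | forN A P, h => by
      simp only [wf, Bool.and_eq_true, bne_iff_ne, Bool.not_eq_true'] at h
      obtain ⟨⟨hA, hPA⟩, hP⟩ := h
      obtain ⟨p, hp⟩ := exec_compile P hP
      -- Each round costs the body, the increment and one test, hence `p + 2`; the final 2 counts
      -- the initialization of the counter and the last, failing test. Array `0` is never written,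
      -- so `p` is evaluated at the same `n` in every round.
      refine ⟨Polynomial.X * (p + 2) + 2, fun s => ?_⟩
      set F : State → State := fun t => (P.run t).setNat A 0 0 ((P.run t).nat A 0 0 + 1) with hF
      have key : ∀ (m : ℕ) (t : State), t.nat 0 0 0 = s.nat 0 0 0 →
          t.nat A 0 0 + m = s.nat 0 0 0 → ∃ u : ℕ,
          Exec (.loop (.natLT (nvar A) (nvar 0)) (.seq P.compile (.setNat A (.const 0) (.const 0)
            (.add (nvar A) (.const 1))))) t u (F^[m] t) ∧
          u ≤ m * (p.eval (s.nat 0 0 0) + 2) + 1 := by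
        intro m
        induction m with
        | zero =>
          intro t h0 hm
          refine ⟨1, .loop_false ?_, by simp⟩
          simp only [BExpr.Holds, NExpr.eval]
          omega
        | succ m ih =>
          intro t h0 hm
          obtain ⟨u, hu, hup⟩ := hp t
          have hn : (F t).nat 0 0 0 = s.nat 0 0 0 := by
            simp only [hF]
            rw [State.setNat_nat_of_ne hA.symm, run_nat_zero hP, h0]
          have hc : (F t).nat A 0 0 = t.nat A 0 0 + 1 := by
            simp only [hF]
            rw [State.setNat_nat_self, run_nat_of_not_writes P hPA]
            simp
          obtain ⟨v, hv, hvb⟩ := ih (F t) hn (by omega)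
          refine ⟨u + 1 + v + 1, .loop_true ?_ (.seq hu (.setNat _ _ _ _ _)) hv, ?_⟩
          · simp only [BExpr.Holds, NExpr.eval]
            omega
          · rw [h0] at hup
            rw [add_mul]
            omega
      obtain ⟨u, hu, hub⟩ := key (s.nat 0 0 0) (s.setNat A 0 0 0)
        (by rw [State.setNat_nat_of_ne hA.symm]) (by rw [State.setNat_nat_self]; simp)
      refine ⟨1 + u, .seq (.setNat s A _ _ _) hu, ?_⟩
      simp only [Polynomial.eval_add, Polynomial.eval_mul, Polynomial.eval_X,
        Polynomial.eval_ofNat]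
      omega

/-- The invariant rule for bounded loops. -/
theorem forN_induct {A : ℕ} {P : Cmd} (hw : (forN A P).wf = true) (s : State)
    (Inv : ℕ → State → Prop) (hstable : ∀ i t a, Inv i t → Inv i (t.setNat A 0 0 a))
    (hinit : Inv 0 s)
    (hstep : ∀ i t, i < s.nat 0 0 0 → t.nat A 0 0 = i →
      (∀ B, (forN A P).writesNat B = false → t.nat B = s.nat B) →
      (∀ B, (forN A P).writesReal B = false → t.real B = s.real B) →
      Inv i t → Inv (i + 1) (P.run t)) :
    Inv (s.nat 0 0 0) ((forN A P).run s) := by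
  have hw' := hw
  simp only [wf, Bool.and_eq_true, bne_iff_ne, Bool.not_eq_true'] at hw'
  obtain ⟨⟨hA, hPA⟩, hP⟩ := hw'
  set F : State → State := fun t => (P.run t).setNat A 0 0 ((P.run t).nat A 0 0 + 1) with hF
  -- The user's invariant is carried together with the value of the counter and the frame facts, so
  -- that the step may use these without stating them in `Inv`.
  have key : ∀ m, m ≤ s.nat 0 0 0 → Inv m (F^[m] (s.setNat A 0 0 0)) ∧
      (F^[m] (s.setNat A 0 0 0)).nat A 0 0 = m ∧
      (∀ B, (forN A P).writesNat B = false → (F^[m] (s.setNat A 0 0 0)).nat B = s.nat B) ∧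
      (∀ B, (forN A P).writesReal B = false → (F^[m] (s.setNat A 0 0 0)).real B = s.real B) := by
    intro m
    induction m with
    | zero =>
      intro _
      refine ⟨hstable _ _ _ hinit, by simp [State.setNat_nat_self], fun B hB => ?_, fun B _ => rfl⟩
      simp only [writesNat, Bool.or_eq_false_iff, beq_eq_false_iff_ne] at hB
      exact State.setNat_nat_of_ne hB.1 _ _ _ _
    | succ m ih =>
      intro hm
      obtain ⟨h1, h2, h3, h4⟩ := ih (by omega)
      rw [Function.iterate_succ_apply']
      set t := F^[m] (s.setNat A 0 0 0)
      refine ⟨hstable _ _ _ (hstep m t (by omega) h2 h3 h4 h1), ?_, fun B hB => ?_, fun B hB => ?_⟩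
      · simp only [hF]
        rw [State.setNat_nat_self, run_nat_of_not_writes P hPA, h2]
        simp
      · rw [← h3 B hB]
        simp only [writesNat, Bool.or_eq_false_iff, beq_eq_false_iff_ne] at hB
        simp only [hF]
        rw [State.setNat_nat_of_ne hB.1, run_nat_of_not_writes P hB.2]
      · rw [← h4 B hB]
        simp only [writesReal] at hB
        simp only [hF]
        rw [State.setNat_real, run_real_of_not_writes P hB]
  exact (key _ le_rfl).1

/-- Repeat a command `n ^ m` times; the counters are the arrays `A, …, A + m - 1`. -/
def repeatPow (A : ℕ) (P : Cmd) : ℕ → Cmd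
  | 0 => P
  | m + 1 => forN (A + m) (repeatPow A P m)

/-- Induction on the nesting depth: one round of the outermost loop advances the index of `Q` by `n
^ m`. The starting index is arbitrary to make this work, and `Q` has to survive writes to the
counters. -/
theorem repeatPow_induct {A : ℕ} {P : Cmd} (Q : ℕ → State → Prop) (n : ℕ)
    (hQ : ∀ i t, t.nat 0 0 0 = n → Q i t → Q (i + 1) (P.run t)) :
    ∀ m : ℕ, (repeatPow A P m).wf = true →
      (∀ i t B a, A ≤ B → B < A + m → Q i t → Q i (t.setNat B 0 0 a)) →
      ∀ i s, s.nat 0 0 0 = n → Q i s → Q (i + n ^ m) ((repeatPow A P m).run s)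
  | 0, _, _, i, s, hs, h => by simpa [repeatPow] using hQ i s hs h
  | m + 1, hw, hst, i, s, hs, h => by
      have hwm : (repeatPow A P m).wf = true := by
        simp only [repeatPow, wf, Bool.and_eq_true] at hw
        exact hw.2
      have := forN_induct (A := A + m) (P := repeatPow A P m) hw s
        (fun j t => Q (i + j * n ^ m) t ∧ t.nat 0 0 0 = n)
        (fun j t a ht => ⟨hst _ _ _ _ (by omega) (by omega) ht.1, by
          have : (0 : ℕ) ≠ A + m := by
            simp only [repeatPow, wf, Bool.and_eq_true, bne_iff_ne] at hw
            exact hw.1.1.symm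
          rw [State.setNat_nat_of_ne this, ht.2]⟩)
        ⟨by simpa using h, hs⟩
        (fun j t _ _ _ _ ht => ⟨by
          have := repeatPow_induct Q n hQ m hwm
            (fun i t B a h1 h2 h3 => hst i t B a h1 (by omega) h3) _ t ht.2 ht.1
          convert this using 1
          ring, by rw [run_nat_zero hwm, ht.2]⟩)
      rw [hs] at this
      rw [pow_succ']
      exact this.1

end Cmd
end RealRAM

namespace RealRAM

/-! ## Filling arrays and adding up

These commands use the natural number arrays `50` and `51` as counters. -/

/-- The indicator of `x = 1`. -/
def NExpr.ind (x : NExpr) : NExpr := .sub x (.sub (.add x x) (.const 2))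

theorem NExpr.eval_ind (x : NExpr) (s : State) :
    x.ind.eval s = if x.eval s = 1 then 1 else 0 := by
  simp only [NExpr.ind, NExpr.eval]
  -- For `x ≥ 2` the subtrahend `2x - 2` is at least `x`, so truncation gives 0; for `x ≤ 1` the
  -- inner truncated difference is 0.
  split_ifs <;> omega

/-- The indicator of the membership of `j` in the set in row `0` of the array `A`. -/
abbrev NExpr.mem (A : ℕ) (j : NExpr) : NExpr := NExpr.ind (.cell A (.const 0) j)

/-- The indicator of `x = y`. -/
def NExpr.eq (x y : NExpr) : NExpr := .sub (.sub (.const 1) (.sub x y)) (.sub y x)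

theorem NExpr.eval_eq (x y : NExpr) (s : State) :
    (x.eq y).eval s = if x.eval s = y.eval s then 1 else 0 := by
  simp only [NExpr.eq, NExpr.eval]
  split_ifs <;> omega

/-- The test whether an expression for a natural number is positive. -/
abbrev BExpr.pos (x : NExpr) : BExpr := .natLT (.const 0) x

@[simp] theorem State.mem_row (s : State) (n A i : ℕ) (v : Fin n) :
    v ∈ s.row n A i ↔ s.nat A i v = 1 := by
  simp [State.row]

namespace Cmd

/-- Set the entries of row `i` of the array `A` to `X`, which may depend on the counter `50`. -/
def fillNat (A : ℕ) (i X : NExpr) : Cmd := forN 50 (setNat A i (nvar 50) X)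

/-- The last assumption available in `h` says that the entries from the counter on are still the old
ones. So `X` may read the entry it is about to overwrite, as the in-place updates `removeSet` and
`addSet` do. The statement on other rows is what `appendSet` needs. -/
theorem run_fillNat {A : ℕ} {i X : NExpr} (hA : A ≠ 0) (hA' : A ≠ 50) (s : State) (r : ℕ)
    (f : ℕ → ℕ)
    (h : ∀ t v, v < s.nat 0 0 0 → (∀ B, B ≠ A → B ≠ 50 → t.nat B = s.nat B) → t.real = s.real →
      t.nat 50 0 0 = v → (∀ v', v ≤ v' → t.nat A r v' = s.nat A r v') →
      i.eval t = r ∧ X.eval t = f v) :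
    (∀ v, v < s.nat 0 0 0 → ((fillNat A i X).run s).nat A r v = f v) ∧
      ∀ r', r' ≠ r → ((fillNat A i X).run s).nat A r' = s.nat A r' := by
  have hw : (fillNat A i X).wf = true := by
    simp [fillNat, wf, writesNat, hA, hA'.symm]
  have := forN_induct (A := 50) hw s (fun m t =>
    (∀ v, v < m → t.nat A r v = f v) ∧ (∀ r', r' ≠ r → t.nat A r' = s.nat A r') ∧
      (∀ v', m ≤ v' → t.nat A r v' = s.nat A r v'))
    (fun m t a ht => by simpa only [State.setNat_nat_of_ne hA'] using ht) (by simp) ?_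
  · exact ⟨this.1, this.2.1⟩
  · intro m t hm hc hN hR ⟨h1, h2, h3⟩
    have hr : t.real = s.real := by
      funext B; exact hR B (by simp [writesReal])
    obtain ⟨hi, hX⟩ := h t m hm (fun B hB hB' => hN B (by simp [writesNat, hB, hB'])) hr hc h3
    simp only [run_setNat, NExpr.eval, hi, hX, hc, State.setNat_nat_self]
    refine ⟨fun v hv => ?_, fun r' hr' => ?_, fun v' hv' => ?_⟩
    · rcases eq_or_ne v m with rfl | hne
      · simp
      · simp [hne, h1 v (by omega)]
    · funext j
      simp [State.setNat_nat_self, hr', h2 r' hr']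
    · have : v' ≠ m := by omega
      simp [this, h3 v' (by omega)]

/-- Set the entries of row `0` of the real array `A` to `X`. -/
def fillReal (A : ℕ) (X : RExpr) : Cmd := forN 50 (setReal A (.const 0) (nvar 50) X)

theorem run_fillReal {A : ℕ} {X : RExpr} (s : State) (f : ℕ → ℝ)
    (h : ∀ t v, v < s.nat 0 0 0 → (∀ B, B ≠ 50 → t.nat B = s.nat B) →
      (∀ B, B ≠ A → t.real B = s.real B) → t.nat 50 0 0 = v → X.eval t = f v)
    (v : ℕ) (hv : v < s.nat 0 0 0) : ((fillReal A X).run s).real A 0 v = f v := by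
  have := forN_induct (A := 50) (P := setReal A (.const 0) (nvar 50) X) rfl s (fun m t =>
    ∀ v, v < m → t.real A 0 v = f v) (fun m t a ht => ht) (by simp) ?_
  · exact this v hv
  · intro m t hm hc hN hR h1 v hv
    have hX := h t m hm (fun B hB => hN B (by simp [writesNat, hB]))
      (fun B hB => hR B (by simp [writesReal, hB])) hc
    simp only [run_setReal, NExpr.eval, hX, hc, State.setReal_real_self]
    rcases eq_or_ne v m with rfl | hne
    · simp
    · simp [hne, h1 v (by omega)]

/-- Set the entries of the real array `A` to `X`. -/
def fillReal₂ (A : ℕ) (X : RExpr) : Cmd :=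
  forN 50 (forN 51 (setReal A (nvar 50) (nvar 51) X))

theorem run_fillReal₂ {A : ℕ} {X : RExpr} (s : State) (f : ℕ → ℕ → ℝ)
    (h : ∀ t u v, u < s.nat 0 0 0 → v < s.nat 0 0 0 →
      (∀ B, B ≠ 50 → B ≠ 51 → t.nat B = s.nat B) →
      (∀ B, B ≠ A → t.real B = s.real B) → t.nat 50 0 0 = u → t.nat 51 0 0 = v →
      X.eval t = f u v)
    (u v : ℕ) (hu : u < s.nat 0 0 0) (hv : v < s.nat 0 0 0) :
    ((fillReal₂ A X).run s).real A u v = f u v := by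
  have := forN_induct (A := 50) (P := forN 51 (setReal A (nvar 50) (nvar 51) X)) rfl s (fun m t =>
    ∀ u v, u < m → v < s.nat 0 0 0 → t.real A u v = f u v) (fun m t a ht => ht) (by simp) ?_
  · exact this u v hu hv
  · intro m t hm hc hN hR h1
    have h0 : t.nat 0 = s.nat 0 := hN 0 rfl
    have := forN_induct (A := 51) (P := setReal A (nvar 50) (nvar 51) X) rfl t (fun m' t' =>
      ∀ u v, (u < m ∧ v < s.nat 0 0 0) ∨ (u = m ∧ v < m') → t'.real A u v = f u v)
      (fun m t a ht => ht) (by simpa using h1) ?_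
    · intro u v hu hv
      refine this u v ?_
      rw [h0]
      omega
    · intro m' t' hm' hc' hN' hR' h1' u v huv
      have h50 : t'.nat 50 0 0 = m := by rw [hN' 50 rfl, hc]
      have hX := h t' m m' hm (by rwa [← h0])
        (fun B hB hB' => by
          rw [hN' B (by simp [writesNat, hB']), hN B (by simp [writesNat, hB, hB'])])
        (fun B hB => by
          rw [hR' B (by simp [writesReal, hB]), hR B (by simp [writesReal, hB])]) h50 hc'
      simp only [run_setReal, NExpr.eval, hX, h50, hc', State.setReal_real_self]
      by_cases hne : u = m ∧ v = m'
      · rw [if_pos hne, hne.1, hne.2]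
      · rw [if_neg hne]
        exact h1' u v (by omega)

/-- Compute `∑ v, X` in the real cell `A`, where `X` may depend on the counter `51`. -/
def sum₁ (A : ℕ) (X : RExpr) : Cmd :=
  seq (setReal A (.const 0) (.const 0) (.ofNat (.const 0)))
    (forN 51 (setReal A (.const 0) (.const 0) (.add (rvar A) X)))

theorem run_forN_add {A : ℕ} {X : RExpr} (s : State) (f : ℕ → ℝ)
    (h : ∀ t v, v < s.nat 0 0 0 → (∀ B, B ≠ 51 → t.nat B = s.nat B) →
      (∀ B, B ≠ A → t.real B = s.real B) → t.nat 51 0 0 = v → X.eval t = f v) :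
    ((forN 51 (setReal A (.const 0) (.const 0) (.add (rvar A) X))).run s).real A 0 0 =
      s.real A 0 0 + ∑ v ∈ Finset.range (s.nat 0 0 0), f v := by
  refine forN_induct (A := 51) rfl s (fun m t =>
    t.real A 0 0 = s.real A 0 0 + ∑ v ∈ Finset.range m, f v) (fun m t a ht => ht) (by simp) ?_
  intro m t hm hc hN hR h1
  have hX := h t m hm (fun B hB => hN B (by simp [writesNat, hB]))
    (fun B hB => hR B (by simp [writesReal, hB])) hc
  simp [NExpr.eval, RExpr.eval, hX, State.setReal_real_self, h1, Finset.sum_range_succ, add_assoc]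

theorem run_sum₁ {A n : ℕ} {X : RExpr} (s : State) (hn : s.nat 0 0 0 = n)
    (f : ℕ → ℝ)
    (h : ∀ t v, v < n → (∀ B, B ≠ 51 → t.nat B = s.nat B) →
      (∀ B, B ≠ A → t.real B = s.real B) → t.nat 51 0 0 = v → X.eval t = f v) :
    ((sum₁ A X).run s).real A 0 0 = ∑ v : Fin n, f v := by
  subst hn
  rw [sum₁, run_seq, run_forN_add _ f]
  · simp [NExpr.eval, RExpr.eval, State.setReal_real_self, Finset.sum_range]
  · intro t v hv hN hR hc
    refine h t v hv hN (fun B hB => ?_) hc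
    rw [hR B hB]
    exact State.setReal_real_of_ne hB _ _ _ _

/-- Compute `∑ u, ∑ v, X` in the real cell `A`, where `X` may depend on the counters `50`, `51`. -/
def sum₂ (A : ℕ) (X : RExpr) : Cmd :=
  seq (setReal A (.const 0) (.const 0) (.ofNat (.const 0)))
    (forN 50 (forN 51 (setReal A (.const 0) (.const 0) (.add (rvar A) X))))

theorem run_sum₂ {A n : ℕ} {X : RExpr} (s : State) (hn : s.nat 0 0 0 = n)
    (f : ℕ → ℕ → ℝ)
    (h : ∀ t u v, u < n → v < n →
      (∀ B, B ≠ 50 → B ≠ 51 → t.nat B = s.nat B) →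
      (∀ B, B ≠ A → t.real B = s.real B) → t.nat 50 0 0 = u → t.nat 51 0 0 = v →
      X.eval t = f u v) :
    ((sum₂ A X).run s).real A 0 0 =
      ∑ u : Fin n, ∑ v : Fin n, f u v := by
  subst hn
  set s' := (setReal A (.const 0) (.const 0) (.ofNat (.const 0))).run s with hs'
  have h0 : s'.real A 0 0 = 0 := by
    simp [hs', NExpr.eval, RExpr.eval, State.setReal_real_self]
  have hN' : s'.nat = s.nat := rfl
  have := forN_induct (A := 50)
    (P := forN 51 (setReal A (.const 0) (.const 0) (.add (rvar A) X))) rfl s' (fun m t =>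
    t.real A 0 0 = ∑ u ∈ Finset.range m, ∑ v ∈ Finset.range (s.nat 0 0 0), f u v)
    (fun m t a ht => ht) (by simpa using h0) ?_
  · rw [sum₂, run_seq, ← hs', this, hN', Finset.sum_range]
    exact Finset.sum_congr rfl fun u _ => Finset.sum_range _
  · intro m t hm hc hN hR h1
    rw [run_forN_add t (f m), h1, Finset.sum_range_succ, hN 0 rfl, hN']
    intro t' v hv hNt hRt hct
    refine h t' m v (hN' ▸ hm) ?_ (fun B hB hB' => ?_) (fun B hB => ?_) ?_ hct
    · rwa [hN 0 rfl] at hv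
    · rw [hNt B hB', hN B (by simp [writesNat, hB, hB']), hN']
    · rw [hRt B hB, hR B (by simp [writesReal, hB]), hs']
      exact State.setReal_real_of_ne hB _ _ _ _
    · rw [hNt 50 (by decide), hc]

end Cmd
end RealRAM

/-! ## Minimizing a cut function by pushing and relabelling

Given capacities `c` and vertex weights `b`, the sets `T` that minimize
`∑ u ∈ T, ∑ v ∉ T, c u v - ∑ v ∈ T, b v` are found by the push-relabel method. -/

section PushRelabel

set_option linter.unusedSectionVars false

variable {V : Type*} [Fintype V] [DecidableEq V]

/-- The objective function. -/
def cutObjective (c : V → V → ℝ) (b : V → ℝ) (T : Finset V) : ℝ :=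
  ∑ u ∈ T, ∑ v ∈ Tᶜ, c u v - ∑ v ∈ T, b v

/-- The invariant of the push-relabel method for residual capacities `r`, excesses `e` and
labels `h`, which are bounded by the number of vertices. -/
structure IsLabelledPreflow (c : V → V → ℝ) (b : V → ℝ) (r : V → V → ℝ) (e : V → ℝ)
    (h : V → ℕ) : Prop where
  nonneg : ∀ u v, 0 ≤ r u v
  add_swap : ∀ u v, r u v + r v u = c u v + c v u
  excess : ∀ v, e v = b v - ∑ u, (c v u - r v u)
  label : ∀ u v, 0 < r u v → h u ≤ h v + 1
  deficit : ∀ v, e v < 0 → h v = 0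
  le_card : ∀ v, h v ≤ Fintype.card V

/-- The residual capacities after pushing `δ` along `(u, v)`. -/
def pushResidual (r : V → V → ℝ) (u v : V) (δ : ℝ) (x y : V) : ℝ :=
  r x y - (if x = u then if y = v then δ else 0 else 0) +
    (if x = v then if y = u then δ else 0 else 0)

/-- The excesses after pushing `δ` along `(u, v)`. -/
def pushExcess (e : V → ℝ) (u v : V) (δ : ℝ) (x : V) : ℝ :=
  e x - (if x = u then δ else 0) + (if x = v then δ else 0)

/-- The labels after relabelling `u`. -/
def relabel (h : V → ℕ) (u : V) (x : V) : ℕ := if x = u then h u + 1 else h x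

open Classical in
/-- The admissible arcs. -/
noncomputable def admissible (r : V → V → ℝ) (h : V → ℕ) : Finset (V × V) :=
  Finset.univ.filter fun p => 0 < r p.1 p.2 ∧ h p.1 = h p.2 + 1

open Classical in
/-- The potential, which every push and every relabelling decreases. -/
noncomputable def pushRelabelPotential (r : V → V → ℝ) (e : V → ℝ) (h : V → ℕ) : ℕ :=
  (Fintype.card V * (Fintype.card V + 1) + 2) * ∑ v, (Fintype.card V - h v) +
    (Fintype.card V + 1) * (admissible r h).card + ∑ v, if 0 < e v then h v else 0

variable {c : V → V → ℝ} {b : V → ℝ} {r : V → V → ℝ} {e : V → ℝ} {h : V → ℕ}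

namespace IsLabelledPreflow

theorem init (hc : ∀ u v, 0 ≤ c u v) : IsLabelledPreflow c b c b fun _ => 0 where
  nonneg := hc
  add_swap _ _ := rfl
  excess v := by simp
  label _ _ _ := by simp
  deficit _ _ := rfl
  le_card _ := by simp

/-- The only arc that can become residual is `(v, u)`, which goes up one level. The excess of `u`
stays non-negative because `δ ≤ e u`, so no new deficit arises. -/
theorem push (H : IsLabelledPreflow c b r e h) {u v : V} (hr : 0 < r u v)
    (hh : h u = h v + 1) {δ : ℝ} (hδ : 0 ≤ δ) (hδe : δ ≤ e u) (hδr : δ ≤ r u v) :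
    IsLabelledPreflow c b (pushResidual r u v δ) (pushExcess e u v δ) h where
  nonneg x y := by
    have := H.nonneg x y
    unfold pushResidual
    split_ifs <;> subst_vars <;> linarith
  add_swap x y := by
    have := H.add_swap x y
    have huv : u ≠ v := by rintro rfl; omega
    unfold pushResidual
    by_cases h1 : x = u <;> by_cases h2 : y = v <;> by_cases h3 : x = v <;> by_cases h4 : y = u <;>
      simp only [h1, h2, h3, h4, if_true, if_false] <;> simp_all
  excess x := by
    have := H.excess x
    have huv : u ≠ v := by rintro rfl; omega
    have h1 : ∑ y, pushResidual r u v δ x y = ∑ y, r x y - (if x = u then δ else 0) +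
        (if x = v then δ else 0) := by
      simp only [pushResidual, Finset.sum_add_distrib, Finset.sum_sub_distrib]
      by_cases h1 : x = u <;> by_cases h2 : x = v <;> simp [h1, h2]
    rw [Finset.sum_sub_distrib] at this ⊢
    rw [h1, pushExcess, this]
    ring
  label x y hxy := by
    by_cases h0 : 0 < r x y
    · exact H.label x y h0
    · unfold pushResidual at hxy
      by_cases h3 : x = v ∧ y = u
      · rw [h3.1, h3.2]; omega
      · exfalso
        have : (if x = v then if y = u then δ else 0 else 0) = 0 := by
          split_ifs <;> simp_all
        rw [this] at hxy
        split_ifs at hxy <;> linarith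
  deficit x hx := by
    unfold pushExcess at hx
    apply H.deficit
    split_ifs at hx <;> subst_vars <;> linarith
  le_card := H.le_card

/-- A residual arc `(u, v)` that is not admissible has `h u ≤ h v`, so `u` can be raised by one.
Non-negative excess at `u` keeps the deficits at level 0. -/
theorem relabel (H : IsLabelledPreflow c b r e h) {u : V} (he : 0 ≤ e u)
    (hu : h u < Fintype.card V) (hadm : ∀ v, 0 < r u v → h u ≠ h v + 1) :
    IsLabelledPreflow c b r e (relabel h u) where
  nonneg := H.nonneg
  add_swap := H.add_swap
  excess := H.excess
  label x y hxy := by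
    have h1 := H.label x y hxy
    unfold _root_.relabel
    by_cases hx : x = u
    · subst hx
      have := hadm y hxy
      by_cases hy : y = x
      · simp [hy]
      · simp only [if_true, if_neg hy]; omega
    · by_cases hy : y = u
      · subst hy
        simp only [if_true, if_neg hx]; omega
      · simp only [if_neg hy, if_neg hx]; omega
  deficit x hx := by
    have : x ≠ u := by rintro rfl; linarith
    simpa [_root_.relabel, this] using H.deficit x hx
  le_card x := by
    unfold _root_.relabel
    split_ifs
    · exact hu
    · exact H.le_card x

/-- The flow `c - r` is antisymmetric, so it cancels over the pairs inside `T`; only what leaves `T`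
remains. This ties the objective to excesses and residual capacities. -/
theorem sum_excess (H : IsLabelledPreflow c b r e h) (T : Finset V) :
    ∑ v ∈ T, e v = ∑ u ∈ T, ∑ v ∈ Tᶜ, r u v - cutObjective c b T := by
  have hz : ∑ u ∈ T, ∑ v ∈ T, (c u v - r u v) = 0 := by
    have h1 : ∑ u ∈ T, ∑ v ∈ T, (c u v - r u v) = ∑ u ∈ T, ∑ v ∈ T, (c v u - r v u) :=
      Finset.sum_comm
    have h2 : ∑ u ∈ T, ∑ v ∈ T, (c u v - r u v) + ∑ u ∈ T, ∑ v ∈ T, (c v u - r v u) = 0 := by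
      rw [← Finset.sum_add_distrib]
      refine Finset.sum_eq_zero fun u _ => ?_
      rw [← Finset.sum_add_distrib]
      refine Finset.sum_eq_zero fun v _ => ?_
      have := H.add_swap u v
      linarith
    linarith
  have h3 : ∀ u, ∑ v, (c u v - r u v) = ∑ v ∈ T, (c u v - r u v) + ∑ v ∈ Tᶜ, (c u v - r u v) :=
    fun u => (Finset.sum_add_sum_compl T _).symm
  simp only [H.excess, h3, cutObjective]
  rw [Finset.sum_sub_distrib, Finset.sum_add_distrib, hz]
  simp only [Finset.sum_sub_distrib]
  ring

/-- If no excess is active, every level that contains no label yields a minimizer. -/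
theorem cutObjective_le (H : IsLabelledPreflow c b r e h)
    (hdone : ∀ v, 0 < e v → h v = Fintype.card V) {g : ℕ} (hg : g ≤ Fintype.card V)
    (hgap : ∀ v, h v ≠ g) (T : Finset V) :
    cutObjective c b (Finset.univ.filter fun v => g < h v) ≤ cutObjective c b T := by
  set S : Finset V := Finset.univ.filter fun v => g < h v with hS
  -- A residual arc leaving `S` would descend from above the empty level `g` to below it, that is by
  -- at least two levels.
  have h0 : ∑ u ∈ S, ∑ v ∈ Sᶜ, r u v = 0 := by
    refine Finset.sum_eq_zero fun u hu => Finset.sum_eq_zero fun v hv => ?_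
    simp only [hS, Finset.mem_filter, Finset.mem_univ, true_and, Finset.mem_compl] at hu hv
    by_contra hne
    have := H.label u v (lt_of_le_of_ne (H.nonneg u v) (Ne.symm hne))
    have := hgap v
    omega
  have h1 : 0 ≤ ∑ u ∈ T, ∑ v ∈ Tᶜ, r u v :=
    Finset.sum_nonneg fun u _ => Finset.sum_nonneg fun v _ => H.nonneg u v
  -- All positive excess sits at level `n`, which is above `g`, and all deficits sit at level 0,
  -- which is not. So `S` has the largest total excess of all sets.
  have h2 : ∑ v ∈ T, e v ≤ ∑ v ∈ S, e v := by
    rw [← Finset.sum_filter_add_sum_filter_not S (· ∈ T),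
      ← Finset.sum_filter_add_sum_filter_not T (· ∈ S)]
    have ha : T.filter (· ∈ S) = S.filter (· ∈ T) := by
      ext; simp [and_comm]
    rw [ha]
    have hb : ∑ v ∈ T.filter (· ∉ S), e v ≤ 0 := by
      refine Finset.sum_nonpos fun v hv => ?_
      by_contra hpos
      have hn := hdone v (not_le.mp hpos)
      have := hgap v
      simp only [hS, Finset.mem_filter, Finset.mem_univ, true_and] at hv
      omega
    have hc : 0 ≤ ∑ v ∈ S.filter (· ∉ T), e v := by
      refine Finset.sum_nonneg fun v hv => ?_
      by_contra hneg
      have := H.deficit v (not_le.mp hneg)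
      simp only [hS, Finset.mem_filter, Finset.mem_univ, true_and] at hv
      omega
    linarith
  have := H.sum_excess S
  have := H.sum_excess T
  linarith

/-- If the push empties `u`, the last sum loses `h u` and gains at most `h v = h u - 1`, while no
arc becomes admissible. If it saturates `(u, v)`, an admissible arc disappears, worth `n + 1`, and
the last sum grows by at most `h v ≤ n`. -/
theorem pushRelabelPotential_push_lt (H : IsLabelledPreflow c b r e h) {u v : V} (he : 0 < e u)
    (hr : 0 < r u v) (hh : h u = h v + 1) :
    pushRelabelPotential (pushResidual r u v (min (e u) (r u v)))
      (pushExcess e u v (min (e u) (r u v))) h < pushRelabelPotential r e h := by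
  have huv : u ≠ v := by rintro rfl; omega
  set δ := min (e u) (r u v) with hδ
  have hδ0 : 0 < δ := lt_min he hr
  have hsub : admissible (pushResidual r u v δ) h ⊆ admissible r h := by
    intro p hp
    simp only [admissible, Finset.mem_filter, Finset.mem_univ, true_and] at hp ⊢
    refine ⟨?_, hp.2⟩
    have h1 := hp.1
    unfold pushResidual at h1
    by_cases h3 : p.1 = v ∧ p.2 = u
    · rw [h3.1, h3.2] at hp; omega
    · have : (if p.1 = v then if p.2 = u then δ else 0 else 0) = 0 := by
        split_ifs <;> simp_all
      rw [this] at h1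
      split_ifs at h1 <;> linarith
  unfold pushRelabelPotential
  rcases le_total (e u) (r u v) with hle | hle
  · have hδe : δ = e u := min_eq_left hle
    have hcard := Finset.card_le_card hsub
    have hsum : ∑ x, (if 0 < pushExcess e u v δ x then h x else 0) + h u ≤
        ∑ x, (if 0 < e x then h x else 0) + h v := by
      have : ∀ x, (if 0 < pushExcess e u v δ x then h x else 0) + (if x = u then h x else 0) ≤
          (if 0 < e x then h x else 0) + (if x = v then h x else 0) := by
        intro x
        unfold pushExcess
        by_cases h1 : x = u
        · subst h1
          simp [huv, hδe, he]
        · by_cases h2 : x = v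
          · subst h2
            simp only [h1, if_false, if_true]
            split_ifs <;> omega
          · simp [h1, h2]
      have := Finset.sum_le_sum fun x (_ : x ∈ Finset.univ) => this x
      simpa [Finset.sum_add_distrib] using this
    have := Nat.mul_le_mul_left (Fintype.card V + 1) hcard
    omega
  · have hδr : δ = r u v := min_eq_right hle
    have hcard : (admissible (pushResidual r u v δ) h).card < (admissible r h).card := by
      refine Finset.card_lt_card (Finset.ssubset_iff_subset_ne.mpr ⟨hsub, fun heq => ?_⟩)
      have : (u, v) ∈ admissible r h := by simp [admissible, hr, hh]
      rw [← heq] at this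
      simp [admissible, pushResidual, hδr, huv] at this
    have hsum : ∑ x, (if 0 < pushExcess e u v δ x then h x else 0) ≤
        ∑ x, (if 0 < e x then h x else 0) + h v := by
      have : ∀ x, (if 0 < pushExcess e u v δ x then h x else 0) ≤
          (if 0 < e x then h x else 0) + (if x = v then h x else 0) := by
        intro x
        unfold pushExcess
        by_cases h1 : x = u
        · subst h1
          simp only [huv, if_false, if_true, he]
          split_ifs <;> omega
        · by_cases h2 : x = v
          · subst h2
            simp only [h1, if_false, if_true]
            split_ifs <;> omega
          · simp [h1, h2]
      have := Finset.sum_le_sum fun x (_ : x ∈ Finset.univ) => this x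
      simpa [Finset.sum_add_distrib] using this
    have := Nat.mul_le_mul_left (Fintype.card V + 1) (Nat.succ_le_of_lt hcard)
    rw [Nat.succ_eq_add_one, mul_add] at this
    have := H.le_card v
    omega

end IsLabelledPreflow

/-- The first term falls by `n(n + 1) + 2`. New admissible arcs must leave `u`, so the second term
rises by at most `(n + 1)n`, and the third by at most 1. -/
theorem pushRelabelPotential_relabel_lt (H : IsLabelledPreflow c b r e h) {u : V}
    (hu : h u < Fintype.card V) :
    pushRelabelPotential r e (relabel h u) < pushRelabelPotential r e h := by
  have hcard : (admissible r (relabel h u)).card ≤ (admissible r h).card + Fintype.card V := by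
    have hsub : admissible r (relabel h u) ⊆
        admissible r h ∪ Finset.univ.image fun v => (u, v) := by
      rintro ⟨x, y⟩ hp
      by_cases hx : x = u
      · simp [hx]
      · have hp' : 0 < r x y ∧ relabel h u x = relabel h u y + 1 := by
          simpa [admissible] using hp
        have hl := H.label x y hp'.1
        have hxy : h x = h y + 1 := by
          have h2 := hp'.2
          unfold relabel at h2
          rw [if_neg hx] at h2
          by_cases hy : y = u
          · subst hy
            rw [if_pos rfl] at h2
            omega
          · rwa [if_neg hy] at h2
        simp [admissible, hp'.1, hxy]
    refine (Finset.card_le_card hsub).trans ((Finset.card_union_le _ _).trans ?_)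
    gcongr
    exact Finset.card_image_le
  have hsum : ∑ x, (if 0 < e x then relabel h u x else 0) ≤
      ∑ x, (if 0 < e x then h x else 0) + 1 := by
    have : ∀ x, (if 0 < e x then relabel h u x else 0) ≤
        (if 0 < e x then h x else 0) + (if x = u then 1 else 0) := by
      intro x
      unfold relabel
      by_cases h1 : x = u
      · subst h1
        simp only [if_true]
        split_ifs <;> omega
      · simp [h1]
    have := Finset.sum_le_sum fun x (_ : x ∈ Finset.univ) => this x
    simpa [Finset.sum_add_distrib] using this
  have hlab : ∑ x, (Fintype.card V - relabel h u x) + 1 = ∑ x, (Fintype.card V - h x) := by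
    have : ∀ x, (Fintype.card V - relabel h u x) + (if x = u then 1 else 0) =
        Fintype.card V - h x := by
      intro x
      unfold relabel
      by_cases h1 : x = u
      · subst h1
        simp only [if_true]
        omega
      · simp [h1]
    rw [← Finset.sum_congr rfl fun x _ => this x]
    simp [Finset.sum_add_distrib]
  unfold pushRelabelPotential
  rw [← hlab]
  nlinarith

/-- Source of the exponent 5 in `minCut`. At `n = 2` the inequality `n(n + 1) + 2 ≤ n³` used here is
tight. -/
theorem pushRelabelPotential_init_le (hV : 2 ≤ Fintype.card V) :
    pushRelabelPotential r e (fun _ => 0) ≤ Fintype.card V ^ 5 := by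
  have h1 : admissible r (fun _ => 0) = ∅ := by simp [admissible]
  simp only [pushRelabelPotential, h1, Finset.card_empty, ite_self, Finset.sum_const_zero,
    Nat.sub_zero, Finset.sum_const, Finset.card_univ, smul_eq_mul, mul_zero, add_zero]
  generalize Fintype.card V = n at hV
  have : n * (n + 1) + 2 ≤ n * n * n := by nlinarith
  calc (n * (n + 1) + 2) * (n * n) ≤ (n * n * n) * (n * n) := Nat.mul_le_mul_right _ this
    _ = n ^ 5 := by ring

/-- Exhausted potential also means that the method has finished: then every label is maximal. -/
theorem eq_card_of_pushRelabelPotential_eq_zero (H : IsLabelledPreflow c b r e h)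
    (h0 : pushRelabelPotential r e h = 0) (v : V) : h v = Fintype.card V := by
  have h1 : ∑ v, (Fintype.card V - h v) = 0 := by
    unfold pushRelabelPotential at h0
    have : (Fintype.card V * (Fintype.card V + 1) + 2) * ∑ v, (Fintype.card V - h v) = 0 := by omega
    simpa using this
  have := Finset.sum_eq_zero_iff.mp h1 v (Finset.mem_univ v)
  have := H.le_card v
  omega

end PushRelabel

namespace RealRAM

/-! ## The push-relabel program

The residual capacities are in the real array `2`, the excesses in row `0` of the real array `3`,
and the labels in row `0` of the natural number array `6`. The minimizer is returned in row `0` of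
the natural number array `9`. -/

namespace State

/-- The real array `A` as a matrix. -/
def matrix (s : State) (n A : ℕ) : Fin n → Fin n → ℝ := fun u v => s.real A u v

/-- Row `0` of the real array `A` as a vector. -/
def vector (s : State) (n A : ℕ) : Fin n → ℝ := fun v => s.real A 0 v

/-- Row `0` of the natural number array `A` as a vector. -/
def natVector (s : State) (n A : ℕ) : Fin n → ℕ := fun v => s.nat A 0 v

/-- The potential of the preflow in the memory. -/
noncomputable def potential (s : State) (n : ℕ) : ℕ :=
  pushRelabelPotential (s.matrix n 2) (s.vector n 3) (s.natVector n 6)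

end State

namespace Cmd

/-- Push along the arc from the counter `10` to the counter `11` if it is admissible. -/
def pushStep : Cmd :=
  ite (.and (.realLT (.ofNat (.const 0)) (.cell 3 (.const 0) (nvar 10)))
      (.and (.realLT (.ofNat (.const 0)) (.cell 2 (nvar 10) (nvar 11)))
        (.pos (.eq (.cell 6 (.const 0) (nvar 10))
          (.add (.cell 6 (.const 0) (nvar 11)) (.const 1))))))
    (seq (ite (.realLT (.cell 2 (nvar 10) (nvar 11)) (.cell 3 (.const 0) (nvar 10)))
        (setReal 4 (.const 0) (.const 0) (.cell 2 (nvar 10) (nvar 11)))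
        (setReal 4 (.const 0) (.const 0) (.cell 3 (.const 0) (nvar 10))))
      (seq (setReal 3 (.const 0) (nvar 10) (.sub (.cell 3 (.const 0) (nvar 10)) (rvar 4)))
        (seq (setReal 3 (.const 0) (nvar 11) (.add (.cell 3 (.const 0) (nvar 11)) (rvar 4)))
          (seq (setReal 2 (nvar 10) (nvar 11) (.sub (.cell 2 (nvar 10) (nvar 11)) (rvar 4)))
            (setReal 2 (nvar 11) (nvar 10) (.add (.cell 2 (nvar 11) (nvar 10)) (rvar 4)))))))
    skip

theorem run_pushStep_of_not {n : ℕ} {s : State} {u v : Fin n} (hu : s.nat 10 0 0 = u)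
    (hv : s.nat 11 0 0 = v) (h : ¬ (0 < s.vector n 3 u ∧ 0 < s.matrix n 2 u v ∧
      s.natVector n 6 u = s.natVector n 6 v + 1)) : pushStep.run s = s := by
  rw [pushStep, run_ite_false, run_skip]
  simpa [BExpr.Holds, NExpr.eval, RExpr.eval, NExpr.eval_eq, hu, hv, State.vector,
    State.matrix, State.natVector] using h

theorem run_pushStep {n : ℕ} {s : State} {u v : Fin n} (hu : s.nat 10 0 0 = u)
    (hv : s.nat 11 0 0 = v) (h1 : 0 < s.vector n 3 u) (h2 : 0 < s.matrix n 2 u v)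
    (h3 : s.natVector n 6 u = s.natVector n 6 v + 1) :
    (pushStep.run s).matrix n 2 = pushResidual (s.matrix n 2) u v
        (min (s.vector n 3 u) (s.matrix n 2 u v)) ∧
      (pushStep.run s).vector n 3 = pushExcess (s.vector n 3) u v
        (min (s.vector n 3 u) (s.matrix n 2 u v)) := by
  -- The labels differ by one, hence the four writes of the push go to distinct cells.
  have huv : u ≠ v := by rintro rfl; omega
  have huv' : (u : ℕ) ≠ v := by simpa [Fin.ext_iff] using huv
  set δ := min (s.vector n 3 u) (s.matrix n 2 u v) with hδ
  rw [pushStep, run_ite_true]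
  swap
  · simp only [State.vector, State.matrix, State.natVector] at h1 h2 h3
    simp [BExpr.Holds, NExpr.eval, RExpr.eval, NExpr.eval_eq, hu, hv, h1, h2, h3]
  have hδs : (ite (.realLT (.cell 2 (nvar 10) (nvar 11)) (.cell 3 (.const 0) (nvar 10)))
        (setReal 4 (.const 0) (.const 0) (.cell 2 (nvar 10) (nvar 11)))
        (setReal 4 (.const 0) (.const 0) (.cell 3 (.const 0) (nvar 10)))).run s =
      s.setReal 4 0 0 δ := by
    by_cases hlt : s.matrix n 2 u v < s.vector n 3 u
    · rw [run_ite_true]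
      · simp only [run_setReal, NExpr.eval, RExpr.eval, hu, hv, hδ, min_eq_right hlt.le]
        rfl
      · simpa [BExpr.Holds, NExpr.eval, RExpr.eval, hu, hv, State.vector, State.matrix] using hlt
    · rw [run_ite_false]
      · simp only [run_setReal, NExpr.eval, RExpr.eval, hu, hδ, min_eq_left (not_lt.mp hlt)]
        rfl
      · simpa [BExpr.Holds, NExpr.eval, RExpr.eval, hu, hv, State.vector, State.matrix] using hlt
  rw [run_seq, hδs]
  constructor
  · funext x y
    simp only [run_seq, run_setReal, NExpr.eval, RExpr.eval, State.setReal_nat, hu, hv,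
      State.matrix, State.setReal_real_self, State.setReal_real_of_ne (show 2 ≠ 3 by decide),
      State.setReal_real_of_ne (show 2 ≠ 4 by decide),
      State.setReal_real_of_ne (show 4 ≠ 2 by decide),
      State.setReal_real_of_ne (show 4 ≠ 3 by decide), pushResidual, Fin.ext_iff]
    by_cases a1 : (x : ℕ) = u <;> by_cases a2 : (y : ℕ) = v <;> by_cases a3 : (x : ℕ) = v <;>
      by_cases a4 : (y : ℕ) = u <;> simp [a1, a2, a3, a4, huv', huv'.symm]
  · funext x
    simp only [run_seq, run_setReal, NExpr.eval, RExpr.eval, State.setReal_nat, hu, hv,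
      State.vector, State.setReal_real_self, State.setReal_real_of_ne (show 3 ≠ 2 by decide),
      State.setReal_real_of_ne (show 3 ≠ 4 by decide),
      State.setReal_real_of_ne (show 4 ≠ 3 by decide), pushExcess, Fin.ext_iff]
    by_cases a1 : (x : ℕ) = u <;> by_cases a3 : (x : ℕ) = v <;>
      simp [a1, a3, huv', huv'.symm]

/-- Push the excess of the counter `10` along all admissible arcs, and then relabel it if it still
has an excess. -/
def discharge : Cmd :=
  ite (.and (.realLT (.ofNat (.const 0)) (.cell 3 (.const 0) (nvar 10)))
      (.natLT (.cell 6 (.const 0) (nvar 10)) (nvar 0)))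
    (seq (forN 11 pushStep)
      (ite (.realLT (.ofNat (.const 0)) (.cell 3 (.const 0) (nvar 10)))
        (setNat 6 (.const 0) (nvar 10) (.add (.cell 6 (.const 0) (nvar 10)) (.const 1))) skip))
    skip

/-- The preflow in the memory satisfies the invariant. -/
def _root_.RealRAM.State.Labelled (s : State) {n : ℕ} (c : Fin n → Fin n → ℝ) (b : Fin n → ℝ) :
    Prop :=
  IsLabelledPreflow c b (s.matrix n 2) (s.vector n 3) (s.natVector n 6)

theorem run_discharge_of_not {n : ℕ} {s : State} (hn : s.nat 0 0 0 = n) {u : Fin n}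
    (hu : s.nat 10 0 0 = u) (h : ¬ (0 < s.vector n 3 u ∧ s.natVector n 6 u < n)) :
    discharge.run s = s := by
  rw [discharge, run_ite_false, run_skip]
  simpa [BExpr.Holds, NExpr.eval, RExpr.eval, hu, hn, State.vector, State.natVector] using h

/-- Either the scan drains `u`, so some push has occurred and lowered the potential, or excess is
left and no arc out of `u` is admissible, so the relabelling is legal and lowers it. -/
theorem run_discharge {n : ℕ} {s : State} (hn : s.nat 0 0 0 = n) {u : Fin n}
    (hu : s.nat 10 0 0 = u) {c : Fin n → Fin n → ℝ} {b : Fin n → ℝ} (H : s.Labelled c b)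
    (h1 : 0 < s.vector n 3 u) (h2 : s.natVector n 6 u < n) :
    (discharge.run s).Labelled c b ∧ (discharge.run s).potential n < s.potential n := by
  -- The last clause says that the arcs scanned so far are not admissible as long as `u` keeps an
  -- excess. Later pushes do not spoil this, since they leave the labels alone and add residual
  -- capacity only on arcs into `u`.
  have hscan := forN_induct (A := 11) (P := pushStep) rfl s (fun m t =>
    t.Labelled c b ∧ t.potential n ≤ s.potential n ∧
      (t.potential n < s.potential n ∨ 0 < t.vector n 3 u) ∧ ∀ v : Fin n, v < m →
        0 < t.vector n 3 u → 0 < t.matrix n 2 u v → t.natVector n 6 u ≠ t.natVector n 6 v + 1)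
    (fun m t a ht => ht) ⟨H, le_rfl, Or.inr h1, by simp⟩ ?_
  · rw [hn] at hscan
    rw [discharge, run_ite_true, run_seq]
    swap
    · simpa [BExpr.Holds, NExpr.eval, RExpr.eval, hu, hn] using ⟨h1, h2⟩
    have hu' : ((forN 11 pushStep).run s).nat 10 = s.nat 10 := run_nat_of_not_writes _ rfl _
    have hh' : ((forN 11 pushStep).run s).nat 6 = s.nat 6 := run_nat_of_not_writes _ rfl _
    set t := (forN 11 pushStep).run s
    obtain ⟨i1, i2, i3, i4⟩ := hscan
    by_cases he : 0 < t.vector n 3 u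
    · rw [run_ite_true]
      swap
      · simpa [BExpr.Holds, NExpr.eval, RExpr.eval, hu', hu, State.vector] using he
      have hlt : t.natVector n 6 u < Fintype.card (Fin n) := by
        simpa [State.natVector, hh'] using h2
      have heq : ((setNat 6 (.const 0) (nvar 10)
          (.add (.cell 6 (.const 0) (nvar 10)) (.const 1))).run t).natVector n 6 =
          relabel (t.natVector n 6) u := by
        funext x
        simp [State.natVector, relabel, NExpr.eval, State.setNat_nat_self, hu', hu, Fin.ext_iff]
      constructor
      · unfold State.Labelled
        rw [heq]
        exact i1.relabel he.le hlt (fun v hv => i4 v v.2 he hv)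
      · refine lt_of_lt_of_le ?_ i2
        unfold State.potential
        rw [heq]
        exact pushRelabelPotential_relabel_lt i1 hlt
    · rw [run_ite_false, run_skip]
      · exact ⟨i1, i3.resolve_right he⟩
      · simpa [BExpr.Holds, NExpr.eval, RExpr.eval, hu', hu, State.vector] using he
  · intro m t hm hc hN hR ⟨i1, i2, i3, i4⟩
    have hut : t.nat 10 0 0 = u := by rw [hN 10 rfl, hu]
    rw [hn] at hm
    have hvt : t.nat 11 0 0 = (⟨m, hm⟩ : Fin n) := hc
    have hnat : (pushStep.run t).natVector n 6 = t.natVector n 6 := by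
      unfold State.natVector
      rw [run_nat_of_not_writes pushStep rfl]
    by_cases hp : 0 < t.vector n 3 u ∧ 0 < t.matrix n 2 u ⟨m, hm⟩ ∧
        t.natVector n 6 u = t.natVector n 6 ⟨m, hm⟩ + 1
    · obtain ⟨p1, p2, p3⟩ := hp
      obtain ⟨q1, q2⟩ := run_pushStep hut hvt p1 p2 p3
      have hlt : (pushStep.run t).potential n < t.potential n := by
        unfold State.potential
        rw [q1, q2, hnat]
        exact i1.pushRelabelPotential_push_lt p1 p2 p3
      refine ⟨?_, by omega, Or.inl (by omega), fun v hv he hr => ?_⟩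
      · unfold State.Labelled
        rw [q1, q2, hnat]
        exact i1.push p2 p3 (le_min p1.le p2.le) (min_le_left _ _) (min_le_right _ _)
      · have hu0 : u ≠ ⟨m, hm⟩ := by
          intro heq
          rw [← heq] at p3
          omega
        rw [hnat]
        rw [q2] at he
        rw [q1] at hr
        simp only [pushExcess, hu0, if_true, if_false, add_zero, sub_pos, min_lt_iff, lt_irrefl,
          false_or] at he
        -- Excess left after the push means that the minimum was the residual capacity. The arc just
        -- used is then saturated, and the other arcs out of `u` are unchanged.
        rcases eq_or_ne v ⟨m, hm⟩ with rfl | hne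
        · exfalso
          rw [min_eq_right he.le] at hr
          simp [pushResidual, hu0] at hr
        · refine i4 v ?_ p1 ?_
          · have : (v : ℕ) ≠ m := fun h => hne (Fin.ext h)
            omega
          · simpa [pushResidual, hu0, hne] using hr
    · rw [run_pushStep_of_not hut hvt hp]
      refine ⟨i1, i2, i3, fun v hv he hr => ?_⟩
      rcases eq_or_ne v ⟨m, hm⟩ with rfl | hne
      · exact fun h => hp ⟨he, hr, h⟩
      · refine i4 v ?_ he hr
        have : (v : ℕ) ≠ m := fun h => hne (Fin.ext h)
        omega

/-- No vertex with a label less than `n` has a positive excess. -/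
def _root_.RealRAM.State.Done (s : State) (n : ℕ) : Prop :=
  ∀ v : Fin n, 0 < s.vector n 3 v → s.natVector n 6 v = n

/-- A sweep that finds an active vertex lowers the potential. A sweep that finds none changes
nothing relevant and certifies `Done`, which therefore persists. -/
theorem run_forN_discharge {n : ℕ} {s : State} (hn : s.nat 0 0 0 = n)
    {c : Fin n → Fin n → ℝ} {b : Fin n → ℝ} (H : s.Labelled c b) :
    ((forN 10 discharge).run s).Labelled c b ∧
      (((forN 10 discharge).run s).potential n < s.potential n ∧ ¬ s.Done n ∨
        ((forN 10 discharge).run s).Done n ∧ s.Done n) := by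
  have := forN_induct (A := 10) (P := discharge) rfl s (fun m t =>
    t.Labelled c b ∧ (t.potential n < s.potential n ∧ ¬ s.Done n ∨
      (t.matrix n 2 = s.matrix n 2 ∧ t.vector n 3 = s.vector n 3 ∧
        t.natVector n 6 = s.natVector n 6) ∧ ∀ v : Fin n, v < m → 0 < s.vector n 3 v →
          s.natVector n 6 v = n))
    (fun m t a ht => ht) ⟨H, Or.inr ⟨⟨rfl, rfl, rfl⟩, by simp⟩⟩ ?_
  · obtain ⟨h1, h2⟩ := this
    refine ⟨h1, h2.imp_right fun h => ?_⟩
    have hd : s.Done n := fun v => h.2 v (by rw [hn]; exact v.2)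
    refine ⟨?_, hd⟩
    intro v
    rw [h.1.2.1, h.1.2.2]
    exact hd v
  · intro m t hm hc hN hR ⟨i1, i2⟩
    rw [hn] at hm
    have hut : t.nat 10 0 0 = (⟨m, hm⟩ : Fin n) := hc
    have hnt : t.nat 0 0 0 = n := by rw [hN 0 rfl, hn]
    by_cases hp : 0 < t.vector n 3 ⟨m, hm⟩ ∧ t.natVector n 6 ⟨m, hm⟩ < n
    · obtain ⟨q1, q2⟩ := run_discharge hnt hut i1 hp.1 hp.2
      refine ⟨q1, Or.inl ?_⟩
      rcases i2 with ⟨h1, h2⟩ | ⟨⟨h1, h2, h3⟩, h4⟩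
      · exact ⟨by omega, h2⟩
      · refine ⟨?_, fun hd => ?_⟩
        · have : t.potential n = s.potential n := by
            unfold State.potential
            rw [h1, h2, h3]
          omega
        · rw [h2, h3] at hp
          have := hd _ hp.1
          omega
    · rw [run_discharge_of_not hnt hut hp]
      refine ⟨i1, i2.imp_right fun ⟨h1, h4⟩ => ⟨h1, fun v hv hpos => ?_⟩⟩
      rcases eq_or_ne v ⟨m, hm⟩ with rfl | hne
      · rw [h1.2.1, h1.2.2] at hp
        have := H.le_card ⟨m, hm⟩
        rw [Fintype.card_fin] at this
        have := not_and.mp hp hpos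
        omega
      · refine h4 v ?_ hpos
        have : (v : ℕ) ≠ m := fun h => hne (Fin.ext h)
        omega

/-- Find a level that is at most `n` and contains no label. -/
def findGap : Cmd :=
  seq (setNat 7 (.const 0) (.const 0) (nvar 0))
    (forN 10 (seq (setNat 8 (.const 0) (.const 0) (.const 0))
      (seq (forN 11 (ite (.pos (.eq (.cell 6 (.const 0) (nvar 11)) (nvar 10)))
          (setNat 8 (.const 0) (.const 0) (.const 1)) skip))
        (ite (.pos (nvar 8)) skip (setNat 7 (.const 0) (.const 0) (nvar 10))))))

theorem run_findGap {n : ℕ} {s : State} (hn : s.nat 0 0 0 = n) :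
    (findGap.run s).nat 7 0 0 ≤ n ∧
      ∀ v : Fin n, s.natVector n 6 v ≠ (findGap.run s).nat 7 0 0 := by
  rw [findGap, run_seq]
  set s' := (setNat 7 (.const 0) (.const 0) (nvar 0)).run s with hs'
  have h7 : s'.nat 7 0 0 = n := by simp [hs', NExpr.eval, State.setNat_nat_self, hn]
  have h6 : s'.nat 6 = s.nat 6 := run_nat_of_not_writes _ rfl _
  have h0 : s'.nat 0 = s.nat 0 := run_nat_of_not_writes _ rfl _
  have := forN_induct (A := 10) (P := seq (setNat 8 (.const 0) (.const 0) (.const 0))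
      (seq (forN 11 (ite (.pos (.eq (.cell 6 (.const 0) (nvar 11)) (nvar 10)))
          (setNat 8 (.const 0) (.const 0) (.const 1)) skip))
        (ite (.pos (nvar 8)) skip (setNat 7 (.const 0) (.const 0) (nvar 10))))) rfl s'
    (fun m t => (t.nat 7 0 0 = n ∧ ∀ g < m, ∃ v : Fin n, s.natVector n 6 v = g) ∨
      (t.nat 7 0 0 < n ∧ ∀ v : Fin n, s.natVector n 6 v ≠ t.nat 7 0 0))
    (fun m t a ht => by simpa only [State.setNat_nat_of_ne (show 7 ≠ 10 by decide)] using ht)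
    (Or.inl ⟨h7, by simp⟩) ?_
  · rw [h0, hn] at this
    rcases this with ⟨h1, h2⟩ | ⟨h1, h2⟩
    · refine ⟨h1.le, fun v hv => ?_⟩
      rw [h1] at hv
      -- The search covers only the levels below `n`, with `n` as default value. If these are all
      -- occupied and `n` is a label too, then `n` vertices carry `n + 1` distinct labels.
      have hsurj : ∀ g : Fin (n + 1), ∃ v : Fin n, s.natVector n 6 v = g := by
        intro g
        rcases Nat.lt_succ_iff_lt_or_eq.mp g.2 with hg | hg
        · exact h2 g hg
        · exact ⟨v, by rw [hv, hg]⟩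
      choose f hf using hsurj
      have hinj : Function.Injective f := by
        intro x y hxy
        apply Fin.ext
        rw [← hf x, ← hf y, hxy]
      have := Fintype.card_le_of_injective f hinj
      simp at this
    · exact ⟨h1.le, h2⟩
  · intro m t hm hc hN hR hI
    simp only [run_seq]
    set t₁ := (setNat 8 (.const 0) (.const 0) (.const 0)).run t with ht₁
    have hcount := forN_induct (A := 11)
      (P := ite (.pos (.eq (.cell 6 (.const 0) (nvar 11)) (nvar 10)))
          (setNat 8 (.const 0) (.const 0) (.const 1)) skip) rfl t₁
      (fun j t' => (t'.nat 8 0 0 = 1 ∧ ∃ v : Fin n, s.natVector n 6 v = m) ∨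
        (t'.nat 8 0 0 = 0 ∧ ∀ v : Fin n, v < j → s.natVector n 6 v ≠ m))
      (fun j t a ht => by simpa only [State.setNat_nat_of_ne (show 8 ≠ 11 by decide)] using ht)
      (Or.inr ⟨by simp [ht₁, NExpr.eval, State.setNat_nat_self], by simp⟩) ?_
    · have t0 : t₁.nat 0 0 0 = n := by
        rw [ht₁, run_nat_of_not_writes _ rfl, hN 0 rfl, h0, hn]
      rw [t0] at hcount
      set t₂ := (forN 11 (ite (.pos (.eq (.cell 6 (.const 0) (nvar 11)) (nvar 10)))
          (setNat 8 (.const 0) (.const 0) (.const 1)) skip)).run t₁ with ht₂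
      have a7 : t₂.nat 7 = t.nat 7 := by
        rw [ht₂, run_nat_of_not_writes _ rfl, ht₁, run_nat_of_not_writes _ rfl]
      have a10 : t₂.nat 10 0 0 = m := by
        rw [ht₂, run_nat_of_not_writes _ rfl, ht₁, run_nat_of_not_writes _ rfl, hc]
      rcases hcount with ⟨h1, v, hv⟩ | ⟨h1, h2⟩
      · rw [run_ite_true _ _ (by simp [BExpr.Holds, NExpr.eval, h1]), run_skip, a7]
        refine hI.imp_left fun h => ⟨h.1, fun g hg => ?_⟩
        rcases eq_or_ne g m with rfl | hne
        · exact ⟨v, hv⟩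
        · exact h.2 g (by omega)
      · rw [run_ite_false _ _ (by simp [BExpr.Holds, NExpr.eval, h1])]
        right
        simp only [run_setNat, NExpr.eval, State.setNat_nat_self, a10]
        rw [h0, hn] at hm
        exact ⟨by simpa using hm, fun v => by simpa using h2 v v.2⟩
    · intro j t' hj hcj hN' hR' hI'
      have b10 : t'.nat 10 0 0 = m := by
        rw [hN' 10 rfl, ht₁, run_nat_of_not_writes _ rfl, hc]
      have b6 : t'.nat 6 = s.nat 6 := by
        rw [hN' 6 rfl, ht₁, run_nat_of_not_writes _ rfl, hN 6 rfl, h6]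
      have t0 : t₁.nat 0 0 0 = n := by
        rw [ht₁, run_nat_of_not_writes _ rfl, hN 0 rfl, h0, hn]
      rw [t0] at hj
      by_cases heq : s.nat 6 0 j = m
      · rw [run_ite_true _ _ (by simp [BExpr.Holds, NExpr.eval, NExpr.eval_eq, b10, b6, hcj, heq])]
        left
        exact ⟨by simp [NExpr.eval, State.setNat_nat_self], ⟨j, hj⟩, heq⟩
      · rw [run_ite_false _ _ (by simp [BExpr.Holds, NExpr.eval, NExpr.eval_eq, b10, b6, hcj, heq]),
          run_skip]
        refine hI'.imp_right fun h => ⟨h.1, fun v hv => ?_⟩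
        rcases eq_or_ne (v : ℕ) j with hv' | hne
        · simpa [State.natVector, hv'] using heq
        · exact h.2 v (by omega)

/-- Find a set that minimizes the cut function with the capacities in the real array `2` and the
vertex weights in the real array `3`. -/
def minCut : Cmd :=
  seq (fillNat 6 (.const 0) (.const 0))
    (seq (repeatPow 12 (forN 10 discharge) 5)
      (seq findGap
        (fillNat 9 (.const 0) (.sub (.const 1)
          (.sub (.const 1) (.sub (.cell 6 (.const 0) (nvar 50)) (nvar 7)))))))

/-- The potential is at most `n ^ 5` at the start. After that many sweeps either some sweep found
nothing to do or the potential is 0; both mean that no excess is active, and the gap yields the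
minimizer. -/
theorem run_minCut {n : ℕ} (h2 : 2 ≤ n) {s : State} (hn : s.nat 0 0 0 = n)
    (hc : ∀ u v, 0 ≤ s.matrix n 2 u v) (T : Finset (Fin n)) :
    cutObjective (s.matrix n 2) (s.vector n 3) ((minCut.run s).row n 9 0) ≤
      cutObjective (s.matrix n 2) (s.vector n 3) T := by
  simp only [minCut, run_seq]
  set s₁ := (fillNat 6 (.const 0) (.const 0)).run s with hs₁
  have e6 : s₁.natVector n 6 = fun _ => 0 := by
    funext v
    exact (run_fillNat (A := 6) (i := .const 0) (X := .const 0) (by decide) (by decide) s 0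
      (fun _ => 0) (by simp [NExpr.eval])).1 v (by rw [hn]; exact v.2)
  have e2 : s₁.matrix n 2 = s.matrix n 2 := by
    unfold State.matrix
    rw [hs₁, run_real_of_not_writes _ rfl]
  have e3 : s₁.vector n 3 = s.vector n 3 := by
    unfold State.vector
    rw [hs₁, run_real_of_not_writes _ rfl]
  have n1 : s₁.nat 0 0 0 = n := by rw [hs₁, run_nat_of_not_writes _ rfl, hn]
  set c := s.matrix n 2
  set b := s.vector n 3
  have H1 : s₁.Labelled c b := by
    unfold State.Labelled
    rw [e2, e3, e6]
    exact IsLabelledPreflow.init hc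
  have hrep := repeatPow_induct (A := 12) (P := forN 10 discharge)
    (fun j t => t.Labelled c b ∧ (t.potential n + j ≤ s₁.potential n ∨ t.Done n)) n
    (fun i t ht hQ => by
      obtain ⟨q1, q2⟩ := run_forN_discharge ht hQ.1
      refine ⟨q1, ?_⟩
      rcases q2 with q2 | q2
      · rcases hQ.2 with h | h
        · left; omega
        · exact absurd h q2.2
      · exact Or.inr q2.1) 5 rfl
    (fun i t B a hB hB' hQ => by
      have : (t.setNat B 0 0 a).natVector n 6 = t.natVector n 6 := by
        unfold State.natVector
        rw [State.setNat_nat_of_ne (by omega)]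
      unfold State.Labelled State.potential State.Done at hQ ⊢
      rw [this]
      exact hQ) 0 s₁ n1 ⟨H1, Or.inl le_rfl⟩
  set s₂ := (repeatPow 12 (forN 10 discharge) 5).run s₁ with hs₂
  have n2 : s₂.nat 0 0 0 = n := by rw [hs₂, run_nat_of_not_writes _ rfl, n1]
  obtain ⟨H2, hd⟩ := hrep
  have hdone : s₂.Done n := by
    refine hd.elim (fun hle => ?_) id
    have h5 : s₁.potential n ≤ n ^ 5 := by
      unfold State.potential
      rw [e6]
      simpa using pushRelabelPotential_init_le (V := Fin n) (r := s₁.matrix n 2)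
        (e := s₁.vector n 3) (by simpa using h2)
    have h0 : s₂.potential n = 0 := by omega
    intro v _
    simpa using eq_card_of_pushRelabelPotential_eq_zero H2 h0 v
  obtain ⟨g1, g2⟩ := run_findGap n2
  have f6 : (findGap.run s₂).nat 6 = s₂.nat 6 := run_nat_of_not_writes _ rfl _
  have n3 : (findGap.run s₂).nat 0 0 0 = n := by rw [run_nat_of_not_writes _ rfl, n2]
  set s₃ := findGap.run s₂ with hs₃
  -- With truncated subtraction, `1 - (1 - (h - g))` is the indicator of `g < h`.
  have hrow := (run_fillNat (A := 9) (i := .const 0) (X := .sub (.const 1)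
          (.sub (.const 1) (.sub (.cell 6 (.const 0) (nvar 50)) (nvar 7)))) (by decide) (by decide)
      s₃ 0 (fun v => 1 - (1 - (s₂.nat 6 0 v - s₃.nat 7 0 0)))
      (fun t v hv hN hR hc _ => ⟨rfl, by simp [NExpr.eval, hN, hc, f6]⟩)).1
  have hset : ((fillNat 9 (.const 0) (.sub (.const 1)
          (.sub (.const 1) (.sub (.cell 6 (.const 0) (nvar 50)) (nvar 7))))).run s₃).row n 9 0 =
      Finset.univ.filter fun v => s₃.nat 7 0 0 < s₂.natVector n 6 v := by
    ext v
    rw [State.mem_row, hrow v (by rw [n3]; exact v.2)]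
    rw [Finset.mem_filter]
    simp only [Finset.mem_univ, true_and, State.natVector]
    omega
  rw [hset]
  exact H2.cutObjective_le (fun v hv => by simpa using hdone v hv) (by simpa using g1) g2 T

end Cmd
end RealRAM

/-! ## Cuts of weight matrices -/

section CutWeight

set_option linter.unusedSectionVars false

variable {V : Type*} [DecidableEq V]

/-- The weight of the cut `(X, S \ X)` of `S` for a weight matrix `a`. -/
def cutWeight (a : V → V → ℝ) (S X : Finset V) : ℝ := ∑ u ∈ X, ∑ v ∈ S \ X, a u v

/-- `X` is a non-empty proper subset of `S`. -/
def IsProperPart (S X : Finset V) : Prop := X ⊆ S ∧ X.Nonempty ∧ X ≠ S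

theorem IsProperPart.of_mem {S X : Finset V} {x y : V} (hX : X ⊆ S) (hx : x ∈ X) (hy : y ∈ S)
    (hyX : y ∉ X) : IsProperPart S X :=
  ⟨hX, ⟨x, hx⟩, fun h => hyX (h ▸ hy)⟩

theorem IsProperPart.exists_mem {S X : Finset V} (h : IsProperPart S X) :
    ∃ x ∈ X, ∃ y ∈ S, y ∉ X := by
  obtain ⟨h1, ⟨x, hx⟩, h3⟩ := h
  by_contra! hne
  exact h3 (h1.antisymm (hne x hx))

theorem cutWeight_nonneg {a : V → V → ℝ} (ha : ∀ u v, 0 ≤ a u v) (S X : Finset V) :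
    0 ≤ cutWeight a S X :=
  Finset.sum_nonneg fun u _ => Finset.sum_nonneg fun v _ => ha u v

/-- The pairs between `T ∩ X` and the rest of `T` are among those between `X` and `S \ X`: a cut of
`S` induces no heavier one on `T`. -/
theorem cutWeight_inter_le {a : V → V → ℝ} (ha : ∀ u v, 0 ≤ a u v) {S T : Finset V} (hTS : T ⊆ S)
    (X : Finset V) : cutWeight a T (T ∩ X) ≤ cutWeight a S X := by
  unfold cutWeight
  refine (Finset.sum_le_sum fun u _ => Finset.sum_le_sum_of_subset_of_nonneg
    (t := S \ X) ?_ fun v _ _ => ha u v).trans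
    (Finset.sum_le_sum_of_subset_of_nonneg Finset.inter_subset_right
      fun u _ _ => Finset.sum_nonneg fun v _ => ha u v)
  intro v hv
  simp only [Finset.mem_sdiff, Finset.mem_inter, not_and] at hv ⊢
  exact ⟨hTS hv.1, hv.2 hv.1⟩

theorem cutWeight_sdiff {a : V → V → ℝ} (ha : ∀ u v, a u v = a v u) {S X : Finset V} (h : X ⊆ S) :
    cutWeight a S (S \ X) = cutWeight a S X := by
  unfold cutWeight
  rw [Finset.sdiff_sdiff_eq_self h, Finset.sum_comm]
  exact Finset.sum_congr rfl fun u _ => Finset.sum_congr rfl fun v _ => ha _ _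

variable [Fintype V]

theorem cutWeight_lt {a : V → V → ℝ} (ha : ∀ u v, 0 ≤ a u v) (S X : Finset V) :
    cutWeight a S X < ∑ u, ∑ v, a u v + 1 := by
  have : cutWeight a S X ≤ ∑ u, ∑ v, a u v :=
    (Finset.sum_le_sum fun u _ => Finset.sum_le_sum_of_subset_of_nonneg (Finset.subset_univ _)
      fun v _ _ => ha u v).trans (Finset.sum_le_sum_of_subset_of_nonneg (Finset.subset_univ _)
        fun u _ _ => Finset.sum_nonneg fun v _ => ha u v)
  linarith

/-- With capacities confined to `S`, vertices outside `S` matter only through their weights `b`. So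
flows on all `n` vertices can serve any subset. -/
theorem cutObjective_restrict (a : V → V → ℝ) (b : V → ℝ) (S T : Finset V) :
    cutObjective (fun u v => if u ∈ S ∧ v ∈ S then a u v else 0) b T =
      cutWeight a S (S ∩ T) - ∑ v ∈ T, b v := by
  unfold cutObjective cutWeight
  congr 1
  simp only [ite_and]
  have : ∀ u, ∑ v ∈ Tᶜ, (if u ∈ S then if v ∈ S then a u v else 0 else 0) =
      if u ∈ S then ∑ v ∈ S \ (S ∩ T), a u v else 0 := by
    intro u
    split_ifs
    · rw [Finset.sum_ite_mem]
      congr 1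
      ext v
      simp
      tauto
    · simp
  simp only [this]
  rw [Finset.sum_ite_mem, Finset.inter_comm]

/-- Weights that attract `x` and repel `y` make the minimizer a minimum cut between them. -/
theorem separates_of_minimizer {a : V → V → ℝ} (ha : ∀ u v, 0 ≤ a u v) {S T : Finset V}
    {x y : V} (hx : x ∈ S) (hxy : x ≠ y) {M : ℝ} (hM : ∀ Y, cutWeight a S Y < M)
    {b : V → ℝ} (hb : ∀ v, b v = (if v = x then M else 0) - (if v = y then M else 0))
    (hT : ∀ Y, cutObjective (fun u v => if u ∈ S ∧ v ∈ S then a u v else 0) b T ≤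
      cutObjective (fun u v => if u ∈ S ∧ v ∈ S then a u v else 0) b Y) :
    x ∈ T ∧ y ∉ T ∧ ∀ Y ⊆ S, x ∈ Y → y ∉ Y → cutWeight a S (S ∩ T) ≤ cutWeight a S Y := by
  have hsum : ∀ Y : Finset V, ∑ v ∈ Y, b v = (if x ∈ Y then M else 0) - (if y ∈ Y then M else 0) := by
    intro Y
    simp only [hb, Finset.sum_sub_distrib, Finset.sum_ite_eq']
  simp only [cutObjective_restrict, hsum] at hT
  have hM0 : 0 < M := (cutWeight_nonneg ha S ∅).trans_lt (hM ∅)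
  -- The set `{x}` has a negative objective, because `M` exceeds its cut weight. A set that misses
  -- `x` or contains `y` gains nothing from `b`, so its objective is non-negative and it cannot be a
  -- minimizer.
  have h1 := hT {x}
  have h2 : S ∩ {x} = {x} := by simpa using hx
  have h3 := hM {x}
  rw [h2] at h1
  simp only [Finset.mem_singleton, if_true, hxy.symm, if_false] at h1
  have h4 := cutWeight_nonneg ha S (S ∩ T)
  have hxT : x ∈ T := by
    by_contra h
    simp only [h, if_false] at h1
    split_ifs at h1 <;> linarith
  have hyT : y ∉ T := by
    intro h
    simp only [h, hxT, if_true] at h1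
    linarith
  refine ⟨hxT, hyT, fun Y hY hxY hyY => ?_⟩
  have h5 := hT Y
  rw [Finset.inter_eq_right.mpr hY] at h5
  simp only [hxT, hyT, hxY, hyY, if_true, if_false] at h5
  linarith

end CutWeight

namespace RealRAM

theorem State.row_congr {s t : State} {A : ℕ} (h : t.nat A = s.nat A) (n i : ℕ) :
    t.row n A i = s.row n A i := by
  ext v
  simp [h]

namespace Cmd

/-! ## Global minimum cuts

The set is in row `0` of the natural number array `26`. If it has a cut, the cell `(0, 0)` of the
array `24` becomes one, and a minimum cut and its weight are returned in row `0` of the array `25`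
and in the real array `6`. -/

/-- Find a minimum cut between the counters `20` and `21`, and store it if it is the best so far. -/
def separate : Cmd :=
  seq (fillReal₂ 2 (.mul (.mul (.cell 0 (nvar 50) (nvar 51)) (.ofNat (.mem 26 (nvar 50))))
      (.ofNat (.mem 26 (nvar 51)))))
    (seq (fillReal 3 (.sub (.mul (rvar 7) (.ofNat (.eq (nvar 50) (nvar 20))))
        (.mul (rvar 7) (.ofNat (.eq (nvar 50) (nvar 21))))))
      (seq minCut
        (seq (fillNat 23 (.const 0)
            (.sub (.add (.mem 26 (nvar 50)) (.mem 9 (nvar 50))) (.const 1)))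
          (seq (sum₂ 5 (.mul (.mul (.cell 0 (nvar 50) (nvar 51)) (.ofNat (.mem 23 (nvar 50))))
              (.ofNat (.sub (.mem 26 (nvar 51)) (.mem 23 (nvar 51))))))
            (ite (.and (.pos (nvar 24)) (.not (.realLT (rvar 5) (rvar 6)))) skip
              (seq (setNat 24 (.const 0) (.const 0) (.const 1))
                (seq (setReal 6 (.const 0) (.const 0) (rvar 5))
                  (fillNat 25 (.const 0) (.mem 23 (nvar 50))))))))))

/-- The memory holds a cut of `S` and its weight. -/
def _root_.RealRAM.State.HoldsCut (s : State) {n : ℕ} (a : Fin n → Fin n → ℝ) (S : Finset (Fin n)) :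
    Prop :=
  s.nat 24 0 0 = 1 ∧ IsProperPart S (s.row n 25 0) ∧
    s.real 6 0 0 = cutWeight a S (s.row n 25 0)

/-- The three conclusions keep the search going: a valid cut is stored, it is no heavier than any
cut separating `x` from `y`, and it is no heavier than the one stored before. -/
theorem run_separate {n : ℕ} (h2 : 2 ≤ n) {s : State} (hn : s.nat 0 0 0 = n)
    {a : Fin n → Fin n → ℝ} (ha : s.matrix n 0 = a) (ha0 : ∀ u v, 0 ≤ a u v)
    {S : Finset (Fin n)} (hS : s.row n 26 0 = S) (hM : ∀ Y, cutWeight a S Y < s.real 7 0 0)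
    {x y : Fin n} (hx : s.nat 20 0 0 = x) (hy : s.nat 21 0 0 = y) (hxS : x ∈ S) (hyS : y ∈ S)
    (hxy : x ≠ y) (hI : s.nat 24 0 0 = 0 ∨ s.HoldsCut a S) :
    (separate.run s).HoldsCut a S ∧
      (∀ Y ⊆ S, x ∈ Y → y ∉ Y → (separate.run s).real 6 0 0 ≤ cutWeight a S Y) ∧
      (s.nat 24 0 0 = 1 → (separate.run s).real 6 0 0 ≤ s.real 6 0 0) := by
  simp only [separate, run_seq]
  have memS : ∀ v : Fin n, s.nat 26 0 v = 1 ↔ v ∈ S := fun v => by rw [← hS, State.mem_row]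
  -- capacities
  have hcap := run_fillReal₂ (A := 2) (X := .mul (.mul (.cell 0 (nvar 50) (nvar 51))
      (.ofNat (.mem 26 (nvar 50)))) (.ofNat (.mem 26 (nvar 51)))) s
    (fun u v => s.real 0 u v * (if s.nat 26 0 u = 1 then 1 else 0) *
      (if s.nat 26 0 v = 1 then 1 else 0))
    (fun t u v hu hv hN hR h50 h51 => by
      simp [NExpr.eval, RExpr.eval, NExpr.eval_ind, hN, hR, h50, h51])
  set s₁ := (fillReal₂ 2 (.mul (.mul (.cell 0 (nvar 50) (nvar 51)) (.ofNat (.mem 26 (nvar 50))))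
      (.ofNat (.mem 26 (nvar 51))))).run s with hs₁
  have hn1 : ∀ B, B ≠ 50 → B ≠ 51 → s₁.nat B = s.nat B := fun B h h' =>
    run_nat_of_not_writes _ (by simp [fillReal₂, writesNat, h, h']) _
  have hr1 : ∀ B, B ≠ 2 → s₁.real B = s.real B := fun B h =>
    run_real_of_not_writes _ (by simp [fillReal₂, writesReal, h]) _
  have c1 : s₁.matrix n 2 = fun u v => if u ∈ S ∧ v ∈ S then a u v else 0 := by
    funext u v
    have := hcap u v (by rw [hn]; exact u.2) (by rw [hn]; exact v.2)
    simp only [State.matrix, this, memS, ite_and, ← ha]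
    split_ifs <;> simp
  -- vertex weights
  have hwt := run_fillReal (A := 3) (X := .sub (.mul (rvar 7) (.ofNat (.eq (nvar 50) (nvar 20))))
        (.mul (rvar 7) (.ofNat (.eq (nvar 50) (nvar 21))))) s₁
    (fun v => s.real 7 0 0 * (if v = x then 1 else 0) - s.real 7 0 0 * (if v = y then 1 else 0))
    (fun t v hv hN hR h50 => by
      simp [NExpr.eval, RExpr.eval, NExpr.eval_eq, hN, hR, h50, hn1, hr1, hx, hy])
  set s₂ := (fillReal 3 (.sub (.mul (rvar 7) (.ofNat (.eq (nvar 50) (nvar 20))))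
        (.mul (rvar 7) (.ofNat (.eq (nvar 50) (nvar 21)))))).run s₁ with hs₂
  have hn2 : ∀ B, B ≠ 50 → B ≠ 51 → s₂.nat B = s.nat B := fun B h h' => by
    rw [← hn1 B h h']
    exact run_nat_of_not_writes _ (by simp [fillReal, writesNat, h]) _
  have hr2 : ∀ B, B ≠ 2 → B ≠ 3 → s₂.real B = s.real B := fun B h h' => by
    rw [← hr1 B h]
    exact run_real_of_not_writes _ (by simp [fillReal, writesReal, h']) _
  have c2 : s₂.matrix n 2 = fun u v => if u ∈ S ∧ v ∈ S then a u v else 0 := by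
    rw [← c1]
    unfold State.matrix
    rw [hs₂, run_real_of_not_writes _ rfl]
  have b2 : ∀ v, s₂.vector n 3 v = (if v = x then s.real 7 0 0 else 0) -
      (if v = y then s.real 7 0 0 else 0) := by
    intro v
    have := hwt v (by rw [hn1 0 (by decide) (by decide), hn]; exact v.2)
    simp only [State.vector, this, Fin.ext_iff]
    split_ifs <;> simp
  -- the minimum cut
  have n2 : s₂.nat 0 0 0 = n := by rw [hn2 0 (by decide) (by decide), hn]
  have hmin := run_minCut h2 n2 (fun u v => by
    rw [c2]
    dsimp only
    split_ifs
    · exact ha0 u v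
    · exact le_rfl)
  set s₃ := minCut.run s₂ with hs₃
  rw [c2] at hmin
  obtain ⟨k1, k2, k3⟩ := separates_of_minimizer ha0 hxS hxy hM b2 hmin
  -- its restriction to the set
  have h26 : s₃.nat 26 = s.nat 26 := by
    rw [hs₃, run_nat_of_not_writes _ rfl, hn2 26 (by decide) (by decide)]
  have h24 : s₃.nat 24 = s.nat 24 := by
    rw [hs₃, run_nat_of_not_writes _ rfl, hn2 24 (by decide) (by decide)]
  have h25 : s₃.nat 25 = s.nat 25 := by
    rw [hs₃, run_nat_of_not_writes _ rfl, hn2 25 (by decide) (by decide)]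
  have hr0 : s₃.real 0 = s.real 0 := by
    rw [hs₃, run_real_of_not_writes _ rfl, hr2 0 (by decide) (by decide)]
  have hr6 : s₃.real 6 = s.real 6 := by
    rw [hs₃, run_real_of_not_writes _ rfl, hr2 6 (by decide) (by decide)]
  have n3 : s₃.nat 0 0 0 = n := by rw [hs₃, run_nat_of_not_writes _ rfl, n2]
  have hcand := (run_fillNat (A := 23) (i := .const 0)
      (X := .sub (.add (.mem 26 (nvar 50)) (.mem 9 (nvar 50))) (.const 1)) (by decide) (by decide)
      s₃ 0 (fun v => (if s.nat 26 0 v = 1 then 1 else 0) + (if s₃.nat 9 0 v = 1 then 1 else 0) - 1)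
      (fun t v hv hN hR h50 _ => ⟨rfl, by
        simp [NExpr.eval, NExpr.eval_ind, hN, h50, h26]⟩)).1
  set s₄ := (fillNat 23 (.const 0)
      (.sub (.add (.mem 26 (nvar 50)) (.mem 9 (nvar 50))) (.const 1))).run s₃ with hs₄
  set X := S ∩ s₃.row n 9 0 with hX
  have h23 : s₄.row n 23 0 = X := by
    ext v
    rw [State.mem_row, hcand v (by rw [n3]; exact v.2), hX, Finset.mem_inter, State.mem_row,
      ← memS]
    split_ifs <;> simp_all
  have mem23 : ∀ v : Fin n, s₄.nat 23 0 v = 1 ↔ v ∈ X := fun v => by rw [← h23, State.mem_row]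
  have hn4 : ∀ B, B ≠ 50 → B ≠ 23 → s₄.nat B = s₃.nat B := fun B h h' =>
    run_nat_of_not_writes _ (by simp [fillNat, writesNat, h, h']) _
  have hr4 : s₄.real = s₃.real := by
    funext B
    exact run_real_of_not_writes _ (by simp [fillNat, writesReal]) _
  have n4 : s₄.nat 0 0 0 = n := by rw [hn4 0 (by decide) (by decide), n3]
  -- its weight
  have hsum := run_sum₂ (A := 5) (X := .mul (.mul (.cell 0 (nvar 50) (nvar 51))
      (.ofNat (.mem 23 (nvar 50)))) (.ofNat (.sub (.mem 26 (nvar 51)) (.mem 23 (nvar 51))))) s₄ n4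
    (fun u v => s.real 0 u v * (if s₄.nat 23 0 u = 1 then 1 else 0) *
      (((if s.nat 26 0 v = 1 then 1 else 0) - (if s₄.nat 23 0 v = 1 then 1 else 0) : ℕ) : ℝ))
    (fun t u v hu hv hN hR h50 h51 => by
      have g23 := hN 23 (by decide) (by decide)
      have g26 : t.nat 26 = s.nat 26 := by
        rw [hN 26 (by decide) (by decide), hn4 26 (by decide) (by decide), h26]
      have g0 : t.real 0 = s.real 0 := by rw [hR 0 (by decide), hr4, hr0]
      simp [NExpr.eval, RExpr.eval, NExpr.eval_ind, g23, g26, g0, h50, h51])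
  set s₅ := (sum₂ 5 (.mul (.mul (.cell 0 (nvar 50) (nvar 51)) (.ofNat (.mem 23 (nvar 50))))
              (.ofNat (.sub (.mem 26 (nvar 51)) (.mem 23 (nvar 51)))))).run s₄ with hs₅
  have h5 : s₅.real 5 0 0 = cutWeight a S X := by
    rw [hsum]
    unfold cutWeight
    rw [← Finset.sum_filter_add_sum_filter_not Finset.univ (· ∈ X)]
    have e1 : Finset.univ.filter (· ∈ X) = X := by ext; simp
    rw [e1, Finset.sum_eq_zero (s := Finset.univ.filter (· ∉ X)), add_zero]
    · refine Finset.sum_congr rfl fun u hu => ?_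
      have e2 : S \ X = Finset.univ.filter (· ∈ S \ X) := by ext; simp
      rw [e2, Finset.sum_filter]
      refine Finset.sum_congr rfl fun v _ => ?_
      simp only [memS, mem23, hu, if_true, mul_one, Finset.mem_sdiff]
      by_cases p1 : v ∈ S <;> by_cases p2 : v ∈ X <;> simp [p1, p2, ← ha, State.matrix]
    · intro u hu
      refine Finset.sum_eq_zero fun v _ => ?_
      simp only [Finset.mem_filter, Finset.mem_univ, true_and] at hu
      simp [mem23, hu]
  have hn5 : ∀ B, B ≠ 50 → B ≠ 51 → s₅.nat B = s₄.nat B := fun B h h' =>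
    run_nat_of_not_writes _ (by simp [sum₂, writesNat, h, h']) _
  have hr5 : ∀ B, B ≠ 5 → s₅.real B = s₄.real B := fun B h =>
    run_real_of_not_writes _ (by simp [sum₂, writesReal, h]) _
  have t24 : s₅.nat 24 = s.nat 24 := by
    rw [hn5 24 (by decide) (by decide), hn4 24 (by decide) (by decide), h24]
  have t25 : s₅.nat 25 = s.nat 25 := by
    rw [hn5 25 (by decide) (by decide), hn4 25 (by decide) (by decide), h25]
  have t23 : s₅.nat 23 = s₄.nat 23 := hn5 23 (by decide) (by decide)
  have t6 : s₅.real 6 = s.real 6 := by rw [hr5 6 (by decide), hr4, hr6]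
  have n5 : s₅.nat 0 0 0 = n := by rw [hn5 0 (by decide) (by decide), n4]
  by_cases hbest : s.nat 24 0 0 = 1 ∧ ¬ cutWeight a S X < s.real 6 0 0
  · rw [run_ite_true, run_skip]
    · have hH : s.HoldsCut a S := by
        rcases hI with h | h
        · omega
        · exact h
      unfold State.HoldsCut
      rw [t24, t6, State.row_congr t25]
      exact ⟨hH, fun Y hY hxY hyY => (not_lt.mp hbest.2).trans (k3 Y hY hxY hyY), fun _ => le_rfl⟩
    · simpa [BExpr.Holds, NExpr.eval, RExpr.eval, t24, t6, h5, hbest.1] using hbest.2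
  · rw [run_ite_false]
    · simp only [run_seq]
      set s₆ := (setReal 6 (.const 0) (.const 0) (rvar 5)).run
        ((setNat 24 (.const 0) (.const 0) (.const 1)).run s₅) with hs₆
      have u23 : s₆.nat 23 = s₄.nat 23 := by
        rw [hs₆, run_nat_of_not_writes _ rfl, run_nat_of_not_writes _ rfl, t23]
      have u24 : s₆.nat 24 0 0 = 1 := by
        simp [hs₆, NExpr.eval, State.setNat_nat_self]
      have u6 : s₆.real 6 0 0 = cutWeight a S X := by
        simp [hs₆, NExpr.eval, RExpr.eval, State.setReal_real_self, h5]
      have n6 : s₆.nat 0 0 0 = n := by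
        rw [hs₆, run_nat_of_not_writes _ rfl, run_nat_of_not_writes _ rfl, n5]
      have hfin := (run_fillNat (A := 25) (i := .const 0) (X := .mem 23 (nvar 50)) (by decide)
        (by decide) s₆ 0 (fun v => if s₄.nat 23 0 v = 1 then 1 else 0)
        (fun t v hv hN hR h50 _ => ⟨rfl, by simp [NExpr.eval, NExpr.eval_ind, hN, h50, u23]⟩)).1
      have hrow : ((fillNat 25 (.const 0) (.mem 23 (nvar 50))).run s₆).row n 25 0 = X := by
        ext v
        rw [State.mem_row, hfin v (by rw [n6]; exact v.2), ← mem23]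
        simp
      have v24 : ((fillNat 25 (.const 0) (.mem 23 (nvar 50))).run s₆).nat 24 0 0 = 1 := by
        rw [run_nat_of_not_writes _ rfl, u24]
      have v6 : ((fillNat 25 (.const 0) (.mem 23 (nvar 50))).run s₆).real 6 0 0 =
          cutWeight a S X := by
        rw [run_real_of_not_writes _ rfl, u6]
      refine ⟨⟨v24, ?_, ?_⟩, ?_, ?_⟩
      · rw [hrow]
        exact .of_mem Finset.inter_subset_left (Finset.mem_inter.mpr ⟨hxS, k1⟩) hyS
          fun h => k2 (Finset.mem_inter.mp h).2
      · rw [hrow, v6]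
      · rw [v6]
        exact k3
      · intro h
        rw [v6]
        by_contra hlt
        exact hbest ⟨h, fun hlt' => hlt hlt'.le⟩
    · intro hh
      simp only [BExpr.Holds, NExpr.eval, RExpr.eval, t24, t6, h5] at hh
      refine hbest ⟨?_, hh.2⟩
      rcases hI with h | h
      · omega
      · exact h.1

/-- Find a minimum cut. -/
def globalMinCut : Cmd :=
  seq (setNat 24 (.const 0) (.const 0) (.const 0))
    (seq (sum₂ 7 (.cell 0 (nvar 50) (nvar 51)))
      (seq (setReal 7 (.const 0) (.const 0) (.add (rvar 7) (.ofNat (.const 1))))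
        (forN 20 (forN 21 (ite (.and (.pos (.mem 26 (nvar 20))) (.and (.pos (.mem 26 (nvar 21)))
          (.not (.pos (.eq (nvar 20) (nvar 21)))))) separate skip)))))

/-- Every cut separates some ordered pair of members of `S`, so the best separating cut over all
pairs is a global minimum. If there is no such pair, `S` has no cut and the flag stays 0. The
separating weight is the total of the matrix plus one. -/
theorem run_globalMinCut {n : ℕ} (h2 : 2 ≤ n) {s : State} (hn : s.nat 0 0 0 = n)
    {a : Fin n → Fin n → ℝ} (ha : s.matrix n 0 = a) (ha0 : ∀ u v, 0 ≤ a u v)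
    {S : Finset (Fin n)} (hS : s.row n 26 0 = S) :
    (globalMinCut.run s).HoldsCut a S ∧
        (∀ Y, IsProperPart S Y → (globalMinCut.run s).real 6 0 0 ≤ cutWeight a S Y) ∨
      (globalMinCut.run s).nat 24 0 0 = 0 ∧ ∀ Y, ¬ IsProperPart S Y := by
  simp only [globalMinCut, run_seq]
  set s₀ := (setNat 24 (.const 0) (.const 0) (.const 0)).run s with hs₀
  have n0 : s₀.nat 0 0 0 = n := by rw [hs₀, run_nat_of_not_writes _ rfl, hn]
  have hsum := run_sum₂ (A := 7) (X := .cell 0 (nvar 50) (nvar 51)) s₀ n0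
    (fun u v => s.real 0 u v)
    (fun t u v hu hv hN hR h50 h51 => by
      simp [NExpr.eval, RExpr.eval, hR, h50, h51, hs₀])
  set s₁ := (sum₂ 7 (.cell 0 (nvar 50) (nvar 51))).run s₀ with hs₁
  set s₂ := (setReal 7 (.const 0) (.const 0) (.add (rvar 7) (.ofNat (.const 1)))).run s₁ with hs₂
  have e24 : s₂.nat 24 0 0 = 0 := by
    rw [hs₂, run_nat_of_not_writes _ rfl, hs₁, run_nat_of_not_writes _ rfl]
    simp [hs₀, NExpr.eval, State.setNat_nat_self]
  have e0 : s₂.nat 0 0 0 = n := by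
    rw [hs₂, run_nat_of_not_writes _ rfl, hs₁, run_nat_of_not_writes _ rfl, n0]
  have e26 : s₂.nat 26 = s.nat 26 := by
    rw [hs₂, run_nat_of_not_writes _ rfl, hs₁, run_nat_of_not_writes _ rfl, hs₀,
      run_nat_of_not_writes _ rfl]
  have r0 : s₂.real 0 = s.real 0 := by
    rw [hs₂, run_real_of_not_writes _ rfl, hs₁, run_real_of_not_writes _ rfl, hs₀,
      run_real_of_not_writes _ rfl]
  have hM : ∀ Y, cutWeight a S Y < s₂.real 7 0 0 := by
    intro Y
    have : s₂.real 7 0 0 = ∑ u, ∑ v, a u v + 1 := by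
      simp [hs₂, NExpr.eval, RExpr.eval, State.setReal_real_self, hsum, ← ha, State.matrix]
    rw [this]
    exact cutWeight_lt ha0 S Y
  have key := forN_induct (A := 20) (P := forN 21 (ite (.and (.pos (.mem 26 (nvar 20)))
      (.and (.pos (.mem 26 (nvar 21))) (.not (.pos (.eq (nvar 20) (nvar 21)))))) separate skip))
    rfl s₂ (fun m t => (t.nat 24 0 0 = 0 ∨ t.HoldsCut a S) ∧
      ∀ x y : Fin n, x < m → ∀ Y ⊆ S, x ∈ Y → y ∈ S → y ∉ Y →
        t.nat 24 0 0 = 1 ∧ t.real 6 0 0 ≤ cutWeight a S Y)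
    (fun m t a ht => ht) ⟨Or.inl e24, by simp⟩ ?_
  · rw [e0] at key
    obtain ⟨k1, k2⟩ := key
    rcases k1 with k1 | k1
    · refine Or.inr ⟨k1, fun Y hY => ?_⟩
      obtain ⟨x, hx, y, hy, hyY⟩ := hY.exists_mem
      have := (k2 x y x.2 Y hY.1 hx hy hyY).1
      omega
    · refine Or.inl ⟨k1, fun Y hY => ?_⟩
      obtain ⟨x, hx, y, hy, hyY⟩ := hY.exists_mem
      exact (k2 x y x.2 Y hY.1 hx hy hyY).2
  · intro i t hi hci hN hR hI
    have t0 : t.nat 0 0 0 = n := by rw [hN 0 rfl, e0]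
    have := forN_induct (A := 21) (P := ite (.and (.pos (.mem 26 (nvar 20)))
        (.and (.pos (.mem 26 (nvar 21))) (.not (.pos (.eq (nvar 20) (nvar 21)))))) separate skip)
      rfl t (fun m t => (t.nat 24 0 0 = 0 ∨ t.HoldsCut a S) ∧
        ∀ x y : Fin n, (x < i ∨ x = i ∧ y < m) → ∀ Y ⊆ S, x ∈ Y → y ∈ S → y ∉ Y →
          t.nat 24 0 0 = 1 ∧ t.real 6 0 0 ≤ cutWeight a S Y)
      (fun m t a ht => ht) ⟨hI.1, fun x y h => hI.2 x y (by omega)⟩ ?_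
    · refine ⟨this.1, fun x y hx => this.2 x y ?_⟩
      have := y.2
      omega
    · intro j t' hj hcj hN' hR' hI'
      rw [e0] at hi
      rw [t0] at hj
      have t'0 : t'.nat 0 0 0 = n := by rw [hN' 0 rfl, t0]
      have t'20 : t'.nat 20 0 0 = (⟨i, hi⟩ : Fin n) := by rw [hN' 20 rfl, hci]
      have t'26 : t'.nat 26 = s.nat 26 := by rw [hN' 26 rfl, hN 26 rfl, e26]
      have hS' : t'.row n 26 0 = S := by rw [State.row_congr t'26, hS]
      have ha' : t'.matrix n 0 = a := by
        rw [← ha]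
        unfold State.matrix
        rw [hR' 0 rfl, hR 0 rfl, r0]
      have hM' : ∀ Y, cutWeight a S Y < t'.real 7 0 0 := by
        rw [hR' 7 rfl, hR 7 rfl]
        exact hM
      have mi : t'.nat 26 0 i = 1 ↔ (⟨i, hi⟩ : Fin n) ∈ S := by rw [← hS', State.mem_row]
      have mj : t'.nat 26 0 j = 1 ↔ (⟨j, hj⟩ : Fin n) ∈ S := by rw [← hS', State.mem_row]
      by_cases hp : (⟨i, hi⟩ : Fin n) ∈ S ∧ (⟨j, hj⟩ : Fin n) ∈ S ∧ i ≠ j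
      · rw [run_ite_true]
        · obtain ⟨q1, q2, q3⟩ := run_separate h2 t'0 ha' ha0 hS' hM' t'20
            (y := ⟨j, hj⟩) hcj hp.1 hp.2.1 (by simpa using hp.2.2) hI'.1
          refine ⟨Or.inr q1, fun x y hxy Y hY hx hy hyY => ⟨q1.1, ?_⟩⟩
          by_cases hlast : (x : ℕ) = i ∧ (y : ℕ) = j
          · refine q2 Y hY ?_ ?_
            · convert hx; exact hlast.1.symm
            · convert hyY; exact hlast.2.symm
          · have := hI'.2 x y (by omega) Y hY hx hy hyY
            exact (q3 this.1).trans this.2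
        · simp [BExpr.Holds, NExpr.eval, NExpr.eval_ind, NExpr.eval_eq, t'20, hcj, mi, mj, hp]
      · rw [run_ite_false, run_skip]
        · refine ⟨hI'.1, fun x y hxy Y hY hx hy hyY => ?_⟩
          by_cases hlast : (x : ℕ) = i ∧ (y : ℕ) = j
          · exfalso
            have ex : x = ⟨i, hi⟩ := Fin.ext hlast.1
            have ey : y = ⟨j, hj⟩ := Fin.ext hlast.2
            subst ex ey
            refine hp ⟨hY hx, hy, ?_⟩
            rintro rfl
            exact hyY hx
          · exact hI'.2 x y (by omega) Y hY hx hy hyY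
        · intro hh
          simp only [BExpr.Holds, NExpr.eval, NExpr.eval_ind, NExpr.eval_eq, t'20, hcj, mi, mj] at hh
          refine hp ⟨?_, ?_, ?_⟩
          · by_contra h; simp [h] at hh
          · by_contra h; simp [h] at hh
          · rintro rfl; simp at hh

end Cmd
end RealRAM

/-! ### Sets without light cuts -/

section CutWeight

variable {V : Type*} [DecidableEq V]

/-- No cut of `S` has a weight with the property `P`. -/
def NoCut (a : V → V → ℝ) (P : ℝ → Prop) (S : Finset V) : Prop :=
  ∀ Y, IsProperPart S Y → ¬ P (cutWeight a S Y)

/-- If `X` met `T` without containing it, `T ∩ X` would be a cut of `T` no heavier than the cut `X`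
of `S`, hence light. So light cuts never divide a set without light cuts. -/
theorem NoCut.subset_or_disjoint {a : V → V → ℝ} (ha : ∀ u v, 0 ≤ a u v) {P : ℝ → Prop}
    (hP : ∀ x y, x ≤ y → P y → P x) {S T X : Finset V} (hT : NoCut a P T) (hTS : T ⊆ S)
    (hX : P (cutWeight a S X)) : T ⊆ X ∨ Disjoint T X := by
  by_contra! h
  obtain ⟨h1, h2⟩ := h
  refine hT (T ∩ X) ⟨Finset.inter_subset_left, ?_, ?_⟩ (hP _ _ (cutWeight_inter_le ha hTS X) hX)
  · rwa [Finset.not_disjoint_iff_nonempty_inter] at h2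
  · exact fun h => h1 (Finset.inter_eq_left.mp h)

end CutWeight

namespace RealRAM.Cmd

/-! ## Sets as rows -/

/-- Copy the set in row `0` of the array `A` to the array `C`. -/
def copySet (C A : ℕ) : Cmd := fillNat C (.const 0) (.mem A (nvar 50))

theorem row_copySet {C A : ℕ} (hC : C ≠ 0) (hC' : C ≠ 50) (hA : A ≠ C) (hA' : A ≠ 50) {n : ℕ}
    {s : State} (hn : s.nat 0 0 0 = n) :
    ((copySet C A).run s).row n C 0 = s.row n A 0 := by
  have := (run_fillNat (A := C) (i := .const 0) (X := .mem A (nvar 50)) hC hC' s 0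
    (fun v => if s.nat A 0 v = 1 then 1 else 0)
    (fun t v hv hN hR h50 _ => ⟨rfl, by
      simp [NExpr.eval, NExpr.eval_ind, hN A hA hA', h50]⟩)).1
  ext v
  rw [State.mem_row, State.mem_row, copySet, this v (by rw [hn]; exact v.2)]
  simp

/-- Store the intersection of the sets in the arrays `A` and `B` in the array `C`. -/
def interSet (C A B : ℕ) : Cmd :=
  fillNat C (.const 0) (.sub (.add (.mem A (nvar 50)) (.mem B (nvar 50))) (.const 1))

theorem row_interSet {C A B : ℕ} (hC : C ≠ 0) (hC' : C ≠ 50) (hA : A ≠ C) (hA' : A ≠ 50)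
    (hB : B ≠ C) (hB' : B ≠ 50) {n : ℕ} {s : State} (hn : s.nat 0 0 0 = n) :
    ((interSet C A B).run s).row n C 0 = s.row n A 0 ∩ s.row n B 0 := by
  have := (run_fillNat (A := C) (i := .const 0)
    (X := .sub (.add (.mem A (nvar 50)) (.mem B (nvar 50))) (.const 1)) hC hC' s 0
    (fun v => (if s.nat A 0 v = 1 then 1 else 0) + (if s.nat B 0 v = 1 then 1 else 0) - 1)
    (fun t v hv hN hR h50 _ => ⟨rfl, by
      simp [NExpr.eval, NExpr.eval_ind, hN A hA hA', hN B hB hB', h50]⟩)).1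
  ext v
  rw [Finset.mem_inter, State.mem_row, State.mem_row, State.mem_row, interSet,
    this v (by rw [hn]; exact v.2)]
  split_ifs <;> simp_all

/-- Remove the members of the set in the array `B` from the set in the array `A`. -/
def removeSet (A B : ℕ) : Cmd :=
  fillNat A (.const 0) (.sub (.mem A (nvar 50)) (.mem B (nvar 50)))

theorem row_removeSet {A B : ℕ} (hA : A ≠ 0) (hA' : A ≠ 50)
    (hB : B ≠ A) (hB' : B ≠ 50) {n : ℕ} {s : State} (hn : s.nat 0 0 0 = n) :
    ((removeSet A B).run s).row n A 0 = s.row n A 0 \ s.row n B 0 := by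
  have := (run_fillNat (A := A) (i := .const 0)
    (X := .sub (.mem A (nvar 50)) (.mem B (nvar 50))) hA hA' s 0
    (fun v => (if s.nat A 0 v = 1 then 1 else 0) - (if s.nat B 0 v = 1 then 1 else 0))
    (fun t v hv hN hR h50 h => ⟨rfl, by
      simp [NExpr.eval, NExpr.eval_ind, hN B hB hB', h50, h v le_rfl]⟩)).1
  ext v
  rw [Finset.mem_sdiff, State.mem_row, State.mem_row, State.mem_row, removeSet,
    this v (by rw [hn]; exact v.2)]
  split_ifs <;> simp_all

/-! ## Splitting along light cuts

The set in row `0` of the array `26` is split as long as it has a cut whose weight is less than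
the real number in the real array `8`, or equal to it if the cell `(0, 0)` of the array `29` is
positive. The part that contains the vertex in the array `28` is kept. -/

/-- Split the set `n` times if possible. -/
def narrow : Cmd :=
  forN 27 (seq globalMinCut
    (ite (.and (.pos (nvar 24)) (.not (.and (.not (.realLT (rvar 6) (rvar 8)))
        (.not (.and (.pos (nvar 29)) (.not (.realLT (rvar 8) (rvar 6))))))))
      (ite (.pos (.mem 25 (nvar 28))) (copySet 26 25) (removeSet 26 25)) skip))

/-- Every `T` around `v` without light cuts stays on the side of `v` in each split, so the result is
the greatest such set. Each split loses a vertex while `v` remains, so fewer than `n` splits can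
happen; a round without a split means that no light cut is left. -/
theorem run_narrow {n : ℕ} (h2 : 2 ≤ n) {s : State} (hn : s.nat 0 0 0 = n)
    {a : Fin n → Fin n → ℝ} (ha : s.matrix n 0 = a) (ha0 : ∀ u v, 0 ≤ a u v)
    {S : Finset (Fin n)} (hS : s.row n 26 0 = S) {v : Fin n} (hv : s.nat 28 0 0 = v)
    (hvS : v ∈ S) {P : ℝ → Prop}
    (hP : ∀ x, P x ↔ x < s.real 8 0 0 ∨ 0 < s.nat 29 0 0 ∧ x ≤ s.real 8 0 0) :
    v ∈ (narrow.run s).row n 26 0 ∧ (narrow.run s).row n 26 0 ⊆ S ∧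
      NoCut a P ((narrow.run s).row n 26 0) ∧
      ∀ T ⊆ S, v ∈ T → NoCut a P T → T ⊆ (narrow.run s).row n 26 0 := by
  have hPle : ∀ x y, x ≤ y → P y → P x := by
    intro x y hxy hy
    rw [hP] at hy ⊢
    exact hy.imp hxy.trans_lt fun h => ⟨h.1, hxy.trans h.2⟩
  have := forN_induct (A := 27) (P := seq globalMinCut
    (ite (.and (.pos (nvar 24)) (.not (.and (.not (.realLT (rvar 6) (rvar 8)))
        (.not (.and (.pos (nvar 29)) (.not (.realLT (rvar 8) (rvar 6))))))))
      (ite (.pos (.mem 25 (nvar 28))) (copySet 26 25) (removeSet 26 25)) skip)) rfl s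
    (fun m t => v ∈ t.row n 26 0 ∧ t.row n 26 0 ⊆ S ∧
      (NoCut a P (t.row n 26 0) ∨ (t.row n 26 0).card + m ≤ S.card) ∧
      ∀ T ⊆ S, v ∈ T → NoCut a P T → T ⊆ t.row n 26 0)
    (fun m t a ht => ht) ?_ ?_
  · obtain ⟨i1, i2, i3, i4⟩ := this
    refine ⟨i1, i2, i3.resolve_right fun h => ?_, i4⟩
    have h3 := Finset.card_pos.mpr ⟨v, i1⟩
    have h4 := S.card_le_univ
    rw [Fintype.card_fin] at h4
    rw [hn] at h
    change Finset.card (State.row _ n 26 0) + n ≤ S.card at h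
    omega
  · rw [hS]
    exact ⟨hvS, subset_rfl, Or.inr le_rfl, fun T hT _ _ => hT⟩
  · intro m t hm hc hN hR ⟨i1, i2, i3, i4⟩
    rw [run_seq]
    have t0 : t.nat 0 0 0 = n := by rw [hN 0 rfl, hn]
    have ta : t.matrix n 0 = a := by
      rw [← ha]
      unfold State.matrix
      rw [hR 0 rfl]
    have hg := run_globalMinCut h2 t0 ta ha0 (S := t.row n 26 0) rfl
    set t' := globalMinCut.run t with ht'
    have t'0 : t'.nat 0 0 0 = n := by rw [ht', run_nat_of_not_writes _ rfl, t0]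
    have t'26 : t'.row n 26 0 = t.row n 26 0 :=
      State.row_congr (by rw [ht', run_nat_of_not_writes _ rfl]) _ _
    have t'28 : t'.nat 28 0 0 = v := by rw [ht', run_nat_of_not_writes _ rfl, hN 28 rfl, hv]
    have t'29 : t'.nat 29 = s.nat 29 := by rw [ht', run_nat_of_not_writes _ rfl, hN 29 rfl]
    have t'8 : t'.real 8 = s.real 8 := by rw [ht', run_real_of_not_writes _ rfl, hR 8 rfl]
    -- The language of tests has only `not` and `and`; the nested negations spell out the
    -- disjunction in `hP`.
    have htest : BExpr.Holds t' (.not (.and (.not (.realLT (rvar 6) (rvar 8)))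
        (.not (.and (.pos (nvar 29)) (.not (.realLT (rvar 8) (rvar 6))))))) ↔
        P (t'.real 6 0 0) := by
      rw [hP]
      simp only [BExpr.Holds, NExpr.eval, RExpr.eval, t'29, t'8, not_and_or, not_or, not_lt,
        not_le]
    rcases hg with ⟨⟨g1, g2, g3⟩, g4⟩ | ⟨g1, g2⟩
    · by_cases hcut : P (t'.real 6 0 0)
      · rw [run_ite_true]
        swap
        · exact ⟨by simp [BExpr.Holds, NExpr.eval, g1], htest.mpr hcut⟩
        have hcut' := hcut
        rw [g3] at hcut'
        have hnot : ¬ NoCut a P (t.row n 26 0) := fun h => h _ g2 hcut'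
        have hcard := i3.resolve_left hnot
        have hsplit : ∀ T ⊆ S, v ∈ T → NoCut a P T →
            T ⊆ t'.row n 25 0 ∨ Disjoint T (t'.row n 25 0) := fun T hT hvT hTP =>
          hTP.subset_or_disjoint ha0 hPle (i4 T hT hvT hTP) hcut'
        have hpart := Finset.card_sdiff_add_card_eq_card g2.1
        have hpos := Finset.card_pos.mpr g2.2.1
        have hlt := Finset.card_lt_card (Finset.ssubset_iff_subset_ne.mpr ⟨g2.1, g2.2.2⟩)
        have hmem : t'.nat 25 0 v = 1 ↔ v ∈ t'.row n 25 0 := by rw [State.mem_row]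
        by_cases hside : v ∈ t'.row n 25 0
        · rw [run_ite_true]
          swap
          · simp [BExpr.Holds, NExpr.eval, NExpr.eval_ind, t'28, hmem, hside]
          rw [row_copySet (by decide) (by decide) (by decide) (by decide) t'0]
          refine ⟨hside, g2.1.trans i2, Or.inr (by omega), fun T hT hvT hTP => ?_⟩
          refine (hsplit T hT hvT hTP).resolve_right fun hd => ?_
          exact Finset.disjoint_left.mp hd hvT hside
        · rw [run_ite_false]
          swap
          · simp [BExpr.Holds, NExpr.eval, NExpr.eval_ind, t'28, hmem, hside]
          rw [row_removeSet (by decide) (by decide) (by decide) (by decide) t'0, t'26]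
          refine ⟨Finset.mem_sdiff.mpr ⟨i1, hside⟩, Finset.sdiff_subset.trans i2,
            Or.inr (by omega), fun T hT hvT hTP => ?_⟩
          rcases hsplit T hT hvT hTP with h | h
          · exact absurd (h hvT) hside
          · exact Finset.subset_sdiff.mpr ⟨i4 T hT hvT hTP, h⟩
      · rw [run_ite_false, run_skip, t'26]
        swap
        · exact fun ⟨_, h⟩ => hcut (htest.mp h)
        exact ⟨i1, i2, Or.inl fun Y hY h => hcut (hPle _ _ (g4 Y hY) h), i4⟩
    · rw [run_ite_false, run_skip, t'26]
      swap
      · simp [BExpr.Holds, NExpr.eval, g1]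
      exact ⟨i1, i2, Or.inl fun Y hY => absurd hY (g2 Y), i4⟩

end RealRAM.Cmd

/-! ## Densest subgraphs of weight matrices -/

section MatrixDensity

set_option linter.unusedSectionVars false

variable {V : Type*} [DecidableEq V]

/-- The weight of `T`, where every unordered pair is counted once. -/
noncomputable def matrixWeight (a : V → V → ℝ) (T : Finset V) : ℝ := (∑ u ∈ T, ∑ v ∈ T, a u v) / 2

/-- The density of `T`. -/
noncomputable def matrixDensity (a : V → V → ℝ) (T : Finset V) : ℝ := matrixWeight a T / T.card

theorem matrixDensity_nonneg {a : V → V → ℝ} (ha : ∀ u v, 0 ≤ a u v) (T : Finset V) :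
    0 ≤ matrixDensity a T :=
  div_nonneg (div_nonneg (Finset.sum_nonneg fun u _ => Finset.sum_nonneg fun v _ => ha u v)
    zero_le_two) (Nat.cast_nonneg _)

@[simp] theorem matrixDensity_empty (a : V → V → ℝ) : matrixDensity a ∅ = 0 := by
  simp [matrixDensity]

theorem matrixWeight_eq (a : V → V → ℝ) (T : Finset V) :
    matrixWeight a T = matrixDensity a T * T.card := by
  rcases T.eq_empty_or_nonempty with rfl | hT
  · simp [matrixWeight]
  · have : (T.card : ℝ) ≠ 0 := by exact_mod_cast hT.card_pos.ne'
    rw [matrixDensity, div_mul_cancel₀ _ this]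

variable [Fintype V]

/-- The degrees in `S` of the members of `S ∩ T` add up to the cut weight plus twice the inner
weight, so the cut term cancels. Minimizing the objective thus maximizes `w(Y) - x|Y|`. -/
theorem cutObjective_eq_matrixWeight {a : V → V → ℝ} {S T : Finset V} {x : ℝ} {b : V → ℝ}
    (hb : ∀ v, b v = if v ∈ S then ∑ u ∈ S, a v u - 2 * x else 0) :
    cutObjective (fun u v => if u ∈ S ∧ v ∈ S then a u v else 0) b T =
      -2 * (matrixWeight a (S ∩ T) - x * (S ∩ T).card) := by
  have h1 : ∑ v ∈ T, b v = ∑ v ∈ S ∩ T, (∑ u ∈ S, a v u - 2 * x) := by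
    simp only [hb]
    rw [Finset.sum_ite_mem, Finset.inter_comm]
  have h2 : ∀ v, ∑ u ∈ S, a v u = ∑ u ∈ S \ (S ∩ T), a v u + ∑ u ∈ S ∩ T, a v u :=
    fun v => (Finset.sum_sdiff Finset.inter_subset_left).symm
  rw [cutObjective_restrict, h1]
  simp only [h2, Finset.sum_sub_distrib, Finset.sum_add_distrib, Finset.sum_const, nsmul_eq_mul]
  rw [cutWeight, matrixWeight]
  ring

end MatrixDensity

namespace RealRAM.Cmd

/-- Compute the density of the set in the array `A` in the real array `10`. -/
def density (A : ℕ) : Cmd :=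
  seq (sum₂ 5 (.mul (.mul (.cell 0 (nvar 50) (nvar 51)) (.ofNat (.mem A (nvar 50))))
      (.ofNat (.mem A (nvar 51)))))
    (seq (setReal 15 (.const 0) (.const 0) (.div (rvar 5) (.ofNat (.const 2))))
      (seq (sum₁ 5 (.ofNat (.mem A (nvar 51))))
        (setReal 10 (.const 0) (.const 0) (.div (rvar 15) (rvar 5)))))

theorem run_density {A : ℕ} (hA : A ≠ 50) (hA' : A ≠ 51) {n : ℕ} {s : State}
    (hn : s.nat 0 0 0 = n) {a : Fin n → Fin n → ℝ} (ha : s.matrix n 0 = a) :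
    ((density A).run s).real 10 0 0 = matrixDensity a (s.row n A 0) := by
  simp only [density, run_seq]
  have mem : ∀ v : Fin n, s.nat A 0 v = 1 ↔ v ∈ s.row n A 0 := fun v => by rw [State.mem_row]
  have h1 := run_sum₂ (A := 5) (X := .mul (.mul (.cell 0 (nvar 50) (nvar 51))
      (.ofNat (.mem A (nvar 50)))) (.ofNat (.mem A (nvar 51)))) s hn
    (fun u v => s.real 0 u v * (if s.nat A 0 u = 1 then 1 else 0) *
      (if s.nat A 0 v = 1 then 1 else 0))
    (fun t u v hu hv hN hR h50 h51 => by
      simp [NExpr.eval, RExpr.eval, NExpr.eval_ind, hN A hA hA', hR, h50, h51])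
  set s₁ := (sum₂ 5 (.mul (.mul (.cell 0 (nvar 50) (nvar 51)) (.ofNat (.mem A (nvar 50))))
      (.ofNat (.mem A (nvar 51))))).run s with hs₁
  set s₂ := (setReal 15 (.const 0) (.const 0) (.div (rvar 5) (.ofNat (.const 2)))).run s₁ with hs₂
  have n2 : s₂.nat 0 0 0 = n := by
    rw [hs₂, run_nat_of_not_writes _ rfl, hs₁, run_nat_of_not_writes _ rfl, hn]
  have a2 : s₂.nat A = s.nat A := by
    rw [hs₂, run_nat_of_not_writes _ rfl, hs₁, run_nat_of_not_writes _ (by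
      simp [sum₂, writesNat, hA, hA'])]
  have h2 : s₂.real 15 0 0 = matrixWeight a (s.row n A 0) := by
    simp only [hs₂, run_setReal, NExpr.eval, RExpr.eval, State.setReal_real_self, h1, matrixWeight]
    simp only [and_self, if_true, Nat.cast_ofNat]
    congr 1
    rw [← Finset.sum_filter_add_sum_filter_not Finset.univ (· ∈ s.row n A 0)]
    have e1 : Finset.univ.filter (· ∈ s.row n A 0) = s.row n A 0 := by ext; simp
    rw [e1, Finset.sum_eq_zero (s := Finset.univ.filter (· ∉ s.row n A 0)), add_zero]
    · refine Finset.sum_congr rfl fun u hu => ?_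
      have e2 : ∑ v ∈ s.row n A 0, a u v = ∑ v, if v ∈ s.row n A 0 then a u v else 0 := by
        rw [Finset.sum_ite_mem, Finset.univ_inter]
      rw [e2]
      refine Finset.sum_congr rfl fun v _ => ?_
      simp only [mem, hu, if_true, mul_one, ← ha, State.matrix]
      split_ifs <;> simp
    · intro u hu
      refine Finset.sum_eq_zero fun v _ => ?_
      simp only [Finset.mem_filter, Finset.mem_univ, true_and] at hu
      simp only [mem, hu]
      simp
  have h3 := run_sum₁ (A := 5) (X := .ofNat (.mem A (nvar 51))) s₂ n2
    (fun v => if s.nat A 0 v = 1 then 1 else 0)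
    (fun t v hv hN hR h51 => by
      simp [NExpr.eval, RExpr.eval, NExpr.eval_ind, hN A hA', a2, h51])
  set s₃ := (sum₁ 5 (.ofNat (.mem A (nvar 51)))).run s₂ with hs₃
  have h4 : s₃.real 15 = s₂.real 15 := by rw [hs₃, run_real_of_not_writes _ rfl]
  have h5 : s₃.real 5 0 0 = (s.row n A 0).card := by
    rw [h3]
    simp only [mem, Finset.sum_boole]
    congr 2
    ext v
    simp only [Finset.mem_filter, Finset.mem_univ, true_and]
  simp only [run_setReal, NExpr.eval, RExpr.eval, State.setReal_real_self, and_self, if_true,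
    h4, h2, h5, matrixDensity]

/-! ## Densest subgraphs

The ground set is in row `0` of the array `30`; a densest subset is computed in row `0` of the
array `31`, and its density in the real array `9`. -/

/-- Fill the real array `3` with the weighted degrees minus twice the current density. -/
def densityWeights : Cmd :=
  forN 52 (seq (sum₁ 5 (.mul (.mul (.cell 0 (nvar 52) (nvar 51)) (.ofNat (.mem 30 (nvar 52))))
      (.ofNat (.mem 30 (nvar 51)))))
    (setReal 3 (.const 0) (nvar 52)
      (.sub (rvar 5) (.mul (.mul (.ofNat (.const 2)) (rvar 9)) (.ofNat (.mem 30 (nvar 52)))))))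

theorem run_densityWeights {n : ℕ} {s : State} (hn : s.nat 0 0 0 = n)
    {a : Fin n → Fin n → ℝ} (ha : s.matrix n 0 = a) {S : Finset (Fin n)}
    (hS : s.row n 30 0 = S) (v : Fin n) :
    (densityWeights.run s).vector n 3 v =
      if v ∈ S then ∑ u ∈ S, a v u - 2 * s.real 9 0 0 else 0 := by
  have mem : ∀ v : Fin n, s.nat 30 0 v = 1 ↔ v ∈ S := fun v => by rw [← hS, State.mem_row]
  have := forN_induct (A := 52) (P := seq (sum₁ 5 (.mul (.mul (.cell 0 (nvar 52) (nvar 51))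
      (.ofNat (.mem 30 (nvar 52)))) (.ofNat (.mem 30 (nvar 51)))))
    (setReal 3 (.const 0) (nvar 52)
      (.sub (rvar 5) (.mul (.mul (.ofNat (.const 2)) (rvar 9)) (.ofNat (.mem 30 (nvar 52)))))))
    rfl s (fun m t => ∀ v : Fin n, v < m → t.vector n 3 v =
      if v ∈ S then ∑ u ∈ S, a v u - 2 * s.real 9 0 0 else 0) (fun m t a ht => ht) (by simp) ?_
  · exact this v (by rw [hn]; exact v.2)
  · intro m t hm hc hN hR hI v hv
    rw [hn] at hm
    have t0 : t.nat 0 0 0 = n := by rw [hN 0 rfl, hn]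
    have t30 : t.nat 30 = s.nat 30 := hN 30 rfl
    have r0 : t.real 0 = s.real 0 := hR 0 rfl
    have h1 := run_sum₁ (A := 5) (X := .mul (.mul (.cell 0 (nvar 52) (nvar 51))
        (.ofNat (.mem 30 (nvar 52)))) (.ofNat (.mem 30 (nvar 51)))) t t0
      (fun v => s.real 0 m v * (if s.nat 30 0 m = 1 then 1 else 0) *
        (if s.nat 30 0 v = 1 then 1 else 0))
      (fun t' v hv hN' hR' h51 => by
        have g52 : t'.nat 52 0 0 = m := by rw [hN' 52 (by decide), hc]
        simp [NExpr.eval, RExpr.eval, NExpr.eval_ind, hN' 30, hR', h51, g52, t30, r0])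
    rw [run_seq]
    set t₁ := (sum₁ 5 (.mul (.mul (.cell 0 (nvar 52) (nvar 51)) (.ofNat (.mem 30 (nvar 52))))
      (.ofNat (.mem 30 (nvar 51))))).run t with ht₁
    have g52 : t₁.nat 52 0 0 = m := by rw [ht₁, run_nat_of_not_writes _ rfl, hc]
    have g30 : t₁.nat 30 = s.nat 30 := by rw [ht₁, run_nat_of_not_writes _ rfl, t30]
    have g3 : t₁.real 3 = t.real 3 := by rw [ht₁, run_real_of_not_writes _ rfl]
    have g9 : t₁.real 9 = s.real 9 := by rw [ht₁, run_real_of_not_writes _ rfl, hR 9 rfl]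
    simp only [run_setReal, NExpr.eval, RExpr.eval, State.vector, State.setReal_real_self, g52, g3,
      g9, h1, true_and, NExpr.eval_ind, g30]
    by_cases hvm : (v : ℕ) = m
    · subst hvm
      simp only [if_true, mem]
      by_cases hvS : v ∈ S
      · have e : ∑ u ∈ S, a v u = ∑ u : Fin n, s.real 0 v u * (if u ∈ S then 1 else 0) := by
          simp [← ha, State.matrix]
        simp [hvS, e]
      · simp [hvS]
    · rw [if_neg hvm]
      exact hI v (by omega)

/-- One step of Dinkelbach's method. -/
def improveDensity : Cmd :=
  seq (fillReal₂ 2 (.mul (.mul (.cell 0 (nvar 50) (nvar 51)) (.ofNat (.mem 30 (nvar 50))))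
      (.ofNat (.mem 30 (nvar 51)))))
    (seq densityWeights
      (seq minCut
        (seq (interSet 32 30 9)
          (seq (density 32)
            (ite (.realLT (rvar 9) (rvar 10))
              (seq (copySet 31 32) (setReal 9 (.const 0) (.const 0) (rvar 10))) skip)))))

/-- The set `X` is the maximizer of `w(Y) - x|Y|` for the current density `x`; it replaces the
current set exactly if it is denser. -/
theorem run_improveDensity {n : ℕ} (h2 : 2 ≤ n) {s : State} (hn : s.nat 0 0 0 = n)
    {a : Fin n → Fin n → ℝ} (ha : s.matrix n 0 = a) (ha0 : ∀ u v, 0 ≤ a u v)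
    {S : Finset (Fin n)} (hS : s.row n 30 0 = S) :
    ∃ X ⊆ S, (∀ Y ⊆ S, matrixWeight a Y - s.real 9 0 0 * Y.card ≤
        matrixWeight a X - s.real 9 0 0 * X.card) ∧
      (s.real 9 0 0 < matrixDensity a X → (improveDensity.run s).row n 31 0 = X ∧
        (improveDensity.run s).real 9 0 0 = matrixDensity a X) ∧
      (¬ s.real 9 0 0 < matrixDensity a X → (improveDensity.run s).row n 31 0 = s.row n 31 0 ∧
        (improveDensity.run s).real 9 0 0 = s.real 9 0 0) := by
  simp only [improveDensity, run_seq]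
  have memS : ∀ v : Fin n, s.nat 30 0 v = 1 ↔ v ∈ S := fun v => by rw [← hS, State.mem_row]
  have hcap := run_fillReal₂ (A := 2) (X := .mul (.mul (.cell 0 (nvar 50) (nvar 51))
      (.ofNat (.mem 30 (nvar 50)))) (.ofNat (.mem 30 (nvar 51)))) s
    (fun u v => s.real 0 u v * (if s.nat 30 0 u = 1 then 1 else 0) *
      (if s.nat 30 0 v = 1 then 1 else 0))
    (fun t u v hu hv hN hR h50 h51 => by
      simp [NExpr.eval, RExpr.eval, NExpr.eval_ind, hN, hR, h50, h51])
  set s₁ := (fillReal₂ 2 (.mul (.mul (.cell 0 (nvar 50) (nvar 51)) (.ofNat (.mem 30 (nvar 50))))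
      (.ofNat (.mem 30 (nvar 51))))).run s with hs₁
  have hn1 : ∀ B, B ≠ 50 → B ≠ 51 → s₁.nat B = s.nat B := fun B h h' =>
    run_nat_of_not_writes _ (by simp [fillReal₂, writesNat, h, h']) _
  have hr1 : ∀ B, B ≠ 2 → s₁.real B = s.real B := fun B h =>
    run_real_of_not_writes _ (by simp [fillReal₂, writesReal, h]) _
  have c1 : s₁.matrix n 2 = fun u v => if u ∈ S ∧ v ∈ S then a u v else 0 := by
    funext u v
    have := hcap u v (by rw [hn]; exact u.2) (by rw [hn]; exact v.2)
    simp only [State.matrix, this, memS, ite_and, ← ha]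
    split_ifs <;> simp
  have n1 : s₁.nat 0 0 0 = n := by rw [hn1 0 (by decide) (by decide), hn]
  have b2 := run_densityWeights n1 (a := a)
    (by rw [← ha]; unfold State.matrix; rw [hr1 0 (by decide)]) (S := S)
    (by rw [State.row_congr (hn1 30 (by decide) (by decide)), hS])
  rw [hr1 9 (by decide)] at b2
  set s₂ := densityWeights.run s₁ with hs₂
  have n2 : s₂.nat 0 0 0 = n := by rw [hs₂, run_nat_of_not_writes _ rfl, n1]
  have c2 : s₂.matrix n 2 = fun u v => if u ∈ S ∧ v ∈ S then a u v else 0 := by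
    rw [← c1]
    unfold State.matrix
    rw [hs₂, run_real_of_not_writes _ rfl]
  have hmin := run_minCut h2 n2 (fun u v => by
    rw [c2]
    dsimp only
    split_ifs
    · exact ha0 u v
    · exact le_rfl)
  set s₃ := minCut.run s₂ with hs₃
  rw [c2] at hmin
  simp only [cutObjective_eq_matrixWeight b2] at hmin
  have n3 : s₃.nat 0 0 0 = n := by rw [hs₃, run_nat_of_not_writes _ rfl, n2]
  have e30 : s₃.row n 30 0 = S := by
    rw [← hS]
    refine State.row_congr ?_ _ _
    rw [hs₃, run_nat_of_not_writes _ rfl, hs₂, run_nat_of_not_writes _ rfl,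
      hn1 30 (by decide) (by decide)]
  have h32 := row_interSet (C := 32) (A := 30) (B := 9) (by decide) (by decide) (by decide)
    (by decide) (by decide) (by decide) n3
  rw [e30] at h32
  set X := S ∩ s₃.row n 9 0 with hX
  set s₄ := (interSet 32 30 9).run s₃ with hs₄
  have n4 : s₄.nat 0 0 0 = n := by rw [hs₄, run_nat_of_not_writes _ rfl, n3]
  have a4 : s₄.matrix n 0 = a := by
    rw [← ha]
    unfold State.matrix
    rw [hs₄, run_real_of_not_writes _ rfl, hs₃, run_real_of_not_writes _ rfl, hs₂,
      run_real_of_not_writes _ rfl, hr1 0 (by decide)]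
  have r9 : s₄.real 9 = s.real 9 := by
    rw [hs₄, run_real_of_not_writes _ rfl, hs₃, run_real_of_not_writes _ rfl, hs₂,
      run_real_of_not_writes _ rfl, hr1 9 (by decide)]
  have e31 : s₄.nat 31 = s.nat 31 := by
    rw [hs₄, run_nat_of_not_writes _ rfl, hs₃, run_nat_of_not_writes _ rfl, hs₂,
      run_nat_of_not_writes _ rfl, hn1 31 (by decide) (by decide)]
  have hdens := run_density (A := 32) (by decide) (by decide) n4 a4
  rw [h32] at hdens
  set s₅ := (density 32).run s₄ with hs₅
  have n5 : s₅.nat 0 0 0 = n := by rw [hs₅, run_nat_of_not_writes _ rfl, n4]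
  have f9 : s₅.real 9 = s.real 9 := by rw [hs₅, run_real_of_not_writes _ rfl, r9]
  have f31 : s₅.row n 31 0 = s.row n 31 0 := State.row_congr (by
    rw [hs₅, run_nat_of_not_writes _ rfl, e31]) _ _
  have f32 : s₅.row n 32 0 = X := by
    rw [← h32]
    exact State.row_congr (by rw [hs₅, run_nat_of_not_writes _ rfl]) _ _
  refine ⟨X, Finset.inter_subset_left, fun Y hY => ?_, fun hlt => ?_, fun hlt => ?_⟩
  · have := hmin Y
    rw [Finset.inter_eq_right.mpr hY] at this
    linarith
  · rw [run_ite_true]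
    swap
    · simpa [BExpr.Holds, NExpr.eval, RExpr.eval, f9, hdens] using hlt
    rw [run_seq]
    constructor
    · rw [State.row_congr (run_nat_of_not_writes _ rfl _),
        row_copySet (by decide) (by decide) (by decide) (by decide) n5, f32]
    · simp only [run_setReal, NExpr.eval, RExpr.eval, State.setReal_real_self, and_self, if_true]
      rw [run_real_of_not_writes _ rfl, hdens]
  · rw [run_ite_false, run_skip, f31, f9]
    · exact ⟨rfl, rfl⟩
    · simpa [BExpr.Holds, NExpr.eval, RExpr.eval, f9, hdens] using hlt

/-- Dinkelbach's method. -/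
def densest : Cmd :=
  seq (copySet 31 30)
    (seq (density 30)
      (seq (setReal 9 (.const 0) (.const 0) (rvar 10)) (forN 33 improveDensity)))

/-- Let `X` maximize `w(Y) - x|Y| = (d(Y) - x)|Y|` with `d(X) > x`. A set denser than `X` must be
smaller than `X`, or its value would be larger. So successive sets shrink strictly and `n` rounds
suffice. -/
theorem run_densest {n : ℕ} (h2 : 2 ≤ n) {s : State} (hn : s.nat 0 0 0 = n)
    {a : Fin n → Fin n → ℝ} (ha : s.matrix n 0 = a) (ha0 : ∀ u v, 0 ≤ a u v)
    {S : Finset (Fin n)} (hS : s.row n 30 0 = S) (hne : S.Nonempty) :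
    (densest.run s).row n 31 0 ⊆ S ∧ ((densest.run s).row n 31 0).Nonempty ∧
      (densest.run s).real 9 0 0 = matrixDensity a ((densest.run s).row n 31 0) ∧
      ∀ T ⊆ S, matrixDensity a T ≤ (densest.run s).real 9 0 0 := by
  simp only [densest, run_seq]
  have h31 := row_copySet (C := 31) (A := 30) (by decide) (by decide) (by decide) (by decide) hn
  rw [hS] at h31
  set s₁ := (copySet 31 30).run s with hs₁
  have n1 : s₁.nat 0 0 0 = n := by rw [hs₁, run_nat_of_not_writes _ rfl, hn]
  have a1 : s₁.matrix n 0 = a := by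
    rw [← ha]
    unfold State.matrix
    rw [hs₁, run_real_of_not_writes _ rfl]
  have e30 : s₁.row n 30 0 = S := by
    rw [← hS]
    exact State.row_congr (by rw [hs₁, run_nat_of_not_writes _ rfl]) _ _
  have hd := run_density (A := 30) (by decide) (by decide) n1 a1
  rw [e30] at hd
  set s₂ := (density 30).run s₁ with hs₂
  set s₃ := (setReal 9 (.const 0) (.const 0) (rvar 10)).run s₂ with hs₃
  have n3 : s₃.nat 0 0 0 = n := by
    rw [hs₃, run_nat_of_not_writes _ rfl, hs₂, run_nat_of_not_writes _ rfl, n1]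
  have a3 : s₃.matrix n 0 = a := by
    rw [← a1]
    unfold State.matrix
    rw [hs₃, run_real_of_not_writes _ rfl, hs₂, run_real_of_not_writes _ rfl]
  have g9 : s₃.real 9 0 0 = matrixDensity a S := by
    simp [hs₃, NExpr.eval, RExpr.eval, State.setReal_real_self, hd]
  have g30 : s₃.row n 30 0 = S := by
    rw [← e30]
    exact State.row_congr (by
      rw [hs₃, run_nat_of_not_writes _ rfl, hs₂, run_nat_of_not_writes _ rfl]) _ _
  have g31 : s₃.row n 31 0 = S := by
    rw [← h31]
    exact State.row_congr (by
      rw [hs₃, run_nat_of_not_writes _ rfl, hs₂, run_nat_of_not_writes _ rfl]) _ _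
  -- The last clause, that every denser subset is smaller than the current one, forces the next
  -- improvement to lose a vertex; the clause before it counts these losses.
  have := forN_induct (A := 33) (P := improveDensity) rfl s₃ (fun m t =>
    t.row n 31 0 ⊆ S ∧ (t.row n 31 0).Nonempty ∧
      t.real 9 0 0 = matrixDensity a (t.row n 31 0) ∧
      ((∀ T ⊆ S, matrixDensity a T ≤ t.real 9 0 0) ∨ (t.row n 31 0).card + m ≤ S.card) ∧
      ∀ T ⊆ S, t.real 9 0 0 < matrixDensity a T → T.card < (t.row n 31 0).card)
    (fun m t a ht => ht) ?_ ?_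
  · obtain ⟨i1, i2, i3, i4, i5⟩ := this
    refine ⟨i1, i2, i3, i4.resolve_right fun h => ?_⟩
    have h3 := i2.card_pos
    have h4 := S.card_le_univ
    rw [Fintype.card_fin] at h4
    rw [n3] at h
    change Finset.card (State.row _ n 31 0) + n ≤ S.card at h
    omega
  · simp only [g31, g9]
    refine ⟨subset_rfl, hne, trivial, Or.inr le_rfl, fun T hT hlt => ?_⟩
    refine Finset.card_lt_card (Finset.ssubset_iff_subset_ne.mpr ⟨hT, ?_⟩)
    rintro rfl
    exact lt_irrefl _ hlt
  · intro m t hm hc hN hR ⟨i1, i2, i3, i4, i5⟩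
    have t0 : t.nat 0 0 0 = n := by rw [hN 0 rfl, n3]
    have ta : t.matrix n 0 = a := by
      rw [← a3]
      unfold State.matrix
      rw [hR 0 rfl]
    have t30 : t.row n 30 0 = S := by rw [State.row_congr (hN 30 rfl), g30]
    obtain ⟨X, hX, hmax, hyes, hno⟩ := run_improveDensity h2 t0 ta ha0 t30
    have hx0 : 0 ≤ t.real 9 0 0 := by
      rw [i3]
      exact matrixDensity_nonneg ha0 _
    by_cases hlt : t.real 9 0 0 < matrixDensity a X
    · obtain ⟨q1, q2⟩ := hyes hlt
      rw [q1, q2]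
      have hXne : X.Nonempty := by
        rw [Finset.nonempty_iff_ne_empty]
        rintro rfl
        rw [matrixDensity_empty] at hlt
        linarith
      have hcard := i5 X hX hlt
      refine ⟨hX, hXne, rfl, i4.imp (fun h => absurd hlt (not_lt.mpr (h X hX))) (fun h => by omega),
        fun T hT hTX => ?_⟩
      have h1 := hmax T hT
      rw [matrixWeight_eq, matrixWeight_eq, ← sub_mul, ← sub_mul] at h1
      by_contra hle
      have h2 : (X.card : ℝ) ≤ T.card := by exact_mod_cast not_lt.mp hle
      have h3 : (0 : ℝ) < X.card := by exact_mod_cast hXne.card_pos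
      nlinarith
    · obtain ⟨q1, q2⟩ := hno hlt
      rw [q1, q2]
      -- If the maximizer is not denser than `x`, the maximum of `(d(Y) - x)|Y|` is at most 0, so no
      -- set has density above `x`.
      refine ⟨i1, i2, i3, Or.inl fun T hT => ?_, i5⟩
      by_contra hgt
      rw [not_le] at hgt
      have h1 := hmax T hT
      rw [matrixWeight_eq, matrixWeight_eq, ← sub_mul, ← sub_mul] at h1
      have hTne : T.Nonempty := by
        rw [Finset.nonempty_iff_ne_empty]
        rintro rfl
        rw [matrixDensity_empty] at hgt
        linarith
      have h3 : (0 : ℝ) < T.card := by exact_mod_cast hTne.card_pos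
      have h4 : (0 : ℝ) ≤ X.card := Nat.cast_nonneg _
      rw [not_lt] at hlt
      nlinarith

end RealRAM.Cmd

/-! ## Weighted graphs as weight matrices -/

section CutWeight

set_option linter.unusedSectionVars false

variable {V : Type*} [DecidableEq V]

theorem IsProperPart.singleton {S : Finset V} {v : V} (hv : v ∈ S) (hS : 2 ≤ S.card) :
    IsProperPart S {v} := by
  refine ⟨Finset.singleton_subset_iff.mpr hv, Finset.singleton_nonempty v, ?_⟩
  rintro rfl
  simp at hS

theorem IsProperPart.two_le_card {S X : Finset V} (h : IsProperPart S X) : 2 ≤ S.card := by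
  have h1 := h.2.1.card_pos
  have h2 := Finset.card_lt_card (Finset.ssubset_iff_subset_ne.mpr ⟨h.1, h.2.2⟩)
  omega

/-- A light cut of the union leaves each of `A` and `B` on one side, and the common vertex puts them
on the same side. This makes maximal components disjoint. -/
theorem NoCut.union {a : V → V → ℝ} (ha : ∀ u v, 0 ≤ a u v) {P : ℝ → Prop}
    (hP : ∀ x y, x ≤ y → P y → P x) {A B : Finset V} {v : V} (hA : NoCut a P A) (hB : NoCut a P B)
    (hvA : v ∈ A) (hvB : v ∈ B) : NoCut a P (A ∪ B) := by
  intro X hX hPX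
  rcases hA.subset_or_disjoint ha hP Finset.subset_union_left hPX with h1 | h1 <;>
    rcases hB.subset_or_disjoint ha hP Finset.subset_union_right hPX with h2 | h2
  · exact hX.2.2 (hX.1.antisymm (Finset.union_subset h1 h2))
  · exact Finset.disjoint_left.mp h2 hvB (h1 hvA)
  · exact Finset.disjoint_left.mp h1 hvA (h2 hvB)
  · obtain ⟨x, hx⟩ := hX.2.1
    rcases Finset.mem_union.mp (hX.1 hx) with h | h
    · exact Finset.disjoint_left.mp h1 h hx
    · exact Finset.disjoint_left.mp h2 h hx

theorem matrixWeight_eq_add_cutWeight {a : V → V → ℝ} (ha : ∀ u v, a u v = a v u)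
    {T X : Finset V} (hX : X ⊆ T) :
    matrixWeight a T = matrixWeight a X + matrixWeight a (T \ X) + cutWeight a T X := by
  have h := cutWeight_sdiff ha hX
  unfold cutWeight at h
  rw [Finset.sdiff_sdiff_eq_self hX] at h
  unfold matrixWeight cutWeight
  have h1 : ∀ u, ∑ v ∈ T, a u v = ∑ v ∈ T \ X, a u v + ∑ v ∈ X, a u v :=
    fun u => (Finset.sum_sdiff hX).symm
  rw [← Finset.sum_sdiff hX]
  simp only [h1, Finset.sum_add_distrib]
  linarith

/-- A graph of positive density has a subgraph with at least two vertices, all of whose cuts are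
heavier than the density. -/
theorem exists_noCut_le_density {a : V → V → ℝ} (ha : ∀ u v, a u v = a v u)
    (ha' : ∀ v, a v v = 0) {D : Finset V} (hD : 0 < matrixDensity a D) :
    ∃ T ⊆ D, 2 ≤ T.card ∧ NoCut a (· ≤ matrixDensity a D) T := by
  set d := matrixDensity a D with hd
  have hne : D.Nonempty := by
    rw [Finset.nonempty_iff_ne_empty]
    rintro rfl
    rw [hd, matrixDensity_empty] at hD
    exact lt_irrefl _ hD
  -- The set `D` qualifies since `w(D) = d|D|` and `d > 0`. In a smallest such `T` both sides of a
  -- cut fail the strict inequality, so their weights sum to at most `d(|T| - 2)`, which leaves more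
  -- than `d` for the cut. Singletons have weight 0 and do not qualify.
  have hex : (D.powerset.filter fun T => T.Nonempty ∧ d * (T.card - 1) < matrixWeight a T).Nonempty := by
    refine ⟨D, Finset.mem_filter.mpr ⟨Finset.mem_powerset_self D, hne, ?_⟩⟩
    rw [matrixWeight_eq, ← hd]
    linarith
  obtain ⟨T, hT, hmin⟩ := Finset.exists_min_image _ Finset.card hex
  simp only [Finset.mem_filter, Finset.mem_powerset] at hT hmin
  obtain ⟨hTD, hTne, hTw⟩ := hT
  refine ⟨T, hTD, ?_, fun X hX hle => ?_⟩
  · by_contra hcard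
    have h1 := hTne.card_pos
    obtain ⟨v, rfl⟩ := Finset.card_eq_one.mp (show T.card = 1 by omega)
    simp [matrixWeight, ha'] at hTw
  · have hsmall : ∀ Y ⊆ T, Y.Nonempty → Y ≠ T → matrixWeight a Y ≤ d * (Y.card - 1) := by
      intro Y hY hYne hYT
      by_contra hlt
      have := hmin Y ⟨hY.trans hTD, hYne, not_le.mp hlt⟩
      have := Finset.card_lt_card (Finset.ssubset_iff_subset_ne.mpr ⟨hY, hYT⟩)
      omega
    obtain ⟨x, hx, y, hy, hyX⟩ := hX.exists_mem
    have h1 := hsmall X hX.1 hX.2.1 hX.2.2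
    have h2 := hsmall (T \ X) Finset.sdiff_subset ⟨y, Finset.mem_sdiff.mpr ⟨hy, hyX⟩⟩
      (fun h => (Finset.mem_sdiff.mp (h ▸ hX.1 hx)).2 hx)
    have h3 := matrixWeight_eq_add_cutWeight ha hX.1
    have h4 : ((T \ X).card : ℝ) = T.card - X.card := by
      rw [Finset.cast_card_sdiff hX.1]
    rw [h4] at h2
    linarith

end CutWeight

namespace WeightedGraph

set_option linter.unusedSectionVars false

open Classical in
/-- The weighted adjacency matrix. -/
noncomputable def adjWeight {V : Type*} (G : WeightedGraph V) (u v : V) : ℝ :=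
  if G.graph.Adj u v then G.w s(u, v) else 0

variable {V : Type*} (G : WeightedGraph V)

theorem adjWeight_nonneg (u v : V) : 0 ≤ G.adjWeight u v := by
  unfold adjWeight
  split_ifs with h
  · exact (G.w_pos _ h).le
  · exact le_rfl

theorem adjWeight_comm (u v : V) : G.adjWeight u v = G.adjWeight v u := by
  by_cases h : G.graph.Adj u v
  · simp [adjWeight, h, h.symm, Sym2.eq_swap (a := u) (b := v)]
  · simp [adjWeight, h, show ¬ G.graph.Adj v u from fun h' => h h'.symm]

@[simp] theorem adjWeight_self (v : V) : G.adjWeight v v = 0 := by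
  simp [adjWeight]

theorem adjWeight_pos_iff (u v : V) : 0 < G.adjWeight u v ↔ G.graph.Adj u v := by
  unfold adjWeight
  split_ifs with h
  · simpa [h] using G.w_pos _ h
  · simp [h]

variable [Fintype V]

theorem mem_edgesIn {S : Finset V} {u v : V} :
    s(u, v) ∈ G.edgesIn S ↔ G.graph.Adj u v ∧ u ∈ S ∧ v ∈ S := by
  simp [edgesIn]

/-- The edges at `v` inside `S` are the injective image of its neighbours in `S` under `u ↦ s(v,
u)`. -/
theorem degIn_eq {S : Finset V} {v : V} (hv : v ∈ S) :
    G.degIn S v = ∑ u ∈ S, G.adjWeight v u := by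
  classical
  have h1 : ((G.edgesIn S).filter fun e => v ∈ e) =
      (S.filter fun u => G.graph.Adj v u).image fun u => s(v, u) := by
    ext e
    induction e with
    | _ x y =>
      simp only [Finset.mem_filter, mem_edgesIn, Finset.mem_image, Sym2.mem_iff]
      constructor
      · rintro ⟨⟨hxy, hx, hy⟩, rfl | rfl⟩
        · exact ⟨y, ⟨hy, hxy⟩, rfl⟩
        · exact ⟨x, ⟨hx, hxy.symm⟩, Sym2.eq_swap⟩
      · rintro ⟨u, ⟨hu, hvu⟩, heq⟩
        rcases Sym2.eq_iff.mp heq with ⟨rfl, rfl⟩ | ⟨rfl, rfl⟩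
        · exact ⟨⟨hvu, hv, hu⟩, Or.inl rfl⟩
        · exact ⟨⟨hvu.symm, hu, hv⟩, Or.inr rfl⟩
  have h2 : G.degIn S v = ∑ e ∈ (G.edgesIn S).filter fun e => v ∈ e, G.w e := by
    unfold degIn weight
    congr!
  rw [h2, h1, Finset.sum_image, Finset.sum_filter]
  · refine Finset.sum_congr rfl fun u _ => ?_
    simp [adjWeight]
  · intro x _ y _ h
    exact Sym2.congr_right.mp h

/-- Handshake: each edge is counted at its two distinct ends. -/
theorem sum_degIn (S : Finset V) : ∑ v ∈ S, G.degIn S v = 2 * G.weight (G.edgesIn S) := by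
  classical
  unfold degIn weight
  simp only [Finset.sum_filter]
  rw [Finset.sum_comm, Finset.mul_sum]
  refine Finset.sum_congr rfl fun e he => ?_
  induction e with
  | _ x y =>
    obtain ⟨hxy, hx, hy⟩ := G.mem_edgesIn.mp he
    have h : S.filter (· ∈ s(x, y)) = {x, y} := by
      ext z
      simp only [Finset.mem_filter, Sym2.mem_iff, Finset.mem_insert, Finset.mem_singleton]
      constructor
      · exact fun h => h.2
      · rintro (rfl | rfl)
        · exact ⟨hx, Or.inl rfl⟩
        · exact ⟨hy, Or.inr rfl⟩
    rw [← Finset.sum_filter, Finset.sum_const, nsmul_eq_mul]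
    have h' : Finset.card (S.filter (· ∈ s(x, y))) = 2 := by
      rw [h, Finset.card_pair hxy.ne]
    congr 1
    convert congrArg (Nat.cast : ℕ → ℝ) h'
    norm_num

theorem density_eq (S : Finset V) : G.density S = matrixDensity G.adjWeight S := by
  unfold density matrixDensity matrixWeight
  rw [← Finset.sum_congr rfl fun v hv => G.degIn_eq hv, sum_degIn]
  congr 1
  ring

/-! ### Cuts -/

variable [DecidableEq V]

open Classical in
/-- The edges between `X` and `S \ X`. -/
noncomputable def boundary (S X : Finset V) : Finset (V × V) :=
  (X ×ˢ (S \ X)).filter fun p => G.graph.Adj p.1 p.2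

theorem cutWeight_eq_sum_boundary (S X : Finset V) :
    cutWeight G.adjWeight S X = ∑ p ∈ G.boundary S X, G.w s(p.1, p.2) := by
  classical
  unfold cutWeight boundary
  rw [← Finset.sum_product', Finset.sum_filter]
  exact Finset.sum_congr rfl fun p _ => by simp [adjWeight]

/-- Forgetting orientation is injective on the boundary, since a pair and its reverse cannot both
lead from `X` to its complement. -/
theorem weight_image_boundary (S X : Finset V) :
    G.weight ((G.boundary S X).image fun p => s(p.1, p.2)) = cutWeight G.adjWeight S X := by
  rw [cutWeight_eq_sum_boundary, weight, Finset.sum_image]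
  rintro ⟨x, y⟩ hp ⟨x', y'⟩ hp' h
  simp only [boundary, Finset.coe_filter, Finset.mem_product, Finset.mem_sdiff,
    Set.mem_ofPred_eq] at hp hp'
  rcases Sym2.eq_iff.mp h with ⟨h1, h2⟩ | ⟨h1, h2⟩
  · simp only at h1 h2
    rw [h1, h2]
  · simp only at h1 h2
    exact absurd (h1 ▸ hp.1.1) hp'.1.2.2

/-- A cut may contain edges besides those across its partition; as edge weights are positive, these
only add weight. -/
theorem cutWeight_le_weight_of_isCut {S : Finset V} {F : Finset (Sym2 V)} (h : G.IsCut S F) :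
    ∃ X, IsProperPart S X ∧ cutWeight G.adjWeight S X ≤ G.weight F := by
  obtain ⟨hF, X, hX, hne, hXS, hcut⟩ := h
  refine ⟨X, ⟨hX, hne, hXS⟩, ?_⟩
  rw [← weight_image_boundary]
  refine Finset.sum_le_sum_of_subset_of_nonneg ?_ fun e he _ => ?_
  · intro e he
    obtain ⟨⟨x, y⟩, hp, rfl⟩ := Finset.mem_image.mp he
    simp only [boundary, Finset.mem_filter, Finset.mem_product, Finset.mem_sdiff] at hp
    exact hcut x hp.1.1 y hp.1.2.1 hp.1.2.2 hp.2
  · have := hF he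
    simp only [edgesIn, Finset.mem_filter] at this
    exact (G.w_pos e this.2.1).le

theorem isCut_image_boundary {S X : Finset V} (h : IsProperPart S X) :
    G.IsCut S ((G.boundary S X).image fun p => s(p.1, p.2)) := by
  refine ⟨fun e he => ?_, X, h.1, h.2.1, h.2.2, fun u hu v hv hvX huv => ?_⟩
  · obtain ⟨⟨x, y⟩, hp, rfl⟩ := Finset.mem_image.mp he
    simp only [boundary, Finset.mem_filter, Finset.mem_product, Finset.mem_sdiff] at hp
    exact G.mem_edgesIn.mpr ⟨hp.2, h.1 hp.1.1, hp.1.2.1⟩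
  · refine Finset.mem_image.mpr ⟨(u, v), ?_, rfl⟩
    simp [boundary, hu, hv, hvX, huv]

/-- Minimum cuts may be taken to be boundaries of proper parts. Sets with at most one vertex have no
cut and connectivity `sInf ∅ = 0`, which positivity of `k` excludes. -/
theorem isEdgeConnected_iff {k : ℝ} (hk : 0 < k) {S : Finset V} :
    G.IsEdgeConnected k S ↔ 2 ≤ S.card ∧ NoCut G.adjWeight (· < k) S := by
  unfold IsEdgeConnected edgeConnectivity
  have hbdd : BddBelow {x | ∃ F, G.IsCut S F ∧ G.weight F = x} := by
    refine ⟨0, ?_⟩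
    rintro _ ⟨F, hF, rfl⟩
    obtain ⟨X, -, hX⟩ := G.cutWeight_le_weight_of_isCut hF
    exact (cutWeight_nonneg G.adjWeight_nonneg S X).trans hX
  constructor
  · intro h
    have hne : {x | ∃ F, G.IsCut S F ∧ G.weight F = x}.Nonempty := by
      by_contra hempty
      rw [Set.not_nonempty_iff_eq_empty.mp hempty, Real.sInf_empty] at h
      linarith
    obtain ⟨_, F, hF, -⟩ := hne
    obtain ⟨X, hX, -⟩ := G.cutWeight_le_weight_of_isCut hF
    refine ⟨hX.two_le_card, fun Y hY => not_lt.mpr (h.trans (csInf_le hbdd ?_))⟩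
    exact ⟨_, G.isCut_image_boundary hY, G.weight_image_boundary S Y⟩
  · rintro ⟨hcard, hno⟩
    refine le_csInf ?_ ?_
    · obtain ⟨v, hv⟩ := Finset.card_pos.mp (show 0 < S.card by omega)
      exact ⟨_, _, G.isCut_image_boundary (.singleton hv hcard), rfl⟩
    · rintro _ ⟨F, hF, rfl⟩
      obtain ⟨X, hX, hle⟩ := G.cutWeight_le_weight_of_isCut hF
      exact (not_lt.mp (hno X hX)).trans hle

theorem cutWeight_singleton {S : Finset V} {v : V} (hv : v ∈ S) :
    cutWeight G.adjWeight S {v} = G.degIn S v := by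
  rw [degIn_eq G hv, cutWeight, Finset.sum_singleton, ← Finset.add_sum_erase S _ hv,
    adjWeight_self, zero_add, Finset.sdiff_singleton_eq_erase]

/-- Two maximal `k`-edge-connected subgraphs with a common vertex coincide. -/
theorem IsMaximalEdgeConnected.eq_of_mem {G : WeightedGraph V} {k : ℝ} (hk : 0 < k)
    {A B : Finset V} (hA : G.IsMaximalEdgeConnected k A) (hB : G.IsMaximalEdgeConnected k B)
    {v : V} (hvA : v ∈ A) (hvB : v ∈ B) : A = B := by
  have h1 := (G.isEdgeConnected_iff hk).mp hA.1
  have h2 := (G.isEdgeConnected_iff hk).mp hB.1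
  have h3 : G.IsEdgeConnected k (A ∪ B) := (G.isEdgeConnected_iff hk).mpr
    ⟨h1.1.trans (Finset.card_le_card Finset.subset_union_left),
      h1.2.union G.adjWeight_nonneg (fun x y hxy h => hxy.trans_lt h) h2.2 hvA hvB⟩
  have hA' : A = A ∪ B := by
    by_contra hne
    exact hA.2 _ (Finset.ssubset_iff_subset_ne.mpr ⟨Finset.subset_union_left, hne⟩) h3
  have hB' : B = A ∪ B := by
    by_contra hne
    exact hB.2 _ (Finset.ssubset_iff_subset_ne.mpr ⟨Finset.subset_union_right, hne⟩) h3
  rw [hA', ← hB']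

omit [DecidableEq V] in
theorem IsEdgeConnected.exists_maximal {G : WeightedGraph V} {k : ℝ} {T : Finset V}
    (hT : G.IsEdgeConnected k T) : ∃ S, T ⊆ S ∧ G.IsMaximalEdgeConnected k S := by
  classical
  obtain ⟨S, hS, hmax⟩ := Finset.exists_max_image
    (Finset.univ.filter fun S => T ⊆ S ∧ G.IsEdgeConnected k S) Finset.card
    ⟨T, by simpa using hT⟩
  simp only [Finset.mem_filter, Finset.mem_univ, true_and] at hS hmax
  refine ⟨S, hS.1, hS.2, fun U hU hUk => ?_⟩
  have := hmax U ⟨hS.1.trans hU.1, hUk⟩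
  have := Finset.card_lt_card hU
  omega

/-! ### Extreme weights -/

omit [DecidableEq V] in
theorem le_wMax {e : Sym2 V} (he : e ∈ G.graph.edgeSet) : G.w e ≤ G.wMax :=
  le_csSup (Set.toFinite _).bddAbove ⟨e, he, rfl⟩

omit [DecidableEq V] in
theorem wMin_le {e : Sym2 V} (he : e ∈ G.graph.edgeSet) : G.wMin ≤ G.w e :=
  csInf_le (Set.toFinite _).bddBelow ⟨e, he, rfl⟩

omit [DecidableEq V] in
theorem wMin_pos (h : G.graph.edgeSet.Nonempty) : 0 < G.wMin := by
  obtain ⟨e, he, hw⟩ := (h.image G.w).csInf_mem (Set.toFinite _)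
  unfold wMin
  rw [← hw]
  exact G.w_pos e he

omit [DecidableEq V] in
theorem wMin_le_wMax (h : G.graph.edgeSet.Nonempty) : G.wMin ≤ G.wMax := by
  obtain ⟨e, he⟩ := h
  exact (G.wMin_le he).trans (G.le_wMax he)

omit [DecidableEq V] in
theorem threshold_pos (h : G.graph.edgeSet.Nonempty) (D : Finset V) : 0 < G.threshold D :=
  mul_pos (G.wMin_pos h) (by positivity)

/-- A cut that is heavier than the density is at least as heavy as the threshold. -/
theorem threshold_le_cutWeight (h : G.graph.edgeSet.Nonempty) {D S X : Finset V}
    (hX : G.density D < cutWeight G.adjWeight S X) :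
    G.threshold D ≤ cutWeight G.adjWeight S X := by
  have hmin := G.wMin_pos h
  have hmax := hmin.trans_le (G.wMin_le_wMax h)
  have hD : 0 ≤ G.density D := by
    rw [density_eq]
    exact matrixDensity_nonneg G.adjWeight_nonneg D
  have hedge : ∀ p ∈ G.boundary S X, s(p.1, p.2) ∈ G.graph.edgeSet := by
    intro p hp
    simp only [boundary, Finset.mem_filter] at hp
    exact hp.2
  rw [cutWeight_eq_sum_boundary] at hX ⊢
  have h1 : ∑ p ∈ G.boundary S X, G.w s(p.1, p.2) ≤ (G.boundary S X).card * G.wMax := by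
    rw [← nsmul_eq_mul]
    exact Finset.sum_le_card_nsmul _ _ _ fun p hp => G.le_wMax (hedge p hp)
  have h2 : (G.boundary S X).card * G.wMin ≤ ∑ p ∈ G.boundary S X, G.w s(p.1, p.2) := by
    rw [← nsmul_eq_mul]
    exact Finset.card_nsmul_le_sum _ _ _ fun p hp => G.wMin_le (hedge p hp)
  -- Counting edges: the cut weighs more than `d` and each of its edges at most `w_max`.
  have h3 : G.density D / G.wMax < (G.boundary S X).card := by
    rw [div_lt_iff₀ hmax]
    linarith
  have h4 : ⌈G.density D / G.wMax⌉₊ ≤ (G.boundary S X).card := Nat.ceil_le.mpr h3.le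
  have h5 : 0 < (G.boundary S X).card := by
    have : (0 : ℝ) < (G.boundary S X).card := (div_nonneg hD hmax.le).trans_lt h3
    exact_mod_cast this
  -- Halving loses enough to absorb the `+ 1`, except when the rounded quotient is 0; there `h5` is
  -- needed.
  have h6 : ⌈G.density D / G.wMax⌉₊ / 2 + 1 ≤ (G.boundary S X).card := by omega
  have h7 : ((⌈G.density D / G.wMax⌉₊ / 2 + 1 : ℕ) : ℝ) ≤ (G.boundary S X).card := by
    exact_mod_cast h6
  unfold threshold
  nlinarith

/-- Both requirements follow from cuts being heavier than `d`: the connectivity by counting edges,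
the degrees because singletons are cuts. -/
theorem isMaderVariant_of_noCut (h : G.graph.edgeSet.Nonempty) {D T : Finset V} (hTD : T ⊆ D)
    (hcard : 2 ≤ T.card) (hT : NoCut G.adjWeight (· ≤ G.density D) T) : G.IsMaderVariant D T := by
  refine ⟨hTD, (G.isEdgeConnected_iff (G.threshold_pos h D)).mpr ⟨hcard, fun X hX => ?_⟩,
    fun v hv => ?_⟩
  · exact not_lt.mpr (G.threshold_le_cutWeight h (not_le.mp (hT X hX)))
  · rw [← cutWeight_singleton G hv]
    exact not_le.mp (hT _ (.singleton hv hcard))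

/-! ### The approximation guarantee -/

omit [DecidableEq V] in
theorem card_mul_le_of_le_degIn {S : Finset V} (hS : S.Nonempty) {x : ℝ}
    (h : ∀ v ∈ S, x ≤ G.degIn S v) : x / 2 ≤ G.density S := by
  have h1 := Finset.card_nsmul_le_sum S _ x h
  rw [sum_degIn, nsmul_eq_mul] at h1
  have h2 : (0 : ℝ) < S.card := by exact_mod_cast hS.card_pos
  unfold density
  rw [le_div_iff₀ h2]
  linarith

omit [DecidableEq V] in
theorem IsEdgeConnected.mono {G : WeightedGraph V} {j k : ℝ} (hjk : j ≤ k) {S : Finset V}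
    (h : G.IsEdgeConnected k S) : G.IsEdgeConnected j S :=
  hjk.trans h

/-- Singletons are cuts, so all degrees are at least `k`, and their sum is twice the total weight.
-/
theorem IsEdgeConnected.half_le_density {G : WeightedGraph V} {k : ℝ} (hk : 0 < k) {S : Finset V}
    (h : G.IsEdgeConnected k S) : k / 2 ≤ G.density S := by
  obtain ⟨hcard, hno⟩ := (G.isEdgeConnected_iff hk).mp h
  refine G.card_mul_le_of_le_degIn (Finset.card_pos.mp (by omega)) fun v hv => ?_
  rw [← cutWeight_singleton G hv]
  exact not_lt.mp (hno _ (.singleton hv hcard))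

omit [DecidableEq V] in
theorem density_mul_le_threshold (h : G.graph.edgeSet.Nonempty) (D : Finset V) :
    G.wMin / G.wMax * G.density D ≤ 2 * G.threshold D := by
  have hmin := G.wMin_pos h
  have h1 := Nat.le_ceil (G.density D / G.wMax)
  have h2 : ⌈G.density D / G.wMax⌉₊ ≤ 2 * (⌈G.density D / G.wMax⌉₊ / 2 + 1) := by omega
  have h3 : (⌈G.density D / G.wMax⌉₊ : ℝ) ≤ 2 * ((⌈G.density D / G.wMax⌉₊ / 2 + 1 : ℕ) : ℝ) := by
    exact_mod_cast h2
  unfold threshold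
  calc G.wMin / G.wMax * G.density D = G.wMin * (G.density D / G.wMax) := by ring
    _ ≤ G.wMin * (2 * ((⌈G.density D / G.wMax⌉₊ / 2 + 1 : ℕ) : ℝ)) := by
      gcongr
      exact h1.trans h3
    _ = _ := by ring

end WeightedGraph

/-- Every execution returns a correct answer. -/
theorem BicriteriaRun.IsExecution.isBicriteriaAnswer {V : Type*} [Fintype V]
    {G : WeightedGraph V} (hE : G.graph.edgeSet.Nonempty) {γ : ℝ} (hγ : 1 ≤ γ) (hγ' : γ ≤ 2)
    {k : ℝ} (hk : 0 < k) {r : BicriteriaRun V} (hr : r.IsExecution G k γ) :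
    G.IsBicriteriaAnswer (γ / 4 * (G.wMin / G.wMax)) (1 / γ) k r.out := by
  classical
  have hγ0 : 0 < γ := by linarith
  by_cases hp : r.p = 0
  · rw [hr.infeasible hp]
    intro T hT
    obtain ⟨S, -, hS⟩ := hT.exists_maximal
    obtain ⟨i, -⟩ := (hr.comp_range S).mpr hS
    exact (Fin.cast hp i).elim0
  · obtain ⟨i, hi, hmax⟩ := hr.output hp
    have hcomp : ∀ j, G.IsMaximalEdgeConnected k (r.comp j) := fun j => (hr.comp_range _).mp ⟨j, rfl⟩
    rw [hi]
    refine ⟨⟨_, (hcomp i).1⟩, ?_, fun T hT => ?_⟩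
    · by_cases hif : k ≤ γ * G.threshold (r.dense i)
      · refine (hr.star_then i hif).2.1.mono ?_
        rw [one_div, inv_mul_le_iff₀ hγ0]
        exact hif
      · rw [hr.star_else i hif]
        refine (hcomp i).1.mono ?_
        rw [one_div, inv_mul_le_iff₀ hγ0]
        nlinarith
    · obtain ⟨S, hTS, hS⟩ := hT.exists_maximal
      obtain ⟨j, rfl⟩ := (hr.comp_range S).mpr hS
      refine le_trans ?_ (hmax j)
      have hTne : T.Nonempty := Finset.card_pos.mp
        (by have := ((G.isEdgeConnected_iff hk).mp hT).1; omega)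
      have hTd := (hr.densest j).2.2 T hTS hTne
      have hmin := G.wMin_pos hE
      have hmm := G.wMin_le_wMax hE
      have hq : G.wMin / G.wMax ≤ 1 := (div_le_one (hmin.trans_le hmm)).mpr hmm
      have hq0 : 0 < G.wMin / G.wMax := div_pos hmin (hmin.trans_le hmm)
      set q := G.wMin / G.wMax with hqdef
      set d := G.density (r.dense j) with hd
      have hd0 : 0 ≤ d := by
        rw [hd, WeightedGraph.density_eq]
        exact matrixDensity_nonneg G.adjWeight_nonneg _
      have hqd : 0 ≤ q * d := by positivity
      refine (mul_le_mul_of_nonneg_left hTd (by positivity)).trans ?_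
      by_cases hif : k ≤ γ * G.threshold (r.dense j)
      -- All degrees exceed `d`, so the density is at least `d / 2`, which suffices by `γ ≤ 2` and
      -- `q ≤ 1`.
      · obtain ⟨-, h2, h3⟩ := hr.star_then j hif
        have hcard := ((G.isEdgeConnected_iff (G.threshold_pos hE _)).mp h2).1
        have := G.card_mul_le_of_le_degIn (Finset.card_pos.mp (show 0 < _ by omega))
          fun v hv => (h3 v hv).le
        nlinarith
      -- Here the density is at least `k / 2 > γτ / 2 ≥ γ q d / 4`.
      · rw [hr.star_else j hif]
        have h1 := (hcomp j).1.half_le_density hk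
        have h2 := G.density_mul_le_threshold hE (r.dense j)
        rw [← hqdef, ← hd] at h2
        nlinarith

namespace RealRAM.Cmd

/-- The invariant rule for two nested loops. -/
theorem forN₂_induct {A B : ℕ} {P : Cmd} (hw : (forN A (forN B P)).wf = true) {s : State} {n : ℕ}
    (hn : s.nat 0 0 0 = n) (Inv : ℕ → ℕ → State → Prop)
    (hstable : ∀ i j t a, Inv i j t → Inv i j (t.setNat A 0 0 a))
    (hstable' : ∀ i j t a, Inv i j t → Inv i j (t.setNat B 0 0 a))
    (hinit : Inv 0 0 s) (hrow : ∀ i t, Inv i n t → Inv (i + 1) 0 t)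
    (hstep : ∀ i j t, i < n → j < n → t.nat A 0 0 = i → t.nat B 0 0 = j →
      (∀ C, (forN A (forN B P)).writesNat C = false → t.nat C = s.nat C) →
      (∀ C, (forN A (forN B P)).writesReal C = false → t.real C = s.real C) →
      Inv i j t → Inv i (j + 1) (P.run t)) :
    Inv n 0 ((forN A (forN B P)).run s) := by
  have hw' : A ≠ 0 ∧ (forN B P).writesNat A = false ∧ (forN B P).wf = true := by
    simpa [wf, and_assoc] using hw
  have := forN_induct hw s (fun i t => Inv i 0 t) (fun i t a h => hstable i 0 t a h) hinit ?_
  · rwa [hn] at this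
  · intro i t hi hc hN hR hI
    rw [hn] at hi
    have t0 : t.nat 0 0 0 = n := by rw [hN 0 (wf.writesNat_zero hw), hn]
    have := forN_induct hw'.2.2 t (fun j t => Inv i j t) (fun j t a h => hstable' i j t a h) hI ?_
    · rw [t0] at this
      exact hrow i _ this
    · intro j t' hj hc' hN' hR' hI'
      refine hstep i j t' hi (by rwa [t0] at hj) ?_ hc' (fun C hC => ?_) (fun C hC => ?_) hI'
      · rw [hN' A hw'.2.1, hc]
      · have : (forN B P).writesNat C = false := by
          rw [writesNat, Bool.or_eq_false_iff] at hC
          exact hC.2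
        rw [hN' C this, hN C hC]
      · rw [hR' C hC, hR C hC]

/-! ## The threshold

The density is in the real array `9`, and the threshold is returned in the real array `13`. -/

/-- Compute the maximum edge weight in the real array `11`. -/
def maxWeight : Cmd :=
  seq (setReal 11 (.const 0) (.const 0) (.ofNat (.const 0)))
    (forN 50 (forN 51 (ite (.realLT (rvar 11) (.cell 0 (nvar 50) (nvar 51)))
      (setReal 11 (.const 0) (.const 0) (.cell 0 (nvar 50) (nvar 51))) skip)))

theorem run_maxWeight {n : ℕ} {s : State} (hn : s.nat 0 0 0 = n) {G : WeightedGraph (Fin n)}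
    (ha : s.matrix n 0 = G.adjWeight) (hE : G.graph.edgeSet.Nonempty) :
    (maxWeight.run s).real 11 0 0 = G.wMax := by
  rw [maxWeight, run_seq]
  set s₁ := (setReal 11 (.const 0) (.const 0) (.ofNat (.const 0))).run s with hs₁
  have n1 : s₁.nat 0 0 0 = n := by rw [hs₁, run_nat_of_not_writes _ rfl, hn]
  have r0 : s₁.real 0 = s.real 0 := run_real_of_not_writes _ rfl _
  have ha' : ∀ x y : Fin n, s.real 0 x y = G.adjWeight x y := fun x y => by
    rw [← ha, State.matrix]
  have := forN₂_induct (A := 50) (B := 51) (P := ite (.realLT (rvar 11)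
      (.cell 0 (nvar 50) (nvar 51))) (setReal 11 (.const 0) (.const 0)
        (.cell 0 (nvar 50) (nvar 51))) skip) rfl n1
    (fun i j t => (t.real 11 0 0 = 0 ∨ ∃ x y, t.real 11 0 0 = G.adjWeight x y) ∧
      ∀ x y : Fin n, (x < i ∨ x = i ∧ y < j) → G.adjWeight x y ≤ t.real 11 0 0)
    (fun i j t a h => h) (fun i j t a h => h)
    ⟨Or.inl (by simp [hs₁, NExpr.eval, RExpr.eval, State.setReal_real_self]), by simp⟩
    (fun i t h => ⟨h.1, fun x y hxy => h.2 x y (by omega)⟩) ?_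
  · obtain ⟨h1, h2⟩ := this
    set M := State.real _ 11 0 0
    have hedge : ∀ e ∈ G.graph.edgeSet, G.w e ≤ M := by
      intro e he
      induction e with
      | _ x y =>
        have := h2 x y (Or.inl x.2)
        rwa [WeightedGraph.adjWeight, if_pos (show G.graph.Adj x y from he)] at this
    obtain ⟨e₀, he₀⟩ := hE
    have hM : 0 < M := (G.w_pos e₀ he₀).trans_le (hedge e₀ he₀)
    rcases h1 with h1 | ⟨x, y, hxy⟩
    · exact absurd h1 hM.ne'
    · have hadj : G.graph.Adj x y := by
        rw [← G.adjWeight_pos_iff, ← hxy]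
        exact hM
      refine le_antisymm ?_ (csSup_le ⟨_, e₀, he₀, rfl⟩ ?_)
      · rw [hxy, WeightedGraph.adjWeight, if_pos hadj]
        exact G.le_wMax hadj
      · rintro _ ⟨e, he, rfl⟩
        exact hedge e he
  · intro i j t hi hj hci hcj hN hR ⟨i1, i2⟩
    have t0 : t.real 0 i j = G.adjWeight ⟨i, hi⟩ ⟨j, hj⟩ := by
      rw [hR 0 rfl, r0, ← ha']
    by_cases hlt : t.real 11 0 0 < G.adjWeight ⟨i, hi⟩ ⟨j, hj⟩
    · rw [run_ite_true]
      swap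
      · simpa [BExpr.Holds, RExpr.eval, NExpr.eval, hci, hcj, t0] using hlt
      simp only [run_setReal, RExpr.eval, NExpr.eval, hci, hcj, t0, State.setReal_real_self,
        and_self, if_true]
      refine ⟨Or.inr ⟨_, _, rfl⟩, fun x y hxy => ?_⟩
      by_cases hlast : (x : ℕ) = i ∧ (y : ℕ) = j
      · obtain ⟨rfl, rfl⟩ := hlast
        exact le_rfl
      · exact (i2 x y (by omega)).trans hlt.le
    · rw [run_ite_false, run_skip]
      swap
      · simpa [BExpr.Holds, RExpr.eval, NExpr.eval, hci, hcj, t0] using hlt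
      refine ⟨i1, fun x y hxy => ?_⟩
      by_cases hlast : (x : ℕ) = i ∧ (y : ℕ) = j
      · obtain ⟨rfl, rfl⟩ := hlast
        exact not_lt.mp hlt
      · exact i2 x y (by omega)

/-- Compute the minimum edge weight in the real array `12`, given the maximum. -/
def minWeight : Cmd :=
  seq (setReal 12 (.const 0) (.const 0) (rvar 11))
    (forN 50 (forN 51 (ite (.and (.realLT (.ofNat (.const 0)) (.cell 0 (nvar 50) (nvar 51)))
        (.realLT (.cell 0 (nvar 50) (nvar 51)) (rvar 12)))
      (setReal 12 (.const 0) (.const 0) (.cell 0 (nvar 50) (nvar 51))) skip)))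

/-- Starting from the maximum, which some edge attains, keeps the stored value an edge weight
throughout; zero entries are non-edges and are skipped. -/
theorem run_minWeight {n : ℕ} {s : State} (hn : s.nat 0 0 0 = n) {G : WeightedGraph (Fin n)}
    (ha : s.matrix n 0 = G.adjWeight) (hE : G.graph.edgeSet.Nonempty)
    (hM : s.real 11 0 0 = G.wMax) :
    (minWeight.run s).real 12 0 0 = G.wMin := by
  rw [minWeight, run_seq]
  set s₁ := (setReal 12 (.const 0) (.const 0) (rvar 11)).run s with hs₁
  have n1 : s₁.nat 0 0 0 = n := by rw [hs₁, run_nat_of_not_writes _ rfl, hn]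
  have r0 : s₁.real 0 = s.real 0 := run_real_of_not_writes _ rfl _
  have ha' : ∀ x y : Fin n, s.real 0 x y = G.adjWeight x y := fun x y => by
    rw [← ha, State.matrix]
  have hmax : ∃ e ∈ G.graph.edgeSet, G.w e = G.wMax :=
    (hE.image G.w).csSup_mem (Set.toFinite _)
  have := forN₂_induct (A := 50) (B := 51)
    (P := ite (.and (.realLT (.ofNat (.const 0)) (.cell 0 (nvar 50) (nvar 51)))
        (.realLT (.cell 0 (nvar 50) (nvar 51)) (rvar 12)))
      (setReal 12 (.const 0) (.const 0) (.cell 0 (nvar 50) (nvar 51))) skip) rfl n1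
    (fun i j t => (∃ e ∈ G.graph.edgeSet, G.w e = t.real 12 0 0) ∧
      ∀ x y : Fin n, (x < i ∨ x = i ∧ y < j) → G.graph.Adj x y → t.real 12 0 0 ≤ G.adjWeight x y)
    (fun i j t a h => h) (fun i j t a h => h)
    ⟨by simpa [hs₁, NExpr.eval, RExpr.eval, State.setReal_real_self, hM] using hmax, by simp⟩
    (fun i t h => ⟨h.1, fun x y hxy => h.2 x y (by omega)⟩) ?_
  · obtain ⟨⟨e₀, he₀, h1⟩, h2⟩ := this
    refine le_antisymm (le_csInf (hE.image G.w) ?_) ?_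
    · rintro _ ⟨e, he, rfl⟩
      induction e with
      | _ x y =>
        have := h2 x y (Or.inl x.2) he
        rwa [WeightedGraph.adjWeight, if_pos (show G.graph.Adj x y from he)] at this
    · rw [← h1]
      exact G.wMin_le he₀
  · intro i j t hi hj hci hcj hN hR ⟨i1, i2⟩
    have t0 : t.real 0 i j = G.adjWeight ⟨i, hi⟩ ⟨j, hj⟩ := by
      rw [hR 0 rfl, r0, ← ha']
    by_cases hlt : 0 < G.adjWeight ⟨i, hi⟩ ⟨j, hj⟩ ∧ G.adjWeight ⟨i, hi⟩ ⟨j, hj⟩ < t.real 12 0 0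
    · rw [run_ite_true]
      swap
      · simpa [BExpr.Holds, RExpr.eval, NExpr.eval, hci, hcj, t0] using hlt
      simp only [run_setReal, RExpr.eval, NExpr.eval, hci, hcj, t0, State.setReal_real_self,
        and_self, if_true]
      refine ⟨?_, fun x y hxy hadj => ?_⟩
      · have := (G.adjWeight_pos_iff _ _).mp hlt.1
        exact ⟨_, this, by rw [WeightedGraph.adjWeight, if_pos this]⟩
      · by_cases hlast : (x : ℕ) = i ∧ (y : ℕ) = j
        · obtain ⟨rfl, rfl⟩ := hlast
          exact le_rfl
        · exact hlt.2.le.trans (i2 x y (by omega) hadj)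
    · rw [run_ite_false, run_skip]
      swap
      · simpa [BExpr.Holds, RExpr.eval, NExpr.eval, hci, hcj, t0] using hlt
      refine ⟨i1, fun x y hxy hadj => ?_⟩
      by_cases hlast : (x : ℕ) = i ∧ (y : ℕ) = j
      · obtain ⟨rfl, rfl⟩ := hlast
        exact not_lt.mp fun h => hlt ⟨(G.adjWeight_pos_iff _ _).mpr hadj, h⟩
      · exact i2 x y (by omega) hadj

/-- Round the quotient of the density and the maximum weight up, in the array `53`. -/
def ceilQuotient : Cmd :=
  seq (setNat 53 (.const 0) (.const 0) (.const 0))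
    (forN 50 (ite (.realLT (.ofNat (nvar 50)) (.div (rvar 9) (rvar 11)))
      (setNat 53 (.const 0) (.const 0) (.add (nvar 53) (.const 1))) skip))

/-- The machine has no rounding, so the ceiling is obtained by counting the natural numbers below
the quotient. The bound `n` makes one loop long enough. -/
theorem run_ceilQuotient {n : ℕ} {s : State} (hn : s.nat 0 0 0 = n)
    (h : s.real 9 0 0 / s.real 11 0 0 ≤ n) :
    (ceilQuotient.run s).nat 53 0 0 = ⌈s.real 9 0 0 / s.real 11 0 0⌉₊ := by
  rw [ceilQuotient, run_seq]
  set s₁ := (setNat 53 (.const 0) (.const 0) (.const 0)).run s with hs₁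
  have n1 : s₁.nat 0 0 0 = n := by rw [hs₁, run_nat_of_not_writes _ rfl, hn]
  set c := ⌈s.real 9 0 0 / s.real 11 0 0⌉₊ with hc
  have hcn : c ≤ n := Nat.ceil_le.mpr h
  have := forN_induct (A := 50) (P := ite (.realLT (.ofNat (nvar 50)) (.div (rvar 9) (rvar 11)))
      (setNat 53 (.const 0) (.const 0) (.add (nvar 53) (.const 1))) skip) rfl s₁
    (fun i t => t.nat 53 0 0 = min i c) (fun i t a h => h)
    (by simp [hs₁, NExpr.eval, State.setNat_nat_self]) ?_
  · rw [this, n1]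
    omega
  · intro i t hi hci hN hR hI
    have r9 : t.real 9 = s.real 9 := hR 9 rfl
    have r11 : t.real 11 = s.real 11 := hR 11 rfl
    have htest : BExpr.Holds t (.realLT (.ofNat (nvar 50)) (.div (rvar 9) (rvar 11))) ↔ i < c := by
      rw [hc, Nat.lt_ceil]
      simp [BExpr.Holds, RExpr.eval, NExpr.eval, hci, r9, r11]
    by_cases hlt : i < c
    · rw [run_ite_true _ _ (htest.mpr hlt)]
      simp only [run_setNat, NExpr.eval, State.setNat_nat_self, and_self, if_true, hI]
      omega
    · rw [run_ite_false _ _ (mt htest.mp hlt), run_skip, hI]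
      omega

/-- Compute half of the number in the array `53`, rounded down, in the array `54`. -/
def half : Cmd :=
  seq (setNat 54 (.const 0) (.const 0) (.const 0))
    (forN 50 (ite (.natLT (.add (.add (nvar 54) (nvar 54)) (.const 1)) (nvar 53))
      (setNat 54 (.const 0) (.const 0) (.add (nvar 54) (.const 1))) skip))

/-- The count increases as long as `2m + 1 < c`, which is equivalent to `m < ⌊c/2⌋`. -/
theorem run_half {s : State} (h : s.nat 53 0 0 ≤ s.nat 0 0 0) :
    (half.run s).nat 54 0 0 = s.nat 53 0 0 / 2 := by
  rw [half, run_seq]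
  set s₁ := (setNat 54 (.const 0) (.const 0) (.const 0)).run s with hs₁
  have n1 : s₁.nat 0 0 0 = s.nat 0 0 0 := by rw [hs₁, run_nat_of_not_writes _ rfl]
  have := forN_induct (A := 50)
    (P := ite (.natLT (.add (.add (nvar 54) (nvar 54)) (.const 1)) (nvar 53))
      (setNat 54 (.const 0) (.const 0) (.add (nvar 54) (.const 1))) skip) rfl s₁
    (fun i t => t.nat 54 0 0 = min i (s.nat 53 0 0 / 2)) (fun i t a h => h)
    (by simp [hs₁, NExpr.eval, State.setNat_nat_self]) ?_
  · rw [this, n1]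
    omega
  · intro i t hi hci hN hR hI
    have e53 : t.nat 53 = s.nat 53 := by
      rw [hN 53 rfl, hs₁, run_nat_of_not_writes _ rfl]
    by_cases hlt : i < s.nat 53 0 0 / 2
    · rw [run_ite_true]
      · simp only [run_setNat, NExpr.eval, State.setNat_nat_self, and_self, if_true, hI]
        omega
      · simp only [BExpr.Holds, NExpr.eval, e53, hI]
        omega
    · rw [run_ite_false, run_skip, hI]
      · omega
      · simp only [BExpr.Holds, NExpr.eval, e53, hI]
        omega

/-- Compute the threshold. -/
def threshold : Cmd :=
  seq maxWeight (seq minWeight (seq ceilQuotient (seq half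
    (setReal 13 (.const 0) (.const 0) (.mul (rvar 12) (.ofNat (.add (nvar 54) (.const 1))))))))

/-- A crude bound on the inner weight by `|D|² w_max / 2`; it guarantees that rounding by counting
up to `n` terminates with the right value. -/
theorem _root_.WeightedGraph.density_div_wMax_le {V : Type*} [Fintype V] (G : WeightedGraph V)
    (hE : G.graph.edgeSet.Nonempty) (D : Finset V) : G.density D / G.wMax ≤ Fintype.card V := by
  classical
  have hM := (G.wMin_pos hE).trans_le (G.wMin_le_wMax hE)
  rw [div_le_iff₀ hM]
  have h1 : ∀ u v, G.adjWeight u v ≤ G.wMax := by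
    intro u v
    unfold WeightedGraph.adjWeight
    split_ifs with h
    · exact G.le_wMax h
    · exact hM.le
  have h2 : ∑ u ∈ D, ∑ v ∈ D, G.adjWeight u v ≤ D.card * (D.card * G.wMax) := by
    rw [← nsmul_eq_mul]
    refine Finset.sum_le_card_nsmul _ _ _ fun u _ => ?_
    rw [← nsmul_eq_mul]
    exact Finset.sum_le_card_nsmul _ _ _ fun v _ => h1 u v
  have h3 : (D.card : ℝ) ≤ Fintype.card V := by exact_mod_cast D.card_le_univ
  rcases D.eq_empty_or_nonempty with rfl | hD
  · rw [WeightedGraph.density_eq, matrixDensity_empty]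
    positivity
  · have h4 : (0 : ℝ) < D.card := by exact_mod_cast hD.card_pos
    rw [WeightedGraph.density_eq, matrixDensity, matrixWeight, div_le_iff₀ h4]
    nlinarith [mul_pos h4 hM]

theorem run_threshold {n : ℕ} {s : State} (hn : s.nat 0 0 0 = n) {G : WeightedGraph (Fin n)}
    (ha : s.matrix n 0 = G.adjWeight) (hE : G.graph.edgeSet.Nonempty) {D : Finset (Fin n)}
    (hD : s.real 9 0 0 = G.density D) : (threshold.run s).real 13 0 0 = G.threshold D := by
  simp only [threshold, run_seq]
  have h1 := run_maxWeight hn ha hE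
  set s₁ := maxWeight.run s with hs₁
  have n1 : s₁.nat 0 0 0 = n := by rw [hs₁, run_nat_of_not_writes _ rfl, hn]
  have a1 : s₁.matrix n 0 = G.adjWeight := by
    rw [← ha]
    unfold State.matrix
    rw [hs₁, run_real_of_not_writes _ rfl]
  have h2 := run_minWeight n1 a1 hE h1
  set s₂ := minWeight.run s₁ with hs₂
  have n2 : s₂.nat 0 0 0 = n := by rw [hs₂, run_nat_of_not_writes _ rfl, n1]
  have e9 : s₂.real 9 0 0 = G.density D := by
    rw [hs₂, run_real_of_not_writes _ rfl, hs₁, run_real_of_not_writes _ rfl, hD]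
  have e11 : s₂.real 11 0 0 = G.wMax := by rw [hs₂, run_real_of_not_writes _ rfl, h1]
  have hle := G.density_div_wMax_le hE D
  rw [Fintype.card_fin] at hle
  have h3 := run_ceilQuotient n2 (by rw [e9, e11]; exact hle)
  rw [e9, e11] at h3
  set s₃ := ceilQuotient.run s₂ with hs₃
  have n3 : s₃.nat 0 0 0 = n := by rw [hs₃, run_nat_of_not_writes _ rfl, n2]
  have h4 := run_half (s := s₃) (by rw [h3, n3]; exact Nat.ceil_le.mpr hle)
  rw [h3] at h4
  have h5 : (half.run s₃).real 12 0 0 = G.wMin := by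
    rw [run_real_of_not_writes _ rfl, hs₃, run_real_of_not_writes _ rfl, h2]
  simp only [run_setReal, NExpr.eval, RExpr.eval, State.setReal_real_self, and_self, if_true, h4,
    h5, WeightedGraph.threshold]

/-! ## Highly connected subgraphs of high minimum degree

The set is in row `0` of the array `31` and its density in the real array `9`. The subset is
returned in row `0` of the array `35`. -/

/-- Split with every member of the set as a seed until a part with at least two vertices remains. -/
def mader : Cmd :=
  seq (setNat 34 (.const 0) (.const 0) (.const 0))
    (seq (setReal 8 (.const 0) (.const 0) (rvar 9))
      (seq (setNat 29 (.const 0) (.const 0) (.const 1))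
        (forN 36 (ite (.and (.pos (.mem 31 (nvar 36))) (.not (.pos (nvar 34))))
          (seq (copySet 26 31)
            (seq (setNat 28 (.const 0) (.const 0) (nvar 36))
              (seq narrow
                (seq globalMinCut
                  (ite (.pos (nvar 24))
                    (seq (setNat 34 (.const 0) (.const 0) (.const 1)) (copySet 35 26)) skip)))))
          skip))))

/-- A set has a cut exactly if it has at least two vertices, so the minimum cut routine doubles as a
size test. -/
theorem run_globalMinCut_flag {n : ℕ} (h2 : 2 ≤ n) {s : State} (hn : s.nat 0 0 0 = n)
    {a : Fin n → Fin n → ℝ} (ha : s.matrix n 0 = a) (ha0 : ∀ u v, 0 ≤ a u v) :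
    (globalMinCut.run s).nat 24 0 0 = 1 ∧ 2 ≤ (s.row n 26 0).card ∨
      (globalMinCut.run s).nat 24 0 0 = 0 ∧ ¬ 2 ≤ (s.row n 26 0).card := by
  rcases run_globalMinCut h2 hn ha ha0 (S := s.row n 26 0) rfl with ⟨h, -⟩ | ⟨h, h'⟩
  · exact Or.inl ⟨h.1, h.2.1.two_le_card⟩
  · refine Or.inr ⟨h, fun hc => ?_⟩
    obtain ⟨v, hv⟩ := Finset.card_pos.mp (show 0 < (s.row n 26 0).card by omega)
    exact h' _ (.singleton hv hc)

/-- Given that some `T` as required exists, a seed in `T` succeeds, because narrowing around it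
keeps all of `T` and hence at least two vertices. The flag in array `34` preserves the first
success, possibly with a seed outside `T`. -/
theorem run_mader {n : ℕ} (h2 : 2 ≤ n) {s : State} (hn : s.nat 0 0 0 = n)
    {a : Fin n → Fin n → ℝ} (ha : s.matrix n 0 = a) (ha0 : ∀ u v, 0 ≤ a u v)
    {D T : Finset (Fin n)} (hD : s.row n 31 0 = D) (hTD : T ⊆ D) (hT : 2 ≤ T.card)
    (hT' : NoCut a (· ≤ s.real 9 0 0) T) :
    (mader.run s).row n 35 0 ⊆ D ∧ 2 ≤ ((mader.run s).row n 35 0).card ∧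
      NoCut a (· ≤ s.real 9 0 0) ((mader.run s).row n 35 0) := by
  simp only [mader, run_seq]
  set s₁ := (setNat 29 (.const 0) (.const 0) (.const 1)).run
    ((setReal 8 (.const 0) (.const 0) (rvar 9)).run
      ((setNat 34 (.const 0) (.const 0) (.const 0)).run s)) with hs₁
  have e34 : s₁.nat 34 0 0 = 0 := rfl
  have e29 : s₁.nat 29 0 0 = 1 := rfl
  have e8 : s₁.real 8 0 0 = s.real 9 0 0 := rfl
  have r0 : s₁.real 0 = s.real 0 := by
    rw [hs₁, run_real_of_not_writes _ rfl, run_real_of_not_writes _ rfl,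
      run_real_of_not_writes _ rfl]
  have n1 : s₁.nat 0 0 0 = n := by
    rw [hs₁, run_nat_of_not_writes _ rfl, run_nat_of_not_writes _ rfl,
      run_nat_of_not_writes _ rfl, hn]
  have e31 : s₁.nat 31 = s.nat 31 := by
    rw [hs₁, run_nat_of_not_writes _ rfl, run_nat_of_not_writes _ rfl,
      run_nat_of_not_writes _ rfl]
  have := forN_induct (A := 36) (P := ite (.and (.pos (.mem 31 (nvar 36))) (.not (.pos (nvar 34))))
          (seq (copySet 26 31)
            (seq (setNat 28 (.const 0) (.const 0) (nvar 36))
              (seq narrow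
                (seq globalMinCut
                  (ite (.pos (nvar 24))
                    (seq (setNat 34 (.const 0) (.const 0) (.const 1)) (copySet 35 26)) skip)))))
          skip) rfl s₁
    (fun m t => (t.nat 34 0 0 = 1 ∧ t.row n 35 0 ⊆ D ∧ 2 ≤ (t.row n 35 0).card ∧
        NoCut a (· ≤ s.real 9 0 0) (t.row n 35 0)) ∨
      t.nat 34 0 0 = 0 ∧ ∀ v : Fin n, v < m → v ∉ T)
    (fun m t a ht => ht) (Or.inr ⟨e34, by simp⟩) ?_
  · rcases this with h | ⟨-, h⟩
    · exact h.2
    · obtain ⟨v, hv⟩ := Finset.card_pos.mp (show 0 < T.card by omega)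
      exact absurd hv (h v (by rw [n1]; exact v.2))
  · intro m t hm hc hN hR hI
    rw [n1] at hm
    have t31 : t.row n 31 0 = D := by rw [State.row_congr (hN 31 rfl), State.row_congr e31, hD]
    have mem : t.nat 31 0 m = 1 ↔ (⟨m, hm⟩ : Fin n) ∈ D := by rw [← t31, State.mem_row]
    rcases hI with hI | ⟨hI, hno⟩
    · rw [run_ite_false, run_skip]
      · exact Or.inl hI
      · simp [BExpr.Holds, NExpr.eval, hI.1]
    · by_cases hmD : (⟨m, hm⟩ : Fin n) ∈ D
      · rw [run_ite_true]
        swap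
        · simp [BExpr.Holds, NExpr.eval, NExpr.eval_ind, hc, mem, hmD, hI]
        simp only [run_seq]
        have t0 : t.nat 0 0 0 = n := by rw [hN 0 rfl, n1]
        have h26 := row_copySet (C := 26) (A := 31) (by decide) (by decide) (by decide)
          (by decide) t0
        rw [t31] at h26
        set t₁ := (copySet 26 31).run t with ht₁
        set t₂ := (setNat 28 (.const 0) (.const 0) (nvar 36)).run t₁ with ht₂
        have u0 : t₂.nat 0 0 0 = n := by
          rw [ht₂, run_nat_of_not_writes _ rfl, ht₁, run_nat_of_not_writes _ rfl, t0]
        have u26 : t₂.row n 26 0 = D := by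
          rw [ht₂, State.row_congr (run_nat_of_not_writes _ rfl _), h26]
        have u28 : t₂.nat 28 0 0 = (⟨m, hm⟩ : Fin n) := by
          rw [ht₂, run_setNat, State.setNat_nat_self]
          simp only [NExpr.eval, and_self, if_true]
          rw [ht₁, run_nat_of_not_writes _ rfl, hc]
        have ua : t₂.matrix n 0 = a := by
          rw [← ha]
          unfold State.matrix
          rw [ht₂, run_real_of_not_writes _ rfl, ht₁, run_real_of_not_writes _ rfl, hR 0 rfl, r0]
        have u8 : t₂.real 8 0 0 = s.real 9 0 0 := by
          rw [ht₂, run_real_of_not_writes _ rfl, ht₁, run_real_of_not_writes _ rfl, hR 8 rfl, e8]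
        have u29 : t₂.nat 29 0 0 = 1 := by
          rw [ht₂, run_nat_of_not_writes _ rfl, ht₁, run_nat_of_not_writes _ rfl, hN 29 rfl, e29]
        have u34 : t₂.nat 34 0 0 = 0 := by
          rw [ht₂, run_nat_of_not_writes _ rfl, ht₁, run_nat_of_not_writes _ rfl, hI]
        obtain ⟨k1, k2, k3, k4⟩ := run_narrow h2 u0 ua ha0 u26 u28 hmD
          (P := (· ≤ s.real 9 0 0)) (by
            intro x
            rw [u8, u29]
            simpa using le_of_lt)
        set t₃ := narrow.run t₂ with ht₃
        have v0 : t₃.nat 0 0 0 = n := by rw [ht₃, run_nat_of_not_writes _ rfl, u0]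
        have va : t₃.matrix n 0 = a := by
          rw [← ua]
          unfold State.matrix
          rw [ht₃, run_real_of_not_writes _ rfl]
        have hflag := run_globalMinCut_flag h2 v0 va ha0
        set t₄ := globalMinCut.run t₃ with ht₄
        have w26 : t₄.row n 26 0 = t₃.row n 26 0 :=
          State.row_congr (by rw [ht₄, run_nat_of_not_writes _ rfl]) _ _
        rcases hflag with ⟨f1, f2⟩ | ⟨f1, f2⟩
        · rw [run_ite_true]
          swap
          · simp [BExpr.Holds, NExpr.eval, f1]
          left
          rw [run_seq]
          set t₅ := (setNat 34 (.const 0) (.const 0) (.const 1)).run t₄ with ht₅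
          have x0 : t₅.nat 0 0 0 = n := by
            rw [ht₅, run_nat_of_not_writes _ rfl, ht₄, run_nat_of_not_writes _ rfl, v0]
          have x26 : t₅.row n 26 0 = t₃.row n 26 0 := by
            rw [ht₅, State.row_congr (run_nat_of_not_writes _ rfl _), w26]
          have x34 : t₅.nat 34 0 0 = 1 := rfl
          rw [row_copySet (by decide) (by decide) (by decide) (by decide) x0, x26,
            run_nat_of_not_writes _ rfl]
          exact ⟨x34, k2, f2, k3⟩
        · rw [run_ite_false, run_skip]
          swap
          · simp [BExpr.Holds, NExpr.eval, f1]
          right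
          refine ⟨?_, fun v hv hvT => ?_⟩
          · rw [ht₄, run_nat_of_not_writes _ rfl, ht₃, run_nat_of_not_writes _ rfl, u34]
          · by_cases hvm : (v : ℕ) = m
            · have : v = ⟨m, hm⟩ := Fin.ext hvm
              rw [this] at hvT
              exact f2 (hT.trans (Finset.card_le_card (k4 T hTD hvT hT')))
            · exact hno v (by omega) hvT
      · rw [run_ite_false, run_skip]
        · refine Or.inr ⟨hI, fun v hv hvT => ?_⟩
          by_cases hvm : (v : ℕ) = m
          · have : v = ⟨m, hm⟩ := Fin.ext hvm
            exact hmD (this ▸ hTD hvT)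
          · exact hno v (by omega) hvT
        · simp [BExpr.Holds, NExpr.eval, NExpr.eval_ind, hc, mem, hmD]

end RealRAM.Cmd

namespace RealRAM.Cmd

/-! ## The algorithm

The vertices are the seeds of the components; those in a component found earlier are marked in
row `0` of the array `41`. The current component, its densest subgraph and the set that replaces it
are in row `0` of the arrays `30`, `31`, `35`, and the best density so far is in the real
array `14`. -/

/-- Treat the component in the array `30`. -/
def processComponent : Cmd :=
  seq densest (seq threshold
    (ite (.realLT (.mul (.cell 1 (.const 0) (.const 1)) (rvar 13)) (.cell 1 (.const 0) (.const 0)))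
      (copySet 35 30) mader))

theorem run_processComponent {n : ℕ} (h2 : 2 ≤ n) {s : State} (hn : s.nat 0 0 0 = n)
    {G : WeightedGraph (Fin n)} (ha : s.matrix n 0 = G.adjWeight)
    (hE : G.graph.edgeSet.Nonempty) {k γ : ℝ} (hk : s.real 1 0 0 = k) (hγ : s.real 1 0 1 = γ)
    (hk0 : 0 < k) {C : Finset (Fin n)} (hC : s.row n 30 0 = C) (hCk : G.IsEdgeConnected k C) :
    (processComponent.run s).row n 30 0 = C ∧
      G.IsDensestIn C ((processComponent.run s).row n 31 0) ∧
      (k ≤ γ * G.threshold ((processComponent.run s).row n 31 0) →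
        G.IsMaderVariant ((processComponent.run s).row n 31 0)
          ((processComponent.run s).row n 35 0)) ∧
      (¬ k ≤ γ * G.threshold ((processComponent.run s).row n 31 0) →
        (processComponent.run s).row n 35 0 = C) := by
  have hcard := ((G.isEdgeConnected_iff hk0).mp hCk).1
  have hCne : C.Nonempty := Finset.card_pos.mp (by omega)
  obtain ⟨d1, d2, d3, d4⟩ := run_densest h2 hn ha G.adjWeight_nonneg hC hCne
  simp only [processComponent, run_seq]
  set s₁ := densest.run s with hs₁
  set D := s₁.row n 31 0 with hD
  have n1 : s₁.nat 0 0 0 = n := by rw [hs₁, run_nat_of_not_writes _ rfl, hn]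
  have a1 : s₁.matrix n 0 = G.adjWeight := by
    rw [← ha]
    unfold State.matrix
    rw [hs₁, run_real_of_not_writes _ rfl]
  have d3' : s₁.real 9 0 0 = G.density D := by rw [d3, WeightedGraph.density_eq]
  have hdens : G.IsDensestIn C D := ⟨d1, d2, fun T hT _ => by
    rw [← d3', WeightedGraph.density_eq]
    exact d4 T hT⟩
  have hth := run_threshold n1 a1 hE d3'
  set s₂ := threshold.run s₁ with hs₂
  have n2 : s₂.nat 0 0 0 = n := by rw [hs₂, run_nat_of_not_writes _ rfl, n1]
  have a2 : s₂.matrix n 0 = G.adjWeight := by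
    rw [← a1]
    unfold State.matrix
    rw [hs₂, run_real_of_not_writes _ rfl]
  have r1 : s₂.real 1 = s.real 1 := by
    rw [hs₂, run_real_of_not_writes _ rfl, hs₁, run_real_of_not_writes _ rfl]
  have e30 : s₂.row n 30 0 = C := by
    rw [← hC]
    exact State.row_congr (by rw [hs₂, run_nat_of_not_writes _ rfl, hs₁,
      run_nat_of_not_writes _ rfl]) _ _
  have e31 : s₂.row n 31 0 = D := State.row_congr (by rw [hs₂, run_nat_of_not_writes _ rfl]) _ _
  have e9 : s₂.real 9 0 0 = G.density D := by rw [hs₂, run_real_of_not_writes _ rfl, d3']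
  have htest : BExpr.Holds s₂ (.realLT (.mul (.cell 1 (.const 0) (.const 1)) (rvar 13))
      (.cell 1 (.const 0) (.const 0))) ↔ ¬ k ≤ γ * G.threshold D := by
    simp [BExpr.Holds, RExpr.eval, NExpr.eval, r1, hk, hγ, hth]
  by_cases hif : k ≤ γ * G.threshold D
  · rw [run_ite_false _ _ fun h => htest.mp h hif, State.row_congr (run_nat_of_not_writes _ rfl _),
      State.row_congr (A := 31) (run_nat_of_not_writes _ rfl _), e30, e31]
    refine ⟨rfl, hdens, fun _ => ?_, fun h => absurd hif h⟩
    -- The component has density at least `k / 2`, and `D` is at least as dense. Positivity is what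
    -- makes the highly connected subgraph exist.
    have hpos : 0 < matrixDensity G.adjWeight D := by
      rw [← WeightedGraph.density_eq]
      have h1 := hCk.half_le_density hk0
      have h3 := hdens.2.2 C subset_rfl hCne
      linarith
    obtain ⟨T, hTD, hT2, hT⟩ := exists_noCut_le_density G.adjWeight_comm G.adjWeight_self hpos
    rw [← WeightedGraph.density_eq, ← e9] at hT
    obtain ⟨m1, m2, m3⟩ := run_mader h2 n2 a2 G.adjWeight_nonneg e31 hTD hT2 hT
    rw [e9] at m3
    exact G.isMaderVariant_of_noCut hE m1 m2 m3
  · rw [run_ite_true _ _ (htest.mpr hif), State.row_congr (run_nat_of_not_writes _ rfl _),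
      State.row_congr (A := 31) (run_nat_of_not_writes _ rfl _), e30, e31,
      row_copySet (by decide) (by decide) (by decide) (by decide) n2, e30]
    exact ⟨rfl, hdens, fun h => absurd h hif, fun _ => rfl⟩

/-- Compare the set in the array `35` with the best set so far. -/
def updateAnswer : Cmd :=
  seq (density 35)
    (ite (.and (.pos (.cell 1 (.const 0) (.const 1))) (.not (.realLT (rvar 14) (rvar 10)))) skip
      (seq (setNat 1 (.const 0) (.const 1) (.const 1))
        (seq (setReal 14 (.const 0) (.const 0) (rvar 10)) (copySet 5 35))))

theorem run_updateAnswer {n : ℕ} {s : State} (hn : s.nat 0 0 0 = n)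
    {G : WeightedGraph (Fin n)} (ha : s.matrix n 0 = G.adjWeight)
    (hflag : s.nat 1 0 1 = 0 ∨ s.nat 1 0 1 = 1) :
    (updateAnswer.run s).nat 1 0 0 = s.nat 1 0 0 ∧ (updateAnswer.run s).nat 1 0 1 = 1 ∧
      ((s.nat 1 0 1 = 1 ∧ (updateAnswer.run s).row n 5 0 = s.row n 5 0 ∧
          (updateAnswer.run s).real 14 0 0 = s.real 14 0 0 ∧
          G.density (s.row n 35 0) ≤ s.real 14 0 0) ∨
        ((updateAnswer.run s).row n 5 0 = s.row n 35 0 ∧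
          (updateAnswer.run s).real 14 0 0 = G.density (s.row n 35 0) ∧
          (s.nat 1 0 1 = 1 → s.real 14 0 0 ≤ G.density (s.row n 35 0)))) := by
  rw [updateAnswer, run_seq]
  have hd := run_density (A := 35) (by decide) (by decide) hn ha
  rw [← WeightedGraph.density_eq] at hd
  set s₁ := (density 35).run s with hs₁
  have n1 : s₁.nat 0 0 0 = n := by rw [hs₁, run_nat_of_not_writes _ rfl, hn]
  have e1 : s₁.nat 1 = s.nat 1 := by rw [hs₁, run_nat_of_not_writes _ rfl]
  have e5 : s₁.row n 5 0 = s.row n 5 0 := State.row_congr (by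
    rw [hs₁, run_nat_of_not_writes _ rfl]) _ _
  have e35 : s₁.row n 35 0 = s.row n 35 0 := State.row_congr (by
    rw [hs₁, run_nat_of_not_writes _ rfl]) _ _
  have e14 : s₁.real 14 = s.real 14 := by rw [hs₁, run_real_of_not_writes _ rfl]
  by_cases hkeep : 0 < s.nat 1 0 1 ∧ ¬ s.real 14 0 0 < G.density (s.row n 35 0)
  · rw [run_ite_true, run_skip, e1, e5, e14]
    · have h1 : s.nat 1 0 1 = 1 := by omega
      exact ⟨rfl, h1, Or.inl ⟨h1, rfl, rfl, not_lt.mp hkeep.2⟩⟩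
    · simpa [BExpr.Holds, RExpr.eval, NExpr.eval, e1, e14, hd] using hkeep
  · rw [run_ite_false]
    · simp only [run_seq]
      set s₂ := (setNat 1 (.const 0) (.const 1) (.const 1)).run s₁ with hs₂
      set s₃ := (setReal 14 (.const 0) (.const 0) (rvar 10)).run s₂ with hs₃
      have n3 : s₃.nat 0 0 0 = n := by
        rw [hs₃, run_nat_of_not_writes _ rfl, hs₂, run_nat_of_not_writes _ rfl, n1]
      have f35 : s₃.row n 35 0 = s.row n 35 0 := by
        rw [hs₃, State.row_congr (run_nat_of_not_writes _ rfl _), hs₂,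
          State.row_congr (run_nat_of_not_writes _ rfl _), e35]
      have f1 : s₃.nat 1 0 0 = s.nat 1 0 0 := by
        rw [← e1]
        rfl
      have f1' : s₃.nat 1 0 1 = 1 := rfl
      have f14 : s₃.real 14 0 0 = G.density (s.row n 35 0) := by
        rw [← hd]
        rfl
      rw [run_nat_of_not_writes _ rfl, run_real_of_not_writes _ rfl,
        row_copySet (by decide) (by decide) (by decide) (by decide) n3, f35, f1, f1', f14]
      refine ⟨rfl, rfl, Or.inr ⟨rfl, rfl, fun h => ?_⟩⟩
      by_contra hlt
      exact hkeep ⟨by omega, fun h' => hlt h'.le⟩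
    · simpa [BExpr.Holds, RExpr.eval, NExpr.eval, e1, e14, hd] using hkeep

/-- Append the set in the array `A` to the family in the array `B`. -/
def appendSet (B A : ℕ) : Cmd := fillNat B (nvar 1) (.mem A (nvar 50))

theorem row_appendSet {A B : ℕ} (hB : B ≠ 0) (hB' : B ≠ 50) (hB1 : B ≠ 1) (hA : A ≠ B)
    (hA' : A ≠ 50) {n : ℕ} {s : State} (hn : s.nat 0 0 0 = n) :
    ((appendSet B A).run s).row n B (s.nat 1 0 0) = s.row n A 0 ∧
      ∀ i, i ≠ s.nat 1 0 0 → ((appendSet B A).run s).row n B i = s.row n B i := by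
  have := run_fillNat (A := B) (i := nvar 1) (X := .mem A (nvar 50)) hB hB' s (s.nat 1 0 0)
    (fun v => if s.nat A 0 v = 1 then 1 else 0)
    (fun t v hv hN hR h50 _ => ⟨by simp [NExpr.eval, hN 1 hB1.symm], by
      simp [NExpr.eval, NExpr.eval_ind, hN A hA hA', h50]⟩)
  constructor
  · ext v
    rw [State.mem_row, State.mem_row, appendSet, this.1 v (by rw [hn]; exact v.2)]
    simp
  · intro i hi
    ext v
    rw [State.mem_row, State.mem_row, appendSet, this.2 i hi]

/-- Add the members of the set in the array `B` to the set in the array `A`. -/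
def addSet (A B : ℕ) : Cmd :=
  fillNat A (.const 0) (.sub (.const 1)
    (.sub (.sub (.const 1) (.mem A (nvar 50))) (.mem B (nvar 50))))

theorem row_addSet {A B : ℕ} (hA : A ≠ 0) (hA' : A ≠ 50)
    (hB : B ≠ A) (hB' : B ≠ 50) {n : ℕ} {s : State} (hn : s.nat 0 0 0 = n) :
    ((addSet A B).run s).row n A 0 = s.row n A 0 ∪ s.row n B 0 := by
  have := (run_fillNat (A := A) (i := .const 0)
    (X := .sub (.const 1) (.sub (.sub (.const 1) (.mem A (nvar 50))) (.mem B (nvar 50))))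
    hA hA' s 0
    (fun v => 1 - (1 - (if s.nat A 0 v = 1 then 1 else 0) - (if s.nat B 0 v = 1 then 1 else 0)))
    (fun t v hv hN hR h50 h => ⟨rfl, by
      simp [NExpr.eval, NExpr.eval_ind, hN B hB hB', h50, h v le_rfl]⟩)).1
  ext v
  rw [Finset.mem_union, State.mem_row, State.mem_row, State.mem_row, addSet,
    this v (by rw [hn]; exact v.2)]
  split_ifs <;> simp_all

/-- Append the current component, its densest subgraph and the set that replaces it. -/
def recordComponent : Cmd :=
  seq (addSet 41 30) (seq (appendSet 2 30) (seq (appendSet 3 31) (seq (appendSet 4 35)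
    (setNat 1 (.const 0) (.const 0) (.add (nvar 1) (.const 1))))))

theorem run_recordComponent {n : ℕ} {s : State} (hn : s.nat 0 0 0 = n) :
    (recordComponent.run s).row n 41 0 = s.row n 41 0 ∪ s.row n 30 0 ∧
      (recordComponent.run s).nat 1 0 0 = s.nat 1 0 0 + 1 ∧
      (recordComponent.run s).nat 1 0 1 = s.nat 1 0 1 ∧
      (recordComponent.run s).row n 2 (s.nat 1 0 0) = s.row n 30 0 ∧
      (recordComponent.run s).row n 3 (s.nat 1 0 0) = s.row n 31 0 ∧
      (recordComponent.run s).row n 4 (s.nat 1 0 0) = s.row n 35 0 ∧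
      ∀ i, i ≠ s.nat 1 0 0 → (recordComponent.run s).row n 2 i = s.row n 2 i ∧
        (recordComponent.run s).row n 3 i = s.row n 3 i ∧
        (recordComponent.run s).row n 4 i = s.row n 4 i := by
  simp only [recordComponent, run_seq]
  have h1 := row_addSet (A := 41) (B := 30) (by decide) (by decide) (by decide) (by decide) hn
  set s₁ := (addSet 41 30).run s with hs₁
  have n1 : s₁.nat 0 0 0 = n := by rw [hs₁, run_nat_of_not_writes _ rfl, hn]
  have g1 : ∀ B, B ≠ 41 → B ≠ 50 → s₁.nat B = s.nat B := fun B h h' =>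
    run_nat_of_not_writes _ (by simp [addSet, fillNat, writesNat, h, h']) _
  have h2 := row_appendSet (A := 30) (B := 2) (by decide) (by decide) (by decide) (by decide)
    (by decide) n1
  set s₂ := (appendSet 2 30).run s₁ with hs₂
  have n2 : s₂.nat 0 0 0 = n := by rw [hs₂, run_nat_of_not_writes _ rfl, n1]
  have g2 : ∀ B, B ≠ 2 → B ≠ 50 → s₂.nat B = s₁.nat B := fun B h h' =>
    run_nat_of_not_writes _ (by simp [appendSet, fillNat, writesNat, h, h']) _
  have h3 := row_appendSet (A := 31) (B := 3) (by decide) (by decide) (by decide) (by decide)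
    (by decide) n2
  set s₃ := (appendSet 3 31).run s₂ with hs₃
  have n3 : s₃.nat 0 0 0 = n := by rw [hs₃, run_nat_of_not_writes _ rfl, n2]
  have g3 : ∀ B, B ≠ 3 → B ≠ 50 → s₃.nat B = s₂.nat B := fun B h h' =>
    run_nat_of_not_writes _ (by simp [appendSet, fillNat, writesNat, h, h']) _
  have h4 := row_appendSet (A := 35) (B := 4) (by decide) (by decide) (by decide) (by decide)
    (by decide) n3
  set s₄ := (appendSet 4 35).run s₃ with hs₄
  have g4 : ∀ B, B ≠ 4 → B ≠ 50 → s₄.nat B = s₃.nat B := fun B h h' =>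
    run_nat_of_not_writes _ (by simp [appendSet, fillNat, writesNat, h, h']) _
  set s₅ := (setNat 1 (.const 0) (.const 0) (.add (nvar 1) (.const 1))).run s₄ with hs₅
  have g5 : ∀ B, B ≠ 1 → s₅.nat B = s₄.nat B := fun B h =>
    run_nat_of_not_writes _ (by simp [writesNat, h]) _
  have p1 : s₁.nat 1 = s.nat 1 := g1 1 (by decide) (by decide)
  have p2 : s₂.nat 1 = s.nat 1 := by rw [g2 1 (by decide) (by decide), p1]
  have p3 : s₃.nat 1 = s.nat 1 := by rw [g3 1 (by decide) (by decide), p2]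
  have p4 : s₄.nat 1 = s.nat 1 := by rw [g4 1 (by decide) (by decide), p3]
  rw [p1] at h2
  rw [p2] at h3
  rw [p3] at h4
  have e41 : s₅.row n 41 0 = s₁.row n 41 0 := State.row_congr (by
    rw [g5 41 (by decide), g4 41 (by decide) (by decide), g3 41 (by decide) (by decide),
      g2 41 (by decide) (by decide)]) _ _
  have e2 : ∀ i, s₅.row n 2 i = s₂.row n 2 i := State.row_congr (by
    rw [g5 2 (by decide), g4 2 (by decide) (by decide), g3 2 (by decide) (by decide)]) _
  have e3 : ∀ i, s₅.row n 3 i = s₃.row n 3 i := State.row_congr (by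
    rw [g5 3 (by decide), g4 3 (by decide) (by decide)]) _
  have e4 : ∀ i, s₅.row n 4 i = s₄.row n 4 i := State.row_congr (g5 4 (by decide)) _
  have f30 : s₁.row n 30 0 = s.row n 30 0 := State.row_congr (g1 30 (by decide) (by decide)) _ _
  have f31 : s₂.row n 31 0 = s.row n 31 0 := State.row_congr (by
    rw [g2 31 (by decide) (by decide), g1 31 (by decide) (by decide)]) _ _
  have f35 : s₃.row n 35 0 = s.row n 35 0 := State.row_congr (by
    rw [g3 35 (by decide) (by decide), g2 35 (by decide) (by decide),
      g1 35 (by decide) (by decide)]) _ _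
  have f2 : ∀ i, s₁.row n 2 i = s.row n 2 i := State.row_congr (g1 2 (by decide) (by decide)) _
  have f3 : ∀ i, s₂.row n 3 i = s.row n 3 i := State.row_congr (by
    rw [g2 3 (by decide) (by decide), g1 3 (by decide) (by decide)]) _
  have f4 : ∀ i, s₃.row n 4 i = s.row n 4 i := State.row_congr (by
    rw [g3 4 (by decide) (by decide), g2 4 (by decide) (by decide),
      g1 4 (by decide) (by decide)]) _
  have q0 : s₅.nat 1 0 0 = s.nat 1 0 0 + 1 := by
    simp [hs₅, NExpr.eval, State.setNat_nat_self, p4]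
  have q1 : s₅.nat 1 0 1 = s.nat 1 0 1 := by
    simp [hs₅, NExpr.eval, State.setNat_nat_self, p4]
  simp only [e2, e3, e4, e41, h1, q0, q1, h2.1, h3.1, h4.1, f30, f31, f35, true_and]
  exact fun i hi => ⟨by rw [h2.2 i hi, f2], by rw [h3.2 i hi, f3], by rw [h4.2 i hi, f4]⟩

/-- Find the component of the counter `40` by splitting the whole graph. -/
def findComponent : Cmd :=
  seq (fillNat 26 (.const 0) (.const 1))
    (seq (setNat 28 (.const 0) (.const 0) (nvar 40))
      (seq (setReal 8 (.const 0) (.const 0) (.cell 1 (.const 0) (.const 0)))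
        (seq (setNat 29 (.const 0) (.const 0) (.const 0)) (seq narrow globalMinCut))))

/-- Narrowing the whole vertex set around `v` yields the greatest set around `v` without cuts below
`k`. With at least two vertices it is a maximal component; with one, no `k`-edge-connected set
contains `v`. -/
theorem run_findComponent {n : ℕ} (h2 : 2 ≤ n) {s : State} (hn : s.nat 0 0 0 = n)
    {G : WeightedGraph (Fin n)} (ha : s.matrix n 0 = G.adjWeight)
    {k : ℝ} (hk : s.real 1 0 0 = k) (hk0 : 0 < k) {v : Fin n} (hv : s.nat 40 0 0 = v) :
    (findComponent.run s).nat 24 0 0 = 1 ∧ v ∈ (findComponent.run s).row n 26 0 ∧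
        G.IsMaximalEdgeConnected k ((findComponent.run s).row n 26 0) ∨
      (findComponent.run s).nat 24 0 0 = 0 ∧ ∀ S, v ∈ S → ¬ G.IsEdgeConnected k S := by
  simp only [findComponent, run_seq]
  have hfill := (run_fillNat (A := 26) (i := .const 0) (X := .const 1) (by decide) (by decide)
    s 0 (fun _ => 1) (by simp [NExpr.eval])).1
  set s₁ := (fillNat 26 (.const 0) (.const 1)).run s with hs₁
  have e26 : s₁.row n 26 0 = Finset.univ := by
    ext x
    simpa using hfill x (by rw [hn]; exact x.2)
  have n1 : s₁.nat 0 0 0 = n := by rw [hs₁, run_nat_of_not_writes _ rfl, hn]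
  have e40 : s₁.nat 40 0 0 = v := by rw [hs₁, run_nat_of_not_writes _ rfl, hv]
  have r1 : s₁.real = s.real := by
    funext B
    exact run_real_of_not_writes _ (by simp [fillNat, writesReal]) _
  set s₂ := (setNat 29 (.const 0) (.const 0) (.const 0)).run
    ((setReal 8 (.const 0) (.const 0) (.cell 1 (.const 0) (.const 0))).run
      ((setNat 28 (.const 0) (.const 0) (nvar 40)).run s₁)) with hs₂
  have n2 : s₂.nat 0 0 0 = n := by
    rw [hs₂, run_nat_of_not_writes _ rfl, run_nat_of_not_writes _ rfl,
      run_nat_of_not_writes _ rfl, n1]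
  have f26 : s₂.row n 26 0 = Finset.univ := by
    rw [← e26]
    exact State.row_congr (by rw [hs₂, run_nat_of_not_writes _ rfl, run_nat_of_not_writes _ rfl,
      run_nat_of_not_writes _ rfl]) _ _
  have f28 : s₂.nat 28 0 0 = v := by
    rw [← e40]
    rfl
  have f29 : s₂.nat 29 0 0 = 0 := rfl
  have f8 : s₂.real 8 0 0 = k := by
    rw [← hk, ← r1]
    rfl
  have fa : s₂.matrix n 0 = G.adjWeight := by
    rw [← ha]
    unfold State.matrix
    rw [hs₂, run_real_of_not_writes _ rfl, run_real_of_not_writes _ rfl,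
      run_real_of_not_writes _ rfl, r1]
  obtain ⟨k1, -, k3, k4⟩ := run_narrow h2 n2 fa G.adjWeight_nonneg f26 f28 (Finset.mem_univ v)
    (P := (· < k)) (by intro x; rw [f8, f29]; simp)
  set s₃ := narrow.run s₂ with hs₃
  have n3 : s₃.nat 0 0 0 = n := by rw [hs₃, run_nat_of_not_writes _ rfl, n2]
  have a3 : s₃.matrix n 0 = G.adjWeight := by
    rw [← fa]
    unfold State.matrix
    rw [hs₃, run_real_of_not_writes _ rfl]
  have hflag := run_globalMinCut_flag h2 n3 a3 G.adjWeight_nonneg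
  rw [State.row_congr (A := 26) (run_nat_of_not_writes globalMinCut rfl _)]
  refine hflag.imp (fun h => ⟨h.1, k1, ?_, fun T hT hTk => ?_⟩) fun h => ⟨h.1, fun S hvS hS => ?_⟩
  · exact (G.isEdgeConnected_iff hk0).mpr ⟨h.2, k3⟩
  · have := k4 T (Finset.subset_univ T) (hT.1 k1) ((G.isEdgeConnected_iff hk0).mp hTk).2
    exact hT.2 this
  · obtain ⟨hcard, hno⟩ := (G.isEdgeConnected_iff hk0).mp hS
    exact h.2 (hcard.trans (Finset.card_le_card (k4 S (Finset.subset_univ S) hvS hno)))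

/-- The loop body of the algorithm. -/
def treatSeed : Cmd :=
  ite (.pos (.mem 41 (nvar 40))) skip
    (seq findComponent (ite (.pos (nvar 24))
      (seq (copySet 30 26) (seq processComponent (seq updateAnswer recordComponent))) skip))

/-- The bicriteria approximation algorithm. -/
def bicriteria : Cmd := forN 40 treatSeed

/-- The components recorded in the memory are treated correctly, and the seeds in `U` are
finished. -/
structure _root_.RealRAM.State.IsPartialRun (s : State) {n : ℕ} (G : WeightedGraph (Fin n))
    (k γ : ℝ) (U : Fin n → Prop) : Prop where
  maximal : ∀ i < s.nat 1 0 0, G.IsMaximalEdgeConnected k (s.row n 2 i)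
  injective : ∀ i < s.nat 1 0 0, ∀ j < s.nat 1 0 0, s.row n 2 i = s.row n 2 j → i = j
  densest : ∀ i < s.nat 1 0 0, G.IsDensestIn (s.row n 2 i) (s.row n 3 i)
  star_then : ∀ i < s.nat 1 0 0, k ≤ γ * G.threshold (s.row n 3 i) →
    G.IsMaderVariant (s.row n 3 i) (s.row n 4 i)
  star_else : ∀ i < s.nat 1 0 0, ¬ k ≤ γ * G.threshold (s.row n 3 i) →
    s.row n 4 i = s.row n 2 i
  covered : ∀ v, v ∈ s.row n 41 0 ↔ ∃ i < s.nat 1 0 0, v ∈ s.row n 2 i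
  finished : ∀ v, U v → ∀ S, v ∈ S → G.IsMaximalEdgeConnected k S → v ∈ s.row n 41 0
  answer : s.nat 1 0 0 = 0 ∧ s.nat 1 0 1 = 0 ∨
    s.nat 1 0 1 = 1 ∧ (∃ i < s.nat 1 0 0, s.row n 5 0 = s.row n 4 i ∧
      s.real 14 0 0 = G.density (s.row n 4 i)) ∧
      ∀ j < s.nat 1 0 0, G.density (s.row n 4 j) ≤ s.real 14 0 0

/-- Skipping covered seeds prevents repetitions, and an uncovered seed is finished either by
recording its component or because it lies in none. -/
theorem run_treatSeed {n : ℕ} (h2 : 2 ≤ n) {s : State} (hn : s.nat 0 0 0 = n)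
    {G : WeightedGraph (Fin n)} (ha : s.matrix n 0 = G.adjWeight)
    (hE : G.graph.edgeSet.Nonempty) {k γ : ℝ} (hk : s.real 1 0 0 = k) (hγ : s.real 1 0 1 = γ)
    (hk0 : 0 < k) {v : Fin n} (hv : s.nat 40 0 0 = v) {U : Fin n → Prop}
    (H : s.IsPartialRun G k γ U) :
    (treatSeed.run s).IsPartialRun G k γ fun u => U u ∨ u = v := by
  have mem : s.nat 41 0 v = 1 ↔ v ∈ s.row n 41 0 := by rw [State.mem_row]
  by_cases hcov : v ∈ s.row n 41 0
  · rw [treatSeed, run_ite_true, run_skip]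
    · refine { H with finished := fun u hu S hS hmax => ?_ }
      rcases hu with hu | rfl
      · exact H.finished u hu S hS hmax
      · exact hcov
    · simp [BExpr.Holds, NExpr.eval, NExpr.eval_ind, hv, mem, hcov]
  rw [treatSeed, run_ite_false]
  swap
  · simp [BExpr.Holds, NExpr.eval, NExpr.eval_ind, hv, mem, hcov]
  rw [run_seq]
  have hfind := run_findComponent h2 hn ha hk hk0 hv
  set s₁ := findComponent.run s with hs₁
  have N1 : ∀ B, findComponent.writesNat B = false → s₁.nat B = s.nat B := fun B h =>
    run_nat_of_not_writes _ h _
  have R1 : ∀ B, findComponent.writesReal B = false → s₁.real B = s.real B := fun B h =>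
    run_real_of_not_writes _ h _
  rcases hfind with ⟨c1, c2, c3⟩ | ⟨c1, c2⟩
  swap
  · rw [run_ite_false, run_skip]
    swap
    · simp [BExpr.Holds, NExpr.eval, c1]
    have e1 := N1 1 rfl
    have e2 := State.row_congr (N1 2 rfl) n
    have e3 := State.row_congr (N1 3 rfl) n
    have e4 := State.row_congr (N1 4 rfl) n
    have e5 := State.row_congr (N1 5 rfl) n
    have e41 := State.row_congr (N1 41 rfl) n
    have e14 := R1 14 rfl
    constructor <;> simp only [e1, e2, e3, e4, e5, e41, e14]
    · exact H.maximal
    · exact H.injective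
    · exact H.densest
    · exact H.star_then
    · exact H.star_else
    · exact H.covered
    · rintro u (hu | rfl) S hS hmax
      · exact H.finished u hu S hS hmax
      · exact absurd hmax.1 (c2 S hS)
    · exact H.answer
  rw [run_ite_true]
  swap
  · simp [BExpr.Holds, NExpr.eval, c1]
  simp only [run_seq]
  set C := s₁.row n 26 0 with hC
  have n1 : s₁.nat 0 0 0 = n := by rw [N1 0 rfl, hn]
  have h30 := row_copySet (C := 30) (A := 26) (by decide) (by decide) (by decide) (by decide) n1
  set s₂ := (copySet 30 26).run s₁ with hs₂
  have N2 : ∀ B, (copySet 30 26).writesNat B = false → s₂.nat B = s₁.nat B := fun B h =>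
    run_nat_of_not_writes _ h _
  have R2 : ∀ B, (copySet 30 26).writesReal B = false → s₂.real B = s₁.real B := fun B h =>
    run_real_of_not_writes _ h _
  have n2 : s₂.nat 0 0 0 = n := by rw [N2 0 rfl, n1]
  have a2 : s₂.matrix n 0 = G.adjWeight := by
    rw [← ha]
    unfold State.matrix
    rw [R2 0 rfl, R1 0 rfl]
  obtain ⟨q1, q2, q3, q4⟩ := run_processComponent h2 n2 a2 hE (k := k) (γ := γ)
    (by rw [R2 1 rfl, R1 1 rfl, hk]) (by rw [R2 1 rfl, R1 1 rfl, hγ]) hk0 h30 c3.1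
  set s₃ := processComponent.run s₂ with hs₃
  have N3 : ∀ B, processComponent.writesNat B = false → s₃.nat B = s₂.nat B := fun B h =>
    run_nat_of_not_writes _ h _
  have R3 : ∀ B, processComponent.writesReal B = false → s₃.real B = s₂.real B := fun B h =>
    run_real_of_not_writes _ h _
  have n3 : s₃.nat 0 0 0 = n := by rw [N3 0 rfl, n2]
  have a3 : s₃.matrix n 0 = G.adjWeight := by
    rw [← a2]
    unfold State.matrix
    rw [R3 0 rfl]
  have e1 : s₃.nat 1 = s.nat 1 := by rw [N3 1 rfl, N2 1 rfl, N1 1 rfl]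
  have e2 := State.row_congr (show s₃.nat 2 = s.nat 2 by rw [N3 2 rfl, N2 2 rfl, N1 2 rfl]) n
  have e3 := State.row_congr (show s₃.nat 3 = s.nat 3 by rw [N3 3 rfl, N2 3 rfl, N1 3 rfl]) n
  have e4 := State.row_congr (show s₃.nat 4 = s.nat 4 by rw [N3 4 rfl, N2 4 rfl, N1 4 rfl]) n
  have e5 := State.row_congr (show s₃.nat 5 = s.nat 5 by rw [N3 5 rfl, N2 5 rfl, N1 5 rfl]) n
  have e41 := State.row_congr (show s₃.nat 41 = s.nat 41 by
    rw [N3 41 rfl, N2 41 rfl, N1 41 rfl]) n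
  have e14 : s₃.real 14 = s.real 14 := by rw [R3 14 rfl, R2 14 rfl, R1 14 rfl]
  have hupd := run_updateAnswer n3 a3 (by
    rw [e1]
    exact H.answer.imp And.right And.left)
  rw [e1, e5, e14] at hupd
  set s₄ := updateAnswer.run s₃ with hs₄
  have N4 : ∀ B, updateAnswer.writesNat B = false → s₄.nat B = s₃.nat B := fun B h =>
    run_nat_of_not_writes _ h _
  have n4 : s₄.nat 0 0 0 = n := by rw [N4 0 rfl, n3]
  obtain ⟨u1, u2, u3⟩ := hupd
  have f2 := State.row_congr (N4 2 rfl) n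
  have f3 := State.row_congr (N4 3 rfl) n
  have f4 := State.row_congr (N4 4 rfl) n
  have f30 := State.row_congr (N4 30 rfl) n
  have f31 := State.row_congr (N4 31 rfl) n
  have f35 := State.row_congr (N4 35 rfl) n
  have f41 := State.row_congr (N4 41 rfl) n
  obtain ⟨w41, wp, wflag, w2, w3, w4, wold⟩ := run_recordComponent n4
  rw [u1] at wp w2 w3 w4 wold
  rw [u2] at wflag
  simp only [f2, f3, f4, f30, f31, f35, f41, e2, e3, e4, e41, q1] at w41 w2 w3 w4 wold
  set s₅ := recordComponent.run s₄ with hs₅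
  have g5 : s₅.row n 5 0 = s₄.row n 5 0 := State.row_congr (by
    rw [hs₅, run_nat_of_not_writes _ rfl]) _ _
  have g14 : s₅.real 14 = s₄.real 14 := by rw [hs₅, run_real_of_not_writes _ rfl]
  set p := s.nat 1 0 0 with hp
  -- The new component contains `v`, which no recorded component does.
  have hCnew : ∀ i < p, s.row n 2 i ≠ C := by
    intro i hi heq
    exact hcov ((H.covered v).mpr ⟨i, hi, heq ▸ c2⟩)
  have old : ∀ i < p, s₅.row n 2 i = s.row n 2 i ∧ s₅.row n 3 i = s.row n 3 i ∧
      s₅.row n 4 i = s.row n 4 i := fun i hi => wold i (by omega)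
  have cases_lt : ∀ i, i < p + 1 → i < p ∨ i = p := fun i hi => by omega
  refine ⟨?_, ?_, ?_, ?_, ?_, ?_, ?_, ?_⟩
  · intro i hi
    rcases cases_lt i (wp ▸ hi) with h | rfl
    · rw [(old i h).1]
      exact H.maximal i h
    · rw [w2]
      exact c3
  · intro i hi j hj heq
    rcases cases_lt i (wp ▸ hi) with h | rfl <;> rcases cases_lt j (wp ▸ hj) with h' | rfl
    · rw [(old i h).1, (old j h').1] at heq
      exact H.injective i h j h' heq
    · rw [(old i h).1, w2] at heq
      exact absurd heq (hCnew i h)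
    · rw [(old j h').1, w2] at heq
      exact absurd heq.symm (hCnew j h')
    · rfl
  · intro i hi
    rcases cases_lt i (wp ▸ hi) with h | rfl
    · rw [(old i h).1, (old i h).2.1]
      exact H.densest i h
    · rw [w2, w3]
      exact q2
  · intro i hi
    rcases cases_lt i (wp ▸ hi) with h | rfl
    · rw [(old i h).2.1, (old i h).2.2]
      exact H.star_then i h
    · rw [w3, w4]
      exact q3
  · intro i hi
    rcases cases_lt i (wp ▸ hi) with h | rfl
    · rw [(old i h).1, (old i h).2.1, (old i h).2.2]
      exact H.star_else i h
    · rw [w2, w3, w4]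
      exact q4
  · intro u
    rw [w41, Finset.mem_union, H.covered, wp]
    constructor
    · rintro (⟨i, hi, hu⟩ | hu)
      · exact ⟨i, by omega, by rwa [(old i hi).1]⟩
      · exact ⟨p, by omega, by rwa [w2]⟩
    · rintro ⟨i, hi, hu⟩
      rcases cases_lt i hi with h | rfl
      · rw [(old i h).1] at hu
        exact Or.inl ⟨i, h, hu⟩
      · rw [w2] at hu
        exact Or.inr hu
  · rintro u (hu | rfl) S hS hmax
    · rw [w41]
      exact Finset.mem_union_left _ (H.finished u hu S hS hmax)
    · rw [w41]
      exact Finset.mem_union_right _ c2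
  · right
    refine ⟨wflag, ?_⟩
    rw [wp, g5, g14]
    rcases u3 with ⟨o1, o2, o3, o4⟩ | ⟨o1, o2, o3⟩
    · rcases H.answer with h | ⟨-, ⟨i, hi, hi5, hi14⟩, hbest⟩
      · omega
      · refine ⟨⟨i, by omega, ?_, ?_⟩, fun j hj => ?_⟩
        · rw [o2, hi5, (old i hi).2.2]
        · rw [o3, hi14, (old i hi).2.2]
        · rw [o3]
          rcases cases_lt j hj with h | rfl
          · rw [(old j h).2.2]
            exact hbest j h
          · rw [w4]
            exact o4
    · refine ⟨⟨p, by omega, ?_, ?_⟩, fun j hj => ?_⟩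
      · rw [o1, w4]
      · rw [o2, w4]
      · rw [o2]
        rcases cases_lt j hj with h | rfl
        · rw [(old j h).2.2]
          rcases H.answer with h' | ⟨hf, -, hbest⟩
          · omega
          · exact (hbest j h).trans (o3 hf)
        · rw [w4]

/-! ### From the input to the decoded execution -/

theorem matrix_input {n : ℕ} (G : WeightedGraph (Fin n)) (k γ : ℝ) :
    (input G k γ).matrix n 0 = G.adjWeight := by
  funext u v
  simp [State.matrix, input, WeightedGraph.adjWeight]

theorem isExecution_bicriteria {n : ℕ} {G : WeightedGraph (Fin n)}
    (hE : G.graph.edgeSet.Nonempty) {k : ℝ} (γ : ℝ) (hk : 0 < k) :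
    ((bicriteria.run (input G k γ)).decode n).IsExecution G k γ := by
  -- The two ends of an edge are distinct; `n ≥ 2` is needed for the bound `n ^ 5` on the potential.
  have h2 : 2 ≤ n := by
    obtain ⟨e, he⟩ := hE
    induction e with
    | _ x y =>
      have hne : x ≠ y := (show G.graph.Adj x y from he).ne
      have := x.2
      have := y.2
      by_contra hlt
      exact hne (Fin.ext (by omega))
  set s := input G k γ with hs
  have hn : s.nat 0 0 0 = n := by simp [hs, input]
  have ha : s.matrix n 0 = G.adjWeight := matrix_input G k γ
  have hk' : s.real 1 0 0 = k := by simp [hs, input]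
  have hγ' : s.real 1 0 1 = γ := by simp [hs, input]
  have hz : ∀ A i j, A ≠ 0 → s.nat A i j = 0 := fun A i j h => by simp [hs, input, h]
  have := forN_induct (A := 40) (P := treatSeed) rfl s
    (fun m t => t.IsPartialRun G k γ fun u => u < m)
    (fun m t a h => ⟨h.maximal, h.injective, h.densest, h.star_then, h.star_else, h.covered,
      h.finished, h.answer⟩) ?_ ?_
  · rw [hn] at this
    change (bicriteria.run s).IsPartialRun G k γ fun u => u < n at this
    set t := bicriteria.run s
    refine ⟨?_, ?_, ?_, ?_, ?_, ?_, ?_⟩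
    · exact fun i j hij => Fin.ext (this.injective i i.2 j j.2 hij)
    · intro S
      constructor
      · rintro ⟨i, rfl⟩
        exact this.maximal i i.2
      · intro hS
        have hcard := ((G.isEdgeConnected_iff hk).mp hS.1).1
        obtain ⟨v, hv⟩ := Finset.card_pos.mp (show 0 < S.card by omega)
        obtain ⟨i, hi, hvi⟩ := (this.covered v).mp (this.finished v v.2 S hv hS)
        -- Completeness of the family: any vertex of `S` has been a seed and is covered by a
        -- recorded component, and maximal components with a common vertex coincide.
        exact ⟨⟨i, hi⟩, (this.maximal i hi).eq_of_mem hk hS hvi hv⟩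
    · intro hp
      rcases this.answer with ⟨-, h⟩ | ⟨-, ⟨i, hi, -⟩, -⟩
      · simp [State.decode, h]
      · have : t.nat 1 0 0 = 0 := hp
        omega
    · exact fun i => this.densest i i.2
    · exact fun i => this.star_then i i.2
    · exact fun i => this.star_else i i.2
    · intro hp
      rcases this.answer with ⟨h, -⟩ | ⟨hf, ⟨i, hi, hi5, hi14⟩, hbest⟩
      · exact absurd h hp
      · refine ⟨⟨i, hi⟩, ?_, fun j => ?_⟩
        · simp [State.decode, hf, hi5]
        · have := hbest j j.2
          rw [hi14] at this
          exact this
  · have hp : s.nat 1 0 0 = 0 := hz _ _ _ (by decide)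
    refine ⟨?_, ?_, ?_, ?_, ?_, ?_, ?_, Or.inl ⟨hp, hz _ _ _ (by decide)⟩⟩
    · simp [hp]
    · simp [hp]
    · simp [hp]
    · simp [hp]
    · simp [hp]
    · simp [hp, hz]
    · simp
  · intro m t hm hc hN hR hI
    rw [hn] at hm
    have := run_treatSeed h2 (by rw [hN 0 rfl, hn]) (G := G)
      (by rw [← ha]; unfold State.matrix; rw [hR 0 rfl]) hE (by rw [hR 1 rfl, hk'])
      (by rw [hR 1 rfl, hγ']) hk (v := ⟨m, hm⟩) hc hI
    refine { this with finished := fun u hu => this.finished u ?_ }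
    rcases Nat.lt_succ_iff_lt_or_eq.mp hu with h | h
    · exact Or.inl h
    · exact Or.inr (Fin.ext h)

end RealRAM.Cmd

/-! ### The theorem -/

theorem theorem5 :
    -- The algorithm (with `γ` as a parameter in the input) runs in polynomial time.
    (∃ (P : RealRAM.Program) (q : Polynomial ℕ),
      ∀ (n : ℕ) (G : WeightedGraph (Fin n)), G.graph.Connected → G.graph.edgeSet.Nonempty →
      ∀ γ : ℝ, 1 ≤ γ → γ ≤ 2 → ∀ k : ℝ, 0 < k →
        ∃ (t : ℕ) (s : RealRAM.State), RealRAM.Exec P (RealRAM.input G k γ) t s ∧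
          t ≤ q.eval n ∧ (s.decode n).IsExecution G k γ) ∧
    -- Whatever choices it makes, its answer has the bicriteria approximation guarantee.
    (∀ {V : Type*} [Fintype V] (G : WeightedGraph V),
      G.graph.Connected → G.graph.edgeSet.Nonempty →
      ∀ γ : ℝ, 1 ≤ γ → γ ≤ 2 → ∀ k : ℝ, 0 < k →
      ∀ r : BicriteriaRun V, r.IsExecution G k γ →
        G.IsBicriteriaAnswer (γ / 4 * (G.wMin / G.wMax)) (1 / γ) k r.out) := by
  refine ⟨?_, fun G _ hE γ hγ hγ' k hk r hr => hr.isBicriteriaAnswer hE hγ hγ' hk⟩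
  obtain ⟨q, hq⟩ := RealRAM.Cmd.exec_compile RealRAM.Cmd.bicriteria rfl
  refine ⟨RealRAM.Cmd.bicriteria.compile, q, fun n G _ hE γ _ _ k hk => ?_⟩
  obtain ⟨t, ht, htq⟩ := hq (RealRAM.input G k γ)
  refine ⟨t, _, ht, ?_, RealRAM.Cmd.isExecution_bicriteria hE γ hk⟩
  simpa [RealRAM.input] using htq
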